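/- Let $d\in\mathbb N$, let $K\subset\mathbb{R}^{d}$ be finite and nonempty, and let $h:[0,+\infty)\to[0,+\infty)$ be of class $C^{1}$ (one-sided derivative at $0$) and strictly increasing. Put $f_K(x)=-\tfrac12\mathrm{dist}(x,K)^2$ and let $\nabla f_K(x)$ be its extended gradient, i.e. the element of minimal norm of the Gateaux subdifferential $$\partial f_K(x)=\Big\{\xi\in\mathbb{R}^d:\ \liminf_{t\to0^+}\frac{f_K(x+tv)-f_K(x)}{t}\ge \xi\cdot v\ \ \forall v\in\mathbb{R}^d\Big\}.$$ Let $\mathrm{opt}(x)=\{y\in K: |x-y|=\mathrm{dist}(x,K)\}$, let $\eta(x)$ be the projection of $x$ on the convex hull of $\mathrm{opt}(x)$, let $\mathcal E=\eta(\mathbb{R}^d)$ and, for $\eta_*\in\mathcal E$, $Q_{\eta_*}=\{x\in\mathbb{R}^d:\eta(x)=\eta_*\}$. For $\delta>0$ and $x_0,x_\delta\in\mathbb{R}^d$ consider on $C([0,\delta],\mathbb{R}^d)$, with the topology of uniform convergence, the functional $$I(\gamma)=\int_0^\delta|\dot\gamma|^2+h(|\nabla f_K(\gamma)|^2)\,dt$$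 if $\gamma$ is absolutely continuous with $\gamma(0)=x_0$ and $\gamma(\delta)=x_\delta$, and $I(\gamma)=+\infty$ otherwise. Let $\gamma$ be a local minimizer of $I$ with $I(\gamma)<+\infty$. Call $t\in[0,\delta]$ a nondegenerate shock time of $\gamma$ if $\eta\circ\gamma$ is not constant on any neighbourhood of $t$ in $[0,\delta]$, and let $NDS(\gamma)$ be the set of these times. Then: (i) $NDS(\gamma)$ is finite, $NDS(\gamma)=\{t_1<\dots<t_\ell\}\subset[0,\delta]$ with $\ell\ge0$, and $\eta\circ\gamma$ is constant on each connected component of $[0,\delta]\setminus\{t_1,\dots,t_\ell\}$. (ii) Set $t_0=0$ and $t_{\ell+1}=\delta$. For every $i\in\{0,\dots,\ell\}$, $\gamma$ is $C^{1,1}$ on $[t_i,t_{i+1}]$ (differentiable, one-sidedly at the endpoints, with Lipschitz derivative), there is $\eta_i\in\mathcal E$ with $\gamma((t_i,t_{i+1}))\subseteq Q_{\eta_i}$, and $$|\ddot\gamma(r)|\le h'(|\gamma(r)-\eta_i|^2)\,|\gamma(r)-\eta_i|\qquad\text{for a.e. } r\in(t_i,t_{i+1}).$$ -/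

import Mathlib

open Set Filter Topology MeasureTheory
open scoped ENNReal NNReal

noncomputable section

/-- The point of `C` nearest to `x` (for `C` nonempty, closed and convex it exists and is unique,
see `nearestPoint_spec` and `nearestPoint_unique`). -/
def nearestPoint {d : ℕ} (C : Set (EuclideanSpace ℝ (Fin d))) (x : EuclideanSpace ℝ (Fin d)) :
    EuclideanSpace ℝ (Fin d) :=
  Classical.epsilon fun y => y ∈ C ∧ ∀ z ∈ C, ‖x - y‖ ≤ ‖x - z‖

theorem nearestPoint_spec {d : ℕ} {C : Set (EuclideanSpace ℝ (Fin d))} (hne : C.Nonempty)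
    (hcl : IsClosed C) (x : EuclideanSpace ℝ (Fin d)) :
    nearestPoint C x ∈ C ∧ ∀ z ∈ C, ‖x - nearestPoint C x‖ ≤ ‖x - z‖ := by
  refine Classical.epsilon_spec
    (p := fun y : EuclideanSpace ℝ (Fin d) => y ∈ C ∧ ∀ z ∈ C, ‖x - y‖ ≤ ‖x - z‖) ?_
  obtain ⟨y, hy, hxy⟩ := hcl.exists_infDist_eq_dist hne x
  refine ⟨y, hy, fun z hz => ?_⟩
  rw [← dist_eq_norm, ← dist_eq_norm, ← hxy]
  exact Metric.infDist_le_dist_of_mem hz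

theorem nearestPoint_unique {d : ℕ} {C : Set (EuclideanSpace ℝ (Fin d))} (hC : Convex ℝ C)
    {x y : EuclideanSpace ℝ (Fin d)} (hy : y ∈ C) (hmin : ∀ z ∈ C, ‖x - y‖ ≤ ‖x - z‖) :
    nearestPoint C x = y := by
  obtain ⟨hw, hwmin⟩ := Classical.epsilon_spec
    (p := fun y : EuclideanSpace ℝ (Fin d) => y ∈ C ∧ ∀ z ∈ C, ‖x - y‖ ≤ ‖x - z‖) ⟨y, hy, hmin⟩
  change nearestPoint C x ∈ C at hw
  change ∀ z ∈ C, ‖x - nearestPoint C x‖ ≤ ‖x - z‖ at hwmin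
  set w := nearestPoint C x
  have heq : ‖x - w‖ = ‖x - y‖ := le_antisymm (hwmin y hy) (hmin w hw)
  have hm : (1 / 2 : ℝ) • w + (1 / 2 : ℝ) • y ∈ C :=
    hC hw hy (by norm_num) (by norm_num) (by norm_num)
  have h1 := hmin _ hm
  have h2 : x - ((1 / 2 : ℝ) • w + (1 / 2 : ℝ) • y) = (1 / 2 : ℝ) • ((x - w) + (x - y)) := by
    module
  rw [h2, norm_smul] at h1
  have h3 := parallelogram_law_with_norm ℝ (x - w) (x - y)
  have h4 : (x - w) - (x - y) = y - w := by abel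
  rw [h4, heq] at h3
  norm_num at h1
  have h5 : ‖y - w‖ = 0 := by
    have := norm_nonneg (y - w)
    have := norm_nonneg (x - y)
    nlinarith
  exact (sub_eq_zero.1 (norm_eq_zero.1 h5)).symm

/-- The Gateaux subdifferential of a real valued function `f` at `x`: the vectors `ξ` with
`liminf_{t → 0+} (f (x + t v) - f x) / t ≥ ⟨ξ, v⟩` for every direction `v`. -/
def gateauxSubdiff {d : ℕ} (f : EuclideanSpace ℝ (Fin d) → ℝ) (x : EuclideanSpace ℝ (Fin d)) :
    Set (EuclideanSpace ℝ (Fin d)) :=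
  {ξ | ∀ v : EuclideanSpace ℝ (Fin d),
    ((inner ℝ ξ v : ℝ) : EReal) ≤
      liminf (fun t : ℝ => (((f (x + t • v) - f x) / t : ℝ) : EReal)) (𝓝[>] 0)}

/-- The extended gradient of `f` at `x`: the element of minimal norm of the subdifferential. -/
def extGrad {d : ℕ} (f : EuclideanSpace ℝ (Fin d) → ℝ) (x : EuclideanSpace ℝ (Fin d)) :
    EuclideanSpace ℝ (Fin d) :=
  nearestPoint (gateauxSubdiff f x) 0

/-- The opposite squared distance function `f_K = - dist_K ^ 2 / 2`. -/
def oppSqDist {d : ℕ} (K : Set (EuclideanSpace ℝ (Fin d))) (x : EuclideanSpace ℝ (Fin d)) : ℝ :=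
  -(Metric.infDist x K) ^ 2 / 2

/-- The optimality class of `x`: the points of `K` at minimal distance from `x`. -/
def optClass {d : ℕ} (K : Set (EuclideanSpace ℝ (Fin d))) (x : EuclideanSpace ℝ (Fin d)) :
    Set (EuclideanSpace ℝ (Fin d)) :=
  {y ∈ K | Metric.infDist x K = ‖x - y‖}

/-- `η_K x`: the projection of `x` on the convex hull of its optimality class. -/
def etaMap {d : ℕ} (K : Set (EuclideanSpace ℝ (Fin d))) (x : EuclideanSpace ℝ (Fin d)) :
    EuclideanSpace ℝ (Fin d) :=
  nearestPoint (convexHull ℝ (optClass K x)) x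

/-- The potential zone `Q_η`. -/
def potentialZone {d : ℕ} (K : Set (EuclideanSpace ℝ (Fin d))) (η : EuclideanSpace ℝ (Fin d)) :
    Set (EuclideanSpace ℝ (Fin d)) :=
  {x | etaMap K x = η}

open Classical in
/-- The action `∫₀^δ |γ'|² + h (|∇f|² (γ))` with endpoint constraints, on `C([0, δ], ℝ^d)`;
it is `+∞` on curves that are not absolutely continuous or have other endpoints. -/
def action {d : ℕ} (h : ℝ → ℝ) (f : EuclideanSpace ℝ (Fin d) → ℝ) {δ : ℝ} (hδ : 0 ≤ δ)
    (x₀ x₁ : EuclideanSpace ℝ (Fin d)) (γ : C(Icc (0 : ℝ) δ, EuclideanSpace ℝ (Fin d))) : ℝ≥0∞ :=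
  if AbsolutelyContinuousOnInterval (IccExtend hδ γ) 0 δ ∧
      γ ⟨0, left_mem_Icc.2 hδ⟩ = x₀ ∧ γ ⟨δ, right_mem_Icc.2 hδ⟩ = x₁ then
    ∫⁻ r in Ioo 0 δ, ENNReal.ofReal
      (‖deriv (IccExtend hδ γ) r‖ ^ 2 + h (‖extGrad f (IccExtend hδ γ r)‖ ^ 2))
  else ⊤

/-- Local minimizers of the action in `C([0, δ], ℝ^d)` with the uniform topology (the action being
finite at the curve, so that the curve satisfies the endpoint constraints). -/
def IsLocalMinimizer {d : ℕ} (h : ℝ → ℝ) (f : EuclideanSpace ℝ (Fin d) → ℝ) {δ : ℝ} (hδ : 0 ≤ δ)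
    (x₀ x₁ : EuclideanSpace ℝ (Fin d)) (γ : C(Icc (0 : ℝ) δ, EuclideanSpace ℝ (Fin d))) : Prop :=
  action h f hδ x₀ x₁ γ < ⊤ ∧ IsLocalMin (action h f hδ x₀ x₁) γ

/-- The nondegenerate shock times of `γ`: the times `t` in `[0, δ]` such that `η_K ∘ γ` is not
constant on any neighbourhood of `t` in `[0, δ]`. -/
def nondegenerateShocks {d : ℕ} (K : Set (EuclideanSpace ℝ (Fin d))) {δ : ℝ}
    (γ : C(Icc (0 : ℝ) δ, EuclideanSpace ℝ (Fin d))) : Set (Icc (0 : ℝ) δ) :=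
  {t | ∀ I ∈ 𝓝 t, ¬ ∃ c, ∀ s ∈ I, etaMap K (γ s) = c}

/-- `u` is of class `C^{1,1}` on `[a, b]`: it is differentiable on `[a, b]` (one-sidedly at the
endpoints) with a Lipschitz derivative. -/
def IsC11On {d : ℕ} (u : ℝ → EuclideanSpace ℝ (Fin d)) (a b : ℝ) : Prop :=
  ∃ v : ℝ → EuclideanSpace ℝ (Fin d),
    (∀ r ∈ Icc a b, HasDerivWithinAt u (v r) (Icc a b) r) ∧
      ∃ L : ℝ≥0, LipschitzOnWith L v (Icc a b)

end

/-!
Write `η = etaMap K`. The extended gradient of `f_K` at `x` is `η x - x`, so the action is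
`∫ |γ'|² + F(γ)` with `F x = h (|x - η x|²)`. On each of the finitely many potential zones
`Q_p = {η = p}` this potential is the `C¹` function `h (|· - p|²)`, but in the whole space it is only
lower semicontinuous. Three facts about the geometry of `F` are used.

* Optimality classes can only shrink near a given point `x`, and if `opt z ⊆ opt x`, then `x - z` is
  orthogonal to the affine hull of `opt z`. Hence, for `z` near `x`, the value `η z` is determined
  by `opt z` as the projection of `x` on its convex hull, and `F z` is close to `h (|x - η z|²)`,
  which takes finitely many values.
* For each `p`, the set `hullZone K p` of the points `x` such that `p` lies in the convex hull of
  `opt x` is closed and convex, it contains `Q_p`, and `F ≤ h (|· - p|²)` on it.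
* Near a point `x` the optimality classes are constant along the rays issuing from `x`, the point
  `x` excluded.

**Finiteness of the shock times.** It suffices that `η` is constant along the minimizer `u`
immediately to the right of each time `a`; time reversal gives the same to the left, and compactness
of `[0, δ]` concludes. Let `p` be, among the values of `η ∘ u` taken at times arbitrarily close to
`a` from the right, one which is nearest to `u a`. If `η (u s) = p`, comparing `u` on `[a, s]` with
the straight segment from `u a` to `u s`, along which the potential is almost at its minimum, bounds
the energy excess of `u`, so that `u` is close to that segment. After rescaling,
these segments have limits by the Lipschitz bound `IsLocMin.exists_norm_sub_le`; the limits are rays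
on which `η = p`: the competitor which follows the ray first and then joins `u`
would otherwise have a smaller action (`IsLocMin.etaMap_ray_eq`). Therefore, away from `a`, the
other values of `η ∘ u` on `[a, s]` are strictly farther from `u a` than `p`, with a potential
larger by a fixed amount. Between two times with value `p` such values cannot occur, because
projecting `u` on the convex set `hullZone K p` would strictly decrease the potential part of the
action without increasing the kinetic one (`IsLocMin.etaMap_eq_of_endpoints`). So `η ∘ u = p` on the
second half of `[a, s]` (`IsLocMin.eventually_eq_on_second_half`), and iterating on dyadic intervals
`η ∘ u = p` immediately after `a`.

**Regularity.** On an interval on which `η ∘ u = p`, the chords of `u` stay in `hullZone K p` by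
convexity, where `F ≤ h (|· - p|²)`. The one-sided first variation of the action in the direction of
a chord of velocity `S` gives `∫ |u' - S|² ≤ ∫ ⟪h' (|u - p|²) (u - p), chord - u⟫`
(`IsLocMin.chord_inequality`). By the Cauchy–Schwarz inequality, the distance of `u` from a chord is
then at most quadratic in the length of the time interval, which implies that `u` is of class
`C^{1,1}` (`isC11On_of_chord_bound`). Expanding the same inequality to second order on small
intervals around a time `r` at which `u'` is differentiable gives
`|u''|² ≤ ⟪h' (|u - p|²) (u - p), u''⟫` at `r` (`norm_sq_le_inner_of_chord_inequality`), which
implies the bound on the acceleration.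
-/

/-! ### Optimality classes and the map `etaMap` -/

/-- Euclidean space of dimension `d`. -/
abbrev Euc (d : ℕ) : Type := EuclideanSpace ℝ (Fin d)

section Geometry

variable {d : ℕ} {K : Set (Euc d)}

theorem mem_optClass_iff (hne : K.Nonempty) {x y : Euc d} :
    y ∈ optClass K x ↔ y ∈ K ∧ ∀ z ∈ K, ‖x - y‖ ≤ ‖x - z‖ := by
  refine and_congr_right fun hy => ⟨fun h z hz => ?_, fun h => le_antisymm ?_ ?_⟩
  · rw [← h, ← dist_eq_norm]
    exact Metric.infDist_le_dist_of_mem hz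
  · rw [← dist_eq_norm]
    exact Metric.infDist_le_dist_of_mem hy
  · rw [Metric.le_infDist hne]
    intro z hz
    rw [dist_eq_norm]
    exact h z hz

theorem optClass_subset (x : Euc d) : optClass K x ⊆ K := fun _ h => h.1

theorem optClass_nonempty (hK : K.Finite) (hne : K.Nonempty) (x : Euc d) :
    (optClass K x).Nonempty := by
  obtain ⟨y, hy, h⟩ := hK.isClosed.exists_infDist_eq_dist hne x
  exact ⟨y, hy, by rw [h, dist_eq_norm]⟩

theorem isClosed_convexHull_optClass (hK : K.Finite) (x : Euc d) :
    IsClosed (convexHull ℝ (optClass K x)) :=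
  ((hK.subset (optClass_subset x)).isCompact_convexHull ℝ).isClosed

theorem etaMap_mem (hK : K.Finite) (hne : K.Nonempty) (x : Euc d) :
    etaMap K x ∈ convexHull ℝ (optClass K x) :=
  (nearestPoint_spec ((optClass_nonempty hK hne x).convexHull)
    (isClosed_convexHull_optClass hK x) x).1

theorem norm_sub_etaMap_le (hK : K.Finite) (hne : K.Nonempty) {x p : Euc d}
    (hp : p ∈ convexHull ℝ (optClass K x)) : ‖x - etaMap K x‖ ≤ ‖x - p‖ :=
  (nearestPoint_spec ((optClass_nonempty hK hne x).convexHull)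
    (isClosed_convexHull_optClass hK x) x).2 p hp

/-- Optimality classes can only shrink under small perturbations of the point. -/
theorem eventually_optClass_subset (hK : K.Finite) (hne : K.Nonempty) (x : Euc d) :
    ∀ᶠ z in 𝓝 x, optClass K z ⊆ optClass K x := by
  have key : ∀ y ∈ K, ∀ᶠ z in 𝓝 x, y ∉ optClass K x → y ∉ optClass K z := by
    intro y hy
    by_cases hyx : y ∈ optClass K x
    · exact Eventually.of_forall fun z hz => absurd hyx hz
    · rw [mem_optClass_iff hne] at hyx
      push Not at hyx
      obtain ⟨y₀, hy₀, hlt⟩ := hyx hy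
      have h1 : ∀ᶠ z in 𝓝 x, ‖z - y₀‖ < ‖z - y‖ :=
        ContinuousAt.eventually_lt (by fun_prop) (by fun_prop) hlt
      filter_upwards [h1] with z hz _ hyz
      rw [mem_optClass_iff hne] at hyz
      exact absurd (hyz.2 y₀ hy₀) (not_le.2 hz)
  filter_upwards [(eventually_all_finite hK).2 key] with z hz y hy
  by_contra hyx
  exact hz y hy.1 hyx hy

theorem norm_sub_sq_sub_norm_sub_sq {F : Type*} [NormedAddCommGroup F] [InnerProductSpace ℝ F]
    (x z p q : F) :
    (‖x - p‖ ^ 2 - ‖x - q‖ ^ 2) - (‖z - p‖ ^ 2 - ‖z - q‖ ^ 2) = -2 * inner ℝ (x - z) (p - q) := by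
  simp only [norm_sub_sq_real, inner_sub_left, inner_sub_right]
  ring

theorem inner_sub_eq_zero_of_mem_optClass {x z p q : Euc d}
    (hzx : optClass K z ⊆ optClass K x) (hp : p ∈ optClass K z) (hq : q ∈ optClass K z) :
    inner ℝ (x - z) (p - q) = 0 := by
  have h1 : ‖z - p‖ = ‖z - q‖ := hp.2.symm.trans hq.2
  have h2 : ‖x - p‖ = ‖x - q‖ := (hzx hp).2.symm.trans (hzx hq).2
  have := norm_sub_sq_sub_norm_sub_sq x z p q
  rw [h1, h2] at this
  linarith

/-- If `opt z ⊆ opt x`, then `x - z` is orthogonal to the affine span of `opt z`. -/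
theorem inner_sub_eq_zero_of_mem_convexHull {x z p q : Euc d}
    (hzx : optClass K z ⊆ optClass K x) (hp : p ∈ convexHull ℝ (optClass K z))
    (hq : q ∈ convexHull ℝ (optClass K z)) : inner ℝ (x - z) (p - q) = 0 := by
  have conv : ∀ c : ℝ, Convex ℝ {p : Euc d | inner ℝ (x - z) p = c} := fun c =>
    convex_hyperplane (innerₗ (Euc d) (x - z)).isLinear c
  have step : ∀ q ∈ optClass K z, ∀ p ∈ convexHull ℝ (optClass K z),
      inner ℝ (x - z) p = (inner ℝ (x - z) q : ℝ) := by
    intro q hq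
    refine convexHull_min (fun p hp => ?_) (conv _)
    have := inner_sub_eq_zero_of_mem_optClass hzx hp hq
    rw [inner_sub_right] at this
    exact sub_eq_zero.1 this
  obtain ⟨y, hy⟩ : (optClass K z).Nonempty := convexHull_nonempty_iff.1 ⟨p, hp⟩
  rw [inner_sub_right, step y hy p hp, step y hy q hq, sub_self]

/-- If `opt z ⊆ opt x`, the points `x` and `z` have the same projection on the convex hull of
`opt z`, because `x - z` is orthogonal to it. -/
theorem norm_sub_etaMap_le_of_subset (hK : K.Finite) (hne : K.Nonempty) {x z p : Euc d}
    (hzx : optClass K z ⊆ optClass K x) (hp : p ∈ convexHull ℝ (optClass K z)) :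
    ‖x - etaMap K z‖ ≤ ‖x - p‖ := by
  have h1 := norm_sub_etaMap_le hK hne hp
  have h2 := norm_sub_sq_sub_norm_sub_sq x z p (etaMap K z)
  rw [inner_sub_eq_zero_of_mem_convexHull hzx hp (etaMap_mem hK hne z)] at h2
  have h3 : ‖z - etaMap K z‖ ^ 2 ≤ ‖z - p‖ ^ 2 := by gcongr
  exact le_of_sq_le_sq (by linarith) (norm_nonneg _)

theorem etaMap_eq_nearestPoint (hK : K.Finite) (hne : K.Nonempty) {x z : Euc d}
    (hzx : optClass K z ⊆ optClass K x) :
    nearestPoint (convexHull ℝ (optClass K z)) x = etaMap K z :=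
  nearestPoint_unique (convex_convexHull ℝ _) (etaMap_mem hK hne z)
    fun _ hp => norm_sub_etaMap_le_of_subset hK hne hzx hp

theorem eq_etaMap_of_norm_sub_le (hK : K.Finite) (hne : K.Nonempty) {x z p : Euc d}
    (hzx : optClass K z ⊆ optClass K x) (hp : p ∈ convexHull ℝ (optClass K z))
    (hle : ‖x - p‖ ≤ ‖x - etaMap K z‖) : p = etaMap K z := by
  rw [← etaMap_eq_nearestPoint hK hne hzx]
  exact (nearestPoint_unique (convex_convexHull ℝ _) hp fun q hq =>
    hle.trans (norm_sub_etaMap_le_of_subset hK hne hzx hq)).symm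

theorem etaMap_congr (hK : K.Finite) (hne : K.Nonempty) {x z : Euc d}
    (h : optClass K z = optClass K x) : etaMap K z = etaMap K x := by
  rw [← etaMap_eq_nearestPoint hK hne h.subset, h]
  rfl

/-- The value of `η` depends only on the optimality class, a subset of the finite set `K`. -/
theorem finite_range_etaMap (hK : K.Finite) (hne : K.Nonempty) : (range (etaMap K)).Finite := by
  classical
  have hfin : (range (optClass K)).Finite :=
    hK.finite_subsets.subset (by rintro _ ⟨x, rfl⟩; exact optClass_subset x)
  refine (hfin.image fun S => etaMap K (Function.invFun (optClass K) S)).subset ?_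
  rintro _ ⟨x, rfl⟩
  exact ⟨optClass K x, mem_range_self x,
    etaMap_congr hK hne (Function.invFun_eq (f := optClass K) ⟨x, rfl⟩)⟩

theorem norm_combo_sub_sq_sub {F : Type*} [NormedAddCommGroup F] [InnerProductSpace ℝ F]
    (x z p q : F) (l : ℝ) :
    ‖x + l • (z - x) - p‖ ^ 2 - ‖x + l • (z - x) - q‖ ^ 2 =
      (1 - l) * (‖x - p‖ ^ 2 - ‖x - q‖ ^ 2) + l * (‖z - p‖ ^ 2 - ‖z - q‖ ^ 2) := by
  have h1 := norm_sub_sq_sub_norm_sub_sq (x + l • (z - x)) x p q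
  have h2 := norm_sub_sq_sub_norm_sub_sq z x p q
  rw [add_sub_cancel_left, real_inner_smul_left] at h1
  linear_combination h1 - l * h2

/-- Near `x` the optimality classes have a conical structure: they do not change along the segment
from `x`, excluded, to `z`. -/
theorem optClass_add_smul (hK : K.Finite) (hne : K.Nonempty) {x z : Euc d} {l : ℝ}
    (hzx : optClass K z ⊆ optClass K x) (hl0 : 0 < l) (hl1 : l ≤ 1) :
    optClass K (x + l • (z - x)) = optClass K z := by
  have sq : ∀ a p q : Euc d, ‖a - p‖ ≤ ‖a - q‖ ↔ ‖a - p‖ ^ 2 - ‖a - q‖ ^ 2 ≤ 0 := fun a p q => by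
    rw [sub_nonpos, sq_le_sq₀ (norm_nonneg _) (norm_nonneg _)]
  obtain ⟨y₀, hy₀⟩ := optClass_nonempty hK hne z
  have hy₀x := hzx hy₀
  ext y
  constructor
  · intro hy
    rw [mem_optClass_iff hne] at hy hy₀ hy₀x ⊢
    have h1 := (sq _ _ _).1 (hy.2 y₀ hy₀.1)
    have h2 := (sq _ _ _).1 (hy₀x.2 y hy.1)
    have h3 := (sq _ _ _).1 (hy₀.2 y hy.1)
    rw [norm_combo_sub_sq_sub] at h1
    have h4 : ‖z - y‖ ^ 2 - ‖z - y₀‖ ^ 2 ≤ 0 := by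
      have : 0 ≤ (1 - l) * (‖x - y‖ ^ 2 - ‖x - y₀‖ ^ 2) :=
        mul_nonneg (by linarith) (by linarith)
      by_contra hcon
      have := mul_pos hl0 (not_le.1 hcon)
      linarith
    exact ⟨hy.1, fun w hw => ((sq _ _ _).2 h4).trans (hy₀.2 w hw)⟩
  · intro hy
    have hyx := hzx hy
    rw [mem_optClass_iff hne] at hy hyx ⊢
    refine ⟨hy.1, fun w hw => (sq _ _ _).2 ?_⟩
    rw [norm_combo_sub_sq_sub]
    have h2 := (sq _ _ _).1 (hyx.2 w hw)
    have h3 := (sq _ _ _).1 (hy.2 w hw)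
    have := mul_nonpos_of_nonneg_of_nonpos (sub_nonneg.2 hl1) h2
    have := mul_nonpos_of_nonneg_of_nonpos hl0.le h3
    linarith

/-- The function `x ↦ ‖x - η x‖` is lower semicontinuous. -/
theorem lowerSemicontinuous_norm_sub_etaMap (hK : K.Finite) (hne : K.Nonempty) :
    LowerSemicontinuous fun x => ‖x - etaMap K x‖ := by
  intro x c hc
  have h1 : ∀ᶠ z in 𝓝 x, ‖z - x‖ < ‖x - etaMap K x‖ - c := by
    refine ContinuousAt.eventually_lt (f := fun z => ‖z - x‖) (by fun_prop) (by fun_prop) ?_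
    simpa using hc
  filter_upwards [eventually_optClass_subset hK hne x, h1] with z hz hzc
  have h2 : ‖x - etaMap K x‖ ≤ ‖x - etaMap K z‖ :=
    norm_sub_etaMap_le hK hne (convexHull_mono hz (etaMap_mem hK hne z))
  have h3 : ‖x - etaMap K z‖ ≤ ‖z - x‖ + ‖z - etaMap K z‖ := by
    rw [← norm_neg (z - x), neg_sub]
    exact norm_sub_le_norm_sub_add_norm_sub x z _
  linarith

/-- If `opt z ⊆ opt x`, a point closer to `x` than `η z` is not a value of `η` near `z`. -/
theorem eventually_etaMap_ne (hK : K.Finite) (hne : K.Nonempty) {x z p : Euc d}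
    (hzx : optClass K z ⊆ optClass K x) (hp : ‖x - p‖ < ‖x - etaMap K z‖) :
    ∀ᶠ z' in 𝓝 z, etaMap K z' ≠ p := by
  filter_upwards [eventually_optClass_subset hK hne z] with z' hz' heq
  refine absurd hp (not_lt.2 (norm_sub_etaMap_le_of_subset hK hne hzx ?_))
  rw [← heq]
  exact convexHull_mono hz' (etaMap_mem hK hne z')

/-- The convex function `sup_{y ∈ K} (⟪x, y⟫ - |y|² / 2) = (|x|² - dist(x, K)²) / 2`. -/
noncomputable def supAffine (K : Set (Euc d)) (x : Euc d) : ℝ :=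
  (‖x‖ ^ 2 - Metric.infDist x K ^ 2) / 2

theorem continuous_supAffine : Continuous (supAffine K) := by
  unfold supAffine
  have := Metric.continuous_infDist_pt K
  fun_prop

theorem supAffine_eq {x y : Euc d} (hy : y ∈ optClass K x) :
    supAffine K x = inner ℝ y x - ‖y‖ ^ 2 / 2 := by
  rw [supAffine, hy.2, norm_sub_sq_real, real_inner_comm]
  ring

theorem le_supAffine {x y : Euc d} (hy : y ∈ K) :
    inner ℝ y x - ‖y‖ ^ 2 / 2 ≤ supAffine K x := by
  have h1 : Metric.infDist x K ≤ ‖x - y‖ := by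
    rw [← dist_eq_norm]
    exact Metric.infDist_le_dist_of_mem hy
  have h2 : Metric.infDist x K ^ 2 ≤ ‖x - y‖ ^ 2 := by
    gcongr
    exact Metric.infDist_nonneg
  rw [norm_sub_sq_real, real_inner_comm] at h2
  rw [supAffine]
  linarith

/-- The convex hull of a finite nonempty set is cut out by its support function. -/
theorem mem_convexHull_of_forall_inner_le {S : Set (Euc d)} (hS : S.Finite)
    {p : Euc d} (h : ∀ v : Euc d, ∃ y ∈ S, (inner ℝ p v : ℝ) ≤ inner ℝ y v) :
    p ∈ convexHull ℝ S := by
  by_contra hp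
  obtain ⟨f, c, hf, hfS⟩ := geometric_hahn_banach_point_closed (convex_convexHull ℝ S)
    (hS.isCompact_convexHull ℝ).isClosed hp
  obtain ⟨y, hy, hpy⟩ := h (-((InnerProductSpace.toDual ℝ (Euc d)).symm f))
  have h1 : ∀ q : Euc d, inner ℝ q ((InnerProductSpace.toDual ℝ (Euc d)).symm f) = f q :=
    fun q => by rw [real_inner_comm, InnerProductSpace.toDual_symm_apply]
  rw [inner_neg_right, inner_neg_right, h1, h1] at hpy
  have := hfS y (subset_convexHull ℝ S hy)
  linarith

/-- The convex hull of the optimality class of `x` is the subdifferential of `supAffine K`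
at `x`. -/
theorem mem_convexHull_optClass_iff (hK : K.Finite) (hne : K.Nonempty) {x p : Euc d} :
    p ∈ convexHull ℝ (optClass K x) ↔
      ∀ w, supAffine K x - inner ℝ p x ≤ supAffine K w - inner ℝ p w := by
  constructor
  · intro hp w
    have hsub : convexHull ℝ (optClass K x) ⊆
        {p : Euc d | inner ℝ (w - x) p ≤ supAffine K w - supAffine K x} := by
      refine convexHull_min (fun y hy => ?_) (convex_halfSpace_le
        (innerₗ (Euc d) (w - x)).isLinear _)
      have h1 := supAffine_eq hy
      have h2 := le_supAffine (x := w) hy.1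
      simp only [mem_ofPred_eq]
      rw [inner_sub_left, real_inner_comm y w, real_inner_comm y x]
      linarith
    have := hsub hp
    simp only [mem_ofPred_eq] at this
    rw [inner_sub_left, real_inner_comm p w, real_inner_comm p x] at this
    linarith
  · intro h
    refine mem_convexHull_of_forall_inner_le (hK.subset (optClass_subset x)) fun v => ?_
    have h1 : Tendsto (fun t : ℝ => x + t • v) (𝓝[>] 0) (𝓝 x) := by
      have : Continuous fun t : ℝ => x + t • v := by fun_prop
      simpa using (this.tendsto 0).mono_left nhdsWithin_le_nhds
    obtain ⟨t, ht, ht0⟩ :=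
      ((h1.eventually (eventually_optClass_subset hK hne x)).and self_mem_nhdsWithin).exists
    obtain ⟨y, hy⟩ := optClass_nonempty hK hne (x + t • v)
    refine ⟨y, ht hy, ?_⟩
    have h2 := h (x + t • v)
    rw [supAffine_eq hy, supAffine_eq (ht hy)] at h2
    simp only [inner_add_right, real_inner_smul_right] at h2
    have : t * inner ℝ p v ≤ t * (inner ℝ y v : ℝ) := by linarith
    exact le_of_mul_le_mul_left this ht0

/-- The points `x` such that `p` lies in the convex hull of the optimality class of `x`. -/
def hullZone (K : Set (Euc d)) (p : Euc d) : Set (Euc d) := {x | p ∈ convexHull ℝ (optClass K x)}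

theorem mem_hullZone_etaMap (hK : K.Finite) (hne : K.Nonempty) (x : Euc d) :
    x ∈ hullZone K (etaMap K x) := etaMap_mem hK hne x

theorem hullZone_eq (hK : K.Finite) (hne : K.Nonempty) (p : Euc d) :
    hullZone K p = ⋂ w, {x | supAffine K x - inner ℝ p x ≤ supAffine K w - inner ℝ p w} := by
  ext x
  simp only [hullZone, mem_ofPred_eq, mem_convexHull_optClass_iff hK hne, mem_iInter]

theorem isClosed_hullZone (hK : K.Finite) (hne : K.Nonempty) (p : Euc d) :
    IsClosed (hullZone K p) := by
  rw [hullZone_eq hK hne]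
  refine isClosed_iInter fun w => isClosed_le ?_ continuous_const
  have := continuous_supAffine (K := K)
  fun_prop

theorem convex_hullZone (hK : K.Finite) (hne : K.Nonempty) (p : Euc d) :
    Convex ℝ (hullZone K p) := by
  rw [hullZone_eq hK hne]
  refine convex_iInter fun w => ?_
  intro x hx z hz a b ha hb hab
  simp only [mem_ofPred_eq] at hx hz ⊢
  obtain ⟨y, hy⟩ := optClass_nonempty hK hne (a • x + b • z)
  have h1 := le_supAffine (x := x) hy.1
  have h2 := le_supAffine (x := z) hy.1
  rw [supAffine_eq hy]
  simp only [inner_add_right, real_inner_smul_right]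
  have h3 := mul_le_mul_of_nonneg_left (h1.trans (sub_le_iff_le_add.1 hx)) ha
  have h4 := mul_le_mul_of_nonneg_left (h2.trans (sub_le_iff_le_add.1 hz)) hb
  have hb' : b = 1 - a := by linarith
  subst hb'
  nlinarith

end Geometry

/-! ### The extended gradient of the opposite squared distance -/

section ExtendedGradient

variable {d : ℕ} {K : Set (Euc d)}

theorem oppSqDist_eq (x : Euc d) : oppSqDist K x = supAffine K x - ‖x‖ ^ 2 / 2 := by
  rw [oppSqDist, supAffine]
  ring

theorem oppSqDist_quotient (x v : Euc d) {t : ℝ} (ht : t ≠ 0) :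
    (oppSqDist K (x + t • v) - oppSqDist K x) / t =
      (supAffine K (x + t • v) - supAffine K x) / t - inner ℝ x v - t * ‖v‖ ^ 2 / 2 := by
  rw [oppSqDist_eq, oppSqDist_eq, norm_add_sq_real, norm_smul, mul_pow, Real.norm_eq_abs, sq_abs,
    real_inner_smul_right]
  field_simp
  ring

/-- The Gateaux subdifferential of `oppSqDist K` at `x` is the convex hull of the optimality class
translated by `-x`. -/
theorem mem_gateauxSubdiff_oppSqDist (hK : K.Finite) (hne : K.Nonempty) {x ξ : Euc d} :
    ξ ∈ gateauxSubdiff (oppSqDist K) x ↔ ξ + x ∈ convexHull ℝ (optClass K x) := by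
  constructor
  · intro h
    have hSfin := hK.subset (optClass_subset (K := K) x)
    refine mem_convexHull_of_forall_inner_le hSfin fun v => ?_
    obtain ⟨y₀, hy₀, hmax⟩ := hSfin.exists_maximalFor (fun y : Euc d => (inner ℝ y v : ℝ)) _
      (optClass_nonempty hK hne x)
    have hmax' : ∀ y ∈ optClass K x, (inner ℝ y v : ℝ) ≤ inner ℝ y₀ v := fun y hy => by
      rcases le_total (inner ℝ y v : ℝ) (inner ℝ y₀ v) with h | h
      · exact h
      · exact hmax hy h
    refine ⟨y₀, hy₀, ?_⟩
    have h1 : Tendsto (fun t : ℝ => x + t • v) (𝓝[>] 0) (𝓝 x) := by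
      have : Continuous fun t : ℝ => x + t • v := by fun_prop
      simpa using (this.tendsto 0).mono_left nhdsWithin_le_nhds
    have h2 : ∀ᶠ t : ℝ in 𝓝[>] 0,
        (((oppSqDist K (x + t • v) - oppSqDist K x) / t : ℝ) : EReal) ≤
          ((inner ℝ y₀ v - inner ℝ x v : ℝ) : EReal) := by
      filter_upwards [h1.eventually (eventually_optClass_subset hK hne x), self_mem_nhdsWithin]
        with t ht ht0
      have ht0' : 0 < t := ht0
      obtain ⟨y, hy⟩ := optClass_nonempty hK hne (x + t • v)
      rw [EReal.coe_le_coe_iff, oppSqDist_quotient _ _ ht0'.ne', supAffine_eq hy,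
        supAffine_eq (ht hy), inner_add_right, real_inner_smul_right]
      have h3 : (inner ℝ y x + t * inner ℝ y v - ‖y‖ ^ 2 / 2 - (inner ℝ y x - ‖y‖ ^ 2 / 2)) / t =
          (inner ℝ y v : ℝ) := by
        field_simp
        ring
      have h4 : 0 ≤ t * ‖v‖ ^ 2 / 2 := by positivity
      rw [h3]
      linarith [hmax' y (ht hy)]
    have h3 := (h v).trans (liminf_le_liminf h2)
    rw [liminf_const, EReal.coe_le_coe_iff] at h3
    rw [inner_add_left]
    linarith
  · intro h v
    have h1 : Tendsto (fun t : ℝ => ((inner ℝ ξ v - t * ‖v‖ ^ 2 / 2 : ℝ) : EReal)) (𝓝[>] 0)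
        (𝓝 ((inner ℝ ξ v : ℝ) : EReal)) := by
      refine (continuous_coe_real_ereal.tendsto _).comp ?_
      have : Continuous fun t : ℝ => inner ℝ ξ v - t * ‖v‖ ^ 2 / 2 := by fun_prop
      simpa using (this.tendsto 0).mono_left nhdsWithin_le_nhds
    rw [← h1.liminf_eq]
    refine liminf_le_liminf ?_
    filter_upwards [self_mem_nhdsWithin] with t ht0
    have ht0' : 0 < t := ht0
    rw [EReal.coe_le_coe_iff, oppSqDist_quotient _ _ ht0'.ne']
    have h2 := (mem_convexHull_optClass_iff hK hne).1 h (x + t • v)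
    simp only [inner_add_right, inner_add_left, real_inner_smul_right] at h2
    have h3 : inner ℝ ξ v + inner ℝ x v ≤ (supAffine K (x + t • v) - supAffine K x) / t := by
      rw [le_div_iff₀ ht0']
      linarith
    linarith

theorem extGrad_oppSqDist (hK : K.Finite) (hne : K.Nonempty) (x : Euc d) :
    extGrad (oppSqDist K) x = etaMap K x - x := by
  have hset : gateauxSubdiff (oppSqDist K) x =
      (fun ξ => ξ + x) ⁻¹' convexHull ℝ (optClass K x) := by
    ext ξ
    exact mem_gateauxSubdiff_oppSqDist hK hne
  rw [extGrad, hset]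
  refine nearestPoint_unique ((convex_convexHull ℝ _).translate_preimage_left x) ?_ fun ξ hξ => ?_
  · simpa using etaMap_mem hK hne x
  · have h : ‖x - etaMap K x‖ ≤ ‖x - (ξ + x)‖ := norm_sub_etaMap_le hK hne hξ
    rw [zero_sub, zero_sub, norm_neg, norm_neg, norm_sub_rev]
    rwa [show x - (ξ + x) = -ξ by abel, norm_neg] at h

theorem norm_extGrad_oppSqDist (hK : K.Finite) (hne : K.Nonempty) (x : Euc d) :
    ‖extGrad (oppSqDist K) x‖ = ‖x - etaMap K x‖ := by
  rw [extGrad_oppSqDist hK hne, norm_sub_rev]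

end ExtendedGradient

/-! ### Curves with square integrable velocity -/

section Curves

variable {d : ℕ}

/-- `u` is, on `[a, b]`, a primitive of the square integrable velocity `w`. -/
structure IsH1 (u w : ℝ → Euc d) (a b : ℝ) : Prop where
  integrable : IntervalIntegrable w volume a b
  sq_integrable : IntervalIntegrable (fun t => ‖w t‖ ^ 2) volume a b
  eq_add_integral : ∀ t ∈ Icc a b, u t = u a + ∫ r in a..t, w r

namespace IsH1

variable {u w : ℝ → Euc d} {a b c : ℝ}

theorem uIcc_subset {s t : ℝ} (hs : s ∈ Icc a b) (ht : t ∈ Icc a b) :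
    uIcc s t ⊆ uIcc a b := by
  rw [uIcc_of_le (hs.1.trans hs.2)]
  exact OrdConnected.uIcc_subset ordConnected_Icc hs ht

theorem sub_eq (h : IsH1 u w a b) {s t : ℝ} (hs : s ∈ Icc a b) (ht : t ∈ Icc a b) :
    u t - u s = ∫ r in s..t, w r := by
  have ha : a ∈ Icc a b := ⟨le_rfl, hs.1.trans hs.2⟩
  rw [h.eq_add_integral t ht, h.eq_add_integral s hs, add_sub_add_left_eq_sub]
  exact intervalIntegral.integral_interval_sub_left (h.integrable.mono_set (uIcc_subset ha ht))
    (h.integrable.mono_set (uIcc_subset ha hs))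

theorem mono (h : IsH1 u w a b) {s t : ℝ} (hs : s ∈ Icc a b) (ht : t ∈ Icc a b) :
    IsH1 u w s t := by
  refine ⟨h.integrable.mono_set (uIcc_subset hs ht), h.sq_integrable.mono_set (uIcc_subset hs ht),
    fun r hr => ?_⟩
  rw [← h.sub_eq hs ⟨hs.1.trans hr.1, hr.2.trans ht.2⟩]
  abel

theorem continuousOn (h : IsH1 u w a b) : ContinuousOn u (Icc a b) := by
  rcases le_or_gt a b with hab | hab
  · have h1 := intervalIntegral.continuousOn_primitive_interval' h.integrable left_mem_uIcc
    rw [uIcc_of_le hab] at h1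
    exact (continuousOn_const.add h1).congr h.eq_add_integral
  · rw [Icc_eq_empty (not_le.2 hab)]
    exact continuousOn_empty _

theorem congr (h : IsH1 u w a b) {u' w' : ℝ → Euc d} (hab : a ≤ b)
    (hu : ∀ t ∈ Icc a b, u' t = u t) (hw : ∀ t ∈ Ioc a b, w' t = w t) : IsH1 u' w' a b := by
  refine ⟨h.integrable.congr fun t ht => ?_, h.sq_integrable.congr fun t ht => ?_, fun t ht => ?_⟩
  · rw [uIoc_of_le hab] at ht
    exact (hw t ht).symm
  · rw [uIoc_of_le hab] at ht
    simp only [hw t ht]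
  · rw [hu t ht, hu a ⟨le_rfl, hab⟩, h.eq_add_integral t ht]
    congr 1
    refine intervalIntegral.integral_congr_ae (ae_of_all _ fun r hr => ?_)
    rw [uIoc_of_le ht.1] at hr
    exact (hw r ⟨hr.1, hr.2.trans ht.2⟩).symm

/-- The concatenation at time `c` of two curves. -/
noncomputable def glue (c : ℝ) (u₁ u₂ : ℝ → Euc d) (t : ℝ) : Euc d :=
  if t ≤ c then u₁ t else u₂ t

theorem glue_left {u₁ u₂ : ℝ → Euc d} {t : ℝ} (h : t ≤ c) : glue c u₁ u₂ t = u₁ t := if_pos h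

theorem glue_right {u₁ u₂ : ℝ → Euc d} {t : ℝ} (h : c < t) : glue c u₁ u₂ t = u₂ t :=
  if_neg (not_le.2 h)

theorem glue_right' {u₁ u₂ : ℝ → Euc d} {t : ℝ} (h : c ≤ t) (heq : u₁ c = u₂ c) :
    glue c u₁ u₂ t = u₂ t := by
  rcases h.eq_or_lt with rfl | h
  · rw [glue_left le_rfl, heq]
  · exact glue_right h

theorem trans (h₁ : IsH1 u w a c) (h₂ : IsH1 u w c b) (hac : a ≤ c) : IsH1 u w a b := by
  refine ⟨h₁.integrable.trans h₂.integrable, h₁.sq_integrable.trans h₂.sq_integrable,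
    fun t ht => ?_⟩
  rcases le_total t c with htc | htc
  · exact h₁.eq_add_integral t ⟨ht.1, htc⟩
  · rw [h₂.eq_add_integral t ⟨htc, ht.2⟩, h₁.eq_add_integral c ⟨hac, le_rfl⟩, add_assoc,
      intervalIntegral.integral_add_adjacent_intervals h₁.integrable
        (h₂.mono (left_mem_Icc.2 (htc.trans ht.2)) ⟨htc, ht.2⟩).integrable]

theorem glue_isH1 {u₁ w₁ u₂ w₂ : ℝ → Euc d} (hac : a ≤ c) (hcb : c ≤ b) (h₁ : IsH1 u₁ w₁ a c)
    (h₂ : IsH1 u₂ w₂ c b) (heq : u₁ c = u₂ c) : IsH1 (glue c u₁ u₂) (glue c w₁ w₂) a b :=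
  (h₁.congr hac (fun _ ht => glue_left ht.2) fun _ ht => glue_left ht.2).trans
    (h₂.congr hcb (fun _ ht => glue_right' ht.1 heq) fun _ ht => glue_right ht.1) hac

theorem line (p v : Euc d) (a b c : ℝ) : IsH1 (fun t => p + (t - c) • v) (fun _ => v) a b := by
  refine ⟨intervalIntegrable_const, intervalIntegrable_const, fun t _ => ?_⟩
  rw [intervalIntegral.integral_const]
  module

/-- Time reversal. -/
theorem comp_neg (h : IsH1 u w a b) (hab : a ≤ b) :
    IsH1 (fun t => u (-t)) (fun t => -w (-t)) (-b) (-a) := by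
  refine ⟨?_, ?_, fun t ht => ?_⟩
  · have h1 : IntervalIntegrable (fun t => w (-t)) volume (-a) (-b) := by
      simpa using (IntervalIntegrable.iff_comp_neg).1 h.integrable
    exact h1.symm.neg
  · simpa using ((IntervalIntegrable.iff_comp_neg).1 h.sq_integrable).symm
  · have h1 := h.sub_eq (s := -t) (t := b) ⟨by linarith [ht.2], by linarith [ht.1]⟩
      ⟨hab, le_rfl⟩
    rw [intervalIntegral.integral_neg, intervalIntegral.integral_comp_neg, neg_neg, ← h1]
    abel

/-- Affine reparametrization by `t ↦ l * t + m`. -/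
theorem comp_mul_add (l m : ℝ) (hl : 0 < l) (h : IsH1 u w (l * a + m) (l * b + m)) :
    IsH1 (fun t => u (l * t + m)) (fun t => l • w (l * t + m)) a b := by
  have key : ∀ f : ℝ → Euc d, IntervalIntegrable f volume (l * a + m) (l * b + m) →
      IntervalIntegrable (fun t => f (l * t + m)) volume a b := by
    intro f hf
    have h1 := (hf.comp_add_right m).comp_mul_left (c := l)
    simpa [hl.ne'] using h1
  have key' : ∀ f : ℝ → ℝ, IntervalIntegrable f volume (l * a + m) (l * b + m) →
      IntervalIntegrable (fun t => f (l * t + m)) volume a b := by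
    intro f hf
    have h1 := (hf.comp_add_right m).comp_mul_left (c := l)
    simpa [hl.ne'] using h1
  refine ⟨(key w h.integrable).smul l, ?_, fun t ht => ?_⟩
  · have := (key' _ h.sq_integrable).const_mul (l ^ 2)
    refine this.congr fun t _ => ?_
    simp only [norm_smul, mul_pow, Real.norm_eq_abs, sq_abs]
  · rw [intervalIntegral.integral_smul, intervalIntegral.smul_integral_comp_mul_add]
    refine h.eq_add_integral _ ⟨?_, ?_⟩
    · linarith [mul_le_mul_of_nonneg_left ht.1 hl.le]
    · linarith [mul_le_mul_of_nonneg_left ht.2 hl.le]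

/-- The affine interpolation `(1 - l) u + l u'` of two curves. -/
theorem combo {u' w' : ℝ → Euc d} (h : IsH1 u w a b) (h' : IsH1 u' w' a b) (l : ℝ) :
    IsH1 (fun t => u t + l • (u' t - u t)) (fun t => w t + l • (w' t - w t)) a b := by
  have hint : IntervalIntegrable (fun t => w t + l • (w' t - w t)) volume a b :=
    h.integrable.add ((h'.integrable.sub h.integrable).smul l)
  refine ⟨hint, ?_, fun t ht => ?_⟩
  · have hb : IntervalIntegrable
        (fun t => 2 * (1 - l) ^ 2 * ‖w t‖ ^ 2 + 2 * l ^ 2 * ‖w' t‖ ^ 2) volume a b :=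
      (h.sq_integrable.const_mul _).add (h'.sq_integrable.const_mul _)
    refine hb.mono_fun' (hint.aestronglyMeasurable_restrict_uIoc.norm.pow 2)
      (ae_of_all _ fun t => ?_)
    have h1 : w t + l • (w' t - w t) = (1 - l) • w t + l • w' t := by module
    have h2 : ‖(1 - l) • w t + l • w' t‖ ≤ ‖(1 - l) • w t‖ + ‖l • w' t‖ := norm_add_le _ _
    have h3 : ‖(1 - l) • w t‖ ^ 2 = (1 - l) ^ 2 * ‖w t‖ ^ 2 := by
      rw [norm_smul, mul_pow, Real.norm_eq_abs, sq_abs]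
    have h4 : ‖l • w' t‖ ^ 2 = l ^ 2 * ‖w' t‖ ^ 2 := by
      rw [norm_smul, mul_pow, Real.norm_eq_abs, sq_abs]
    beta_reduce
    rw [Real.norm_of_nonneg (sq_nonneg _), h1]
    nlinarith [norm_nonneg ((1 - l) • w t + l • w' t), norm_nonneg ((1 - l) • w t),
      norm_nonneg (l • w' t), sq_nonneg (‖(1 - l) • w t‖ - ‖l • w' t‖),
      pow_le_pow_left₀ (norm_nonneg _) h2 2]
  · have hs := uIcc_subset (a := a) (b := b) ⟨le_rfl, ht.1.trans ht.2⟩ ht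
    have i1 := h.integrable.mono_set hs
    have i2 := h'.integrable.mono_set hs
    have i3 : IntervalIntegrable (fun t => l • (w' t - w t)) volume a t := (i2.sub i1).smul l
    rw [intervalIntegral.integral_add i1 i3, intervalIntegral.integral_smul,
      intervalIntegral.integral_sub i2 i1, h.eq_add_integral t ht, h'.eq_add_integral t ht]
    module

/-- The kinetic energy splits into that of the mean velocity and a variance. -/
theorem integral_norm_sub_sq (h : IsH1 u w a b) (hab : a ≤ b) {v : Euc d}
    (hv : u b - u a = (b - a) • v) :
    IntervalIntegrable (fun t => ‖w t - v‖ ^ 2) volume a b ∧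
      ∫ t in a..b, ‖w t - v‖ ^ 2 = (∫ t in a..b, ‖w t‖ ^ 2) - (b - a) * ‖v‖ ^ 2 := by
  have hi : IntervalIntegrable (fun t => (inner ℝ v (w t) : ℝ)) volume a b :=
    ⟨h.integrable.1.const_inner v, h.integrable.2.const_inner v⟩
  have heq : (fun t => ‖w t - v‖ ^ 2) = fun t => ‖w t‖ ^ 2 - 2 * inner ℝ v (w t) + ‖v‖ ^ 2 := by
    ext t
    rw [norm_sub_sq_real, real_inner_comm]
  have hin : ∫ t in a..b, (inner ℝ v (w t) : ℝ) = (b - a) * ‖v‖ ^ 2 := by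
    have h1 := (innerSL ℝ v).intervalIntegral_comp_comm h.integrable
    simp only [innerSL_apply_apply] at h1
    rw [h1, ← h.sub_eq ⟨le_rfl, hab⟩ ⟨hab, le_rfl⟩, hv, real_inner_smul_right,
      real_inner_self_eq_norm_sq]
  have i1 := h.sq_integrable.sub (hi.const_mul 2)
  constructor
  · rw [heq]
    exact i1.add intervalIntegrable_const
  · rw [heq, intervalIntegral.integral_add i1 intervalIntegrable_const,
      intervalIntegral.integral_sub h.sq_integrable (hi.const_mul 2),
      intervalIntegral.integral_const_mul, hin, intervalIntegral.integral_const, smul_eq_mul]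
    ring

theorem mul_norm_sq_le (h : IsH1 u w a b) (hab : a ≤ b) {v : Euc d}
    (hv : u b - u a = (b - a) • v) : (b - a) * ‖v‖ ^ 2 ≤ ∫ t in a..b, ‖w t‖ ^ 2 := by
  have h1 := (h.integral_norm_sub_sq hab hv).2
  have h2 : 0 ≤ ∫ t in a..b, ‖w t - v‖ ^ 2 :=
    intervalIntegral.integral_nonneg hab fun t _ => by positivity
  linarith

/-- Cauchy–Schwarz: the squared displacement is at most time times energy. -/
theorem norm_sub_sq_le (h : IsH1 u w a b) (hab : a ≤ b) :
    ‖u b - u a‖ ^ 2 ≤ (b - a) * ∫ t in a..b, ‖w t‖ ^ 2 := by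
  rcases hab.eq_or_lt with rfl | hlt
  · simp
  · have hpos : 0 < b - a := sub_pos.2 hlt
    have h1 := h.mul_norm_sq_le hab (v := (b - a)⁻¹ • (u b - u a)) (by
      rw [smul_smul, mul_inv_cancel₀ hpos.ne', one_smul])
    rw [norm_smul, mul_pow, Real.norm_eq_abs, sq_abs] at h1
    have h2 := mul_le_mul_of_nonneg_left h1 hpos.le
    have h3 : (b - a) * ((b - a) * ((b - a)⁻¹ ^ 2 * ‖u b - u a‖ ^ 2)) = ‖u b - u a‖ ^ 2 := by
      field_simp
    linarith

/-- A bound on the deviation from uniform motion in terms of the energy excess. -/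
theorem norm_deviation_sq_le (h : IsH1 u w a b) (hab : a ≤ b) {v : Euc d}
    (hv : u b - u a = (b - a) • v) {t : ℝ} (ht : t ∈ Icc a b) :
    ‖u t - (u a + (t - a) • v)‖ ^ 2 ≤ (b - a) * ∫ r in a..b, ‖w r - v‖ ^ 2 := by
  have hi := (h.integral_norm_sub_sq hab hv).1
  have h2 : IsH1 (fun t => u t - (u a + (t - a) • v)) (fun t => w t - v) a b := by
    refine ⟨h.integrable.sub intervalIntegrable_const, hi, fun r hr => ?_⟩
    rw [intervalIntegral.integral_sub (h.mono ⟨le_rfl, hab⟩ hr).integrable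
      intervalIntegrable_const, intervalIntegral.integral_const, h.eq_add_integral r hr]
    module
  have h4 := (h2.mono ⟨le_rfl, hab⟩ ht).norm_sub_sq_le ht.1
  have h5 : u a - (u a + (a - a) • v) = 0 := by simp
  rw [h5, sub_zero] at h4
  refine h4.trans (mul_le_mul (by linarith [ht.2]) ?_ ?_ (by linarith))
  · exact intervalIntegral.integral_mono_interval le_rfl ht.1 ht.2
      (ae_of_all _ fun r => by positivity) hi
  · exact intervalIntegral.integral_nonneg ht.1 fun t _ => by positivity

/-- Curves with square integrable velocity are absolutely continuous. -/
theorem absolutelyContinuous (h : IsH1 u w a b) (hab : a ≤ b) :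
    AbsolutelyContinuousOnInterval u a b := by
  have h1 := h.integrable.norm.absolutelyContinuousOnInterval_intervalIntegral
    (c := a) left_mem_uIcc
  unfold AbsolutelyContinuousOnInterval at h1 ⊢
  refine squeeze_zero' (Eventually.of_forall fun E => Finset.sum_nonneg fun i _ => dist_nonneg) ?_
    h1
  rw [eventually_inf_principal]
  refine Eventually.of_forall fun E hE => Finset.sum_le_sum fun i hi => ?_
  obtain ⟨hs, ht⟩ := hE.1 i hi
  rw [uIcc_of_le hab] at hs ht
  have ha : a ∈ Icc a b := ⟨le_rfl, hab⟩
  rw [dist_comm, dist_eq_norm, h.sub_eq hs ht, dist_comm, Real.dist_eq,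
    intervalIntegral.integral_interval_sub_left
      (h.integrable.norm.mono_set (uIcc_subset ha ht))
      (h.integrable.norm.mono_set (uIcc_subset ha hs))]
  exact intervalIntegral.norm_integral_le_abs_integral_norm

theorem ae_hasDerivAt (h : IsH1 u w a b) (hab : a ≤ b) :
    ∀ᵐ t, t ∈ Ioo a b → HasDerivAt u (w t) t := by
  filter_upwards [h.integrable.ae_hasDerivAt_integral] with t ht hmem
  have h1 := (ht (by rw [uIcc_of_le hab]; exact Ioo_subset_Icc_self hmem) a left_mem_uIcc).const_add
    (u a)
  refine h1.congr_of_eventuallyEq ?_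
  filter_upwards [Icc_mem_nhds hmem.1 hmem.2] with r hr
  exact h.eq_add_integral r hr

end IsH1

/-- An absolutely continuous curve whose derivative is square integrable. -/
theorem AbsolutelyContinuousOnInterval.isH1 {u : ℝ → Euc d} {a b : ℝ} (hab : a ≤ b)
    (hu : AbsolutelyContinuousOnInterval u a b)
    (hint : IntervalIntegrable (fun t => ‖deriv u t‖ ^ 2) volume a b) :
    IsH1 u (deriv u) a b := by
  have hw : IntervalIntegrable (deriv u) volume a b := by
    refine (hint.add (intervalIntegrable_const (c := (1 : ℝ)))).mono_fun'
      (stronglyMeasurable_deriv u).aestronglyMeasurable (ae_of_all _ fun t => ?_)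
    beta_reduce
    nlinarith [sq_nonneg (‖deriv u t‖ - 1 / 2)]
  refine ⟨hw, hint, fun t ht => ?_⟩
  have hsub : uIcc a t ⊆ uIcc a b := IsH1.uIcc_subset ⟨le_rfl, hab⟩ ht
  have hdiff := hu.boundedVariationOn.ae_differentiableAt_of_mem_uIcc
  ext i
  have hi : AbsolutelyContinuousOnInterval (fun t => u t i) a t := by
    have h1 := hu.mono hsub
    unfold AbsolutelyContinuousOnInterval at h1 ⊢
    refine squeeze_zero (fun E => Finset.sum_nonneg fun i _ => dist_nonneg) (fun E => ?_) h1
    refine Finset.sum_le_sum fun j _ => ?_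
    rw [dist_eq_norm, dist_eq_norm, ← PiLp.sub_apply]
    exact PiLp.norm_apply_le _ _
  have h1 := hi.integral_deriv_eq_sub
  have h2 : ∫ r in a..t, deriv (fun t => u t i) r = ∫ r in a..t, (deriv u r) i := by
    refine intervalIntegral.integral_congr_ae ?_
    filter_upwards [hdiff] with r hr hmem
    exact ((EuclideanSpace.proj (𝕜 := ℝ) i).hasFDerivAt.comp_hasDerivAt r
      (hr (hsub (uIoc_subset_uIcc hmem))).hasDerivAt).deriv
  have h3 := (EuclideanSpace.proj (𝕜 := ℝ) i).intervalIntegral_comp_comm (hw.mono_set hsub)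
  simp only [PiLp.proj_apply] at h3
  rw [PiLp.add_apply, ← h3, ← h2, h1]
  ring

/-- Composing with a `1`-Lipschitz map does not increase the speed. -/
theorem IsH1.exists_comp_lipschitz {u w : ℝ → Euc d} {a b : ℝ} (h : IsH1 u w a b) (hab : a ≤ b)
    {P : Euc d → Euc d} (hP : LipschitzWith 1 P) :
    ∃ z, IsH1 (fun t => P (u t)) z a b ∧
      ∫ t in a..b, ‖z t‖ ^ 2 ≤ ∫ t in a..b, ‖w t‖ ^ 2 := by
  have hac : AbsolutelyContinuousOnInterval (fun t => P (u t)) a b := by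
    have h1 := h.absolutelyContinuous hab
    unfold AbsolutelyContinuousOnInterval at h1 ⊢
    refine squeeze_zero (fun E => Finset.sum_nonneg fun i _ => dist_nonneg) (fun E => ?_) h1
    exact Finset.sum_le_sum fun j _ => by simpa using hP.dist_le_mul _ _
  have hle : ∀ᵐ t, t ∈ Ioo a b → ‖deriv (fun t => P (u t)) t‖ ^ 2 ≤ ‖w t‖ ^ 2 := by
    filter_upwards [h.ae_hasDerivAt hab] with t ht hmem
    by_cases hd : DifferentiableAt ℝ (fun t => P (u t)) t
    · have h1 := (hasDerivAt_iff_tendsto_slope.1 hd.hasDerivAt).norm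
      have h2 := (hasDerivAt_iff_tendsto_slope.1 (ht hmem)).norm
      have h3 : ‖deriv (fun t => P (u t)) t‖ ≤ ‖w t‖ := by
        refine le_of_tendsto_of_tendsto h1 h2 (Eventually.of_forall fun s => ?_)
        simp only [slope_def_module, norm_smul]
        gcongr
        simpa [dist_eq_norm] using hP.dist_le_mul (u s) (u t)
      gcongr
    · rw [deriv_zero_of_not_differentiableAt hd]
      simp
  have hle' : ∀ᵐ t ∂(volume.restrict (uIoc a b)),
      ‖deriv (fun t => P (u t)) t‖ ^ 2 ≤ ‖w t‖ ^ 2 := by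
    rw [uIoc_of_le hab, ← restrict_Ioo_eq_restrict_Ioc]
    exact (ae_restrict_iff' measurableSet_Ioo).2 hle
  have hint : IntervalIntegrable (fun t => ‖deriv (fun t => P (u t)) t‖ ^ 2) volume a b := by
    refine h.sq_integrable.mono_fun'
      ((stronglyMeasurable_deriv _).aestronglyMeasurable.norm.pow 2) ?_
    filter_upwards [hle'] with t ht
    rwa [Real.norm_of_nonneg (by positivity)]
  refine ⟨_, hac.isH1 hab hint, intervalIntegral.integral_mono_ae_restrict hab hint
    h.sq_integrable ?_⟩
  rw [← restrict_Ioo_eq_restrict_Icc]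
  exact (ae_restrict_iff' measurableSet_Ioo).2 hle

end Curves

/-! ### Local minimality on subintervals -/

section LocalMinimality

variable {d : ℕ}

/-- A nonnegative measurable function which is bounded on balls. -/
structure IsPotential (F : Euc d → ℝ) : Prop where
  measurable : Measurable F
  nonneg : ∀ x, 0 ≤ F x
  bound : ∀ R : ℝ, ∃ B : ℝ, ∀ x, ‖x‖ ≤ R → F x ≤ B

theorem IsPotential.intervalIntegrable {F : Euc d → ℝ} (hF : IsPotential F) {u : ℝ → Euc d}
    {a b : ℝ} (hab : a ≤ b) (hu : ContinuousOn u (Icc a b)) :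
    IntervalIntegrable (fun t => F (u t)) volume a b := by
  obtain ⟨R, hR⟩ := isCompact_Icc.exists_bound_of_continuousOn hu
  obtain ⟨B, hB⟩ := hF.bound R
  have hm : AEMeasurable u (volume.restrict (Ioc a b)) :=
    (hu.mono Ioc_subset_Icc_self).aemeasurable measurableSet_Ioc
  rw [intervalIntegrable_iff_integrableOn_Ioc_of_le hab]
  refine Integrable.of_bound (hF.measurable.comp_aemeasurable hm).aestronglyMeasurable B ?_
  filter_upwards [ae_restrict_mem measurableSet_Ioc] with t ht
  rw [Real.norm_of_nonneg (hF.nonneg _)]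
  exact hB _ (hR t (Ioc_subset_Icc_self ht))

/-- The action on `[a, b]` of the curve `u` with velocity `w` in the potential `F`. -/
noncomputable def cost (F : Euc d → ℝ) (u w : ℝ → Euc d) (a b : ℝ) : ℝ :=
  (∫ t in a..b, ‖w t‖ ^ 2) + ∫ t in a..b, F (u t)

theorem cost_congr (F : Euc d → ℝ) {u w u' w' : ℝ → Euc d} {a b : ℝ} (hab : a ≤ b)
    (hu : ∀ t ∈ Ioc a b, u' t = u t) (hw : ∀ t ∈ Ioc a b, w' t = w t) :
    cost F u' w' a b = cost F u w a b := by
  rw [← uIoc_of_le hab] at hu hw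
  rw [cost, cost]
  congr 1
  · exact intervalIntegral.integral_congr_ae (ae_of_all _ fun t ht => by simp only [hw t ht])
  · exact intervalIntegral.integral_congr_ae (ae_of_all _ fun t ht => by simp only [hu t ht])

theorem cost_add {F : Euc d → ℝ} (hF : IsPotential F) {u w : ℝ → Euc d} {a b c : ℝ}
    (h : IsH1 u w a b) (hac : a ≤ c) (hcb : c ≤ b) :
    cost F u w a c + cost F u w c b = cost F u w a b := by
  have h1 := h.mono (s := a) (t := c) ⟨le_rfl, hac.trans hcb⟩ ⟨hac, hcb⟩
  have h2 := h.mono (s := c) (t := b) ⟨hac, hcb⟩ ⟨hac.trans hcb, le_rfl⟩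
  rw [cost, cost, cost, ← intervalIntegral.integral_add_adjacent_intervals h1.sq_integrable
    h2.sq_integrable, ← intervalIntegral.integral_add_adjacent_intervals
    (hF.intervalIntegrable hac h1.continuousOn) (hF.intervalIntegrable hcb h2.continuousOn)]
  ring

theorem cost_glue {F : Euc d → ℝ} (hF : IsPotential F) {u₁ w₁ u₂ w₂ : ℝ → Euc d} {a b c : ℝ}
    (hac : a ≤ c) (hcb : c ≤ b) (h₁ : IsH1 u₁ w₁ a c) (h₂ : IsH1 u₂ w₂ c b) (heq : u₁ c = u₂ c) :
    cost F (IsH1.glue c u₁ u₂) (IsH1.glue c w₁ w₂) a b = cost F u₁ w₁ a c + cost F u₂ w₂ c b := by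
  rw [← cost_add hF (IsH1.glue_isH1 hac hcb h₁ h₂ heq) hac hcb,
    cost_congr F hac (fun _ ht => IsH1.glue_left ht.2) fun _ ht => IsH1.glue_left ht.2,
    cost_congr F hcb (fun _ ht => IsH1.glue_right ht.1) fun _ ht => IsH1.glue_right ht.1]

/-- `u` (with velocity `w`) minimizes the action with potential `F` on each subinterval of
`[α, β]` among the curves with the same endpoints at uniform distance less than `ε` from it. -/
structure IsLocMin (F : Euc d → ℝ) (u w : ℝ → Euc d) (α β ε : ℝ) : Prop where
  isH1 : IsH1 u w α β
  eps_pos : 0 < ε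
  cost_le : ∀ a b, α ≤ a → a ≤ b → b ≤ β → ∀ σ z : ℝ → Euc d, IsH1 σ z a b → σ a = u a →
    σ b = u b → (∀ t ∈ Icc a b, ‖σ t - u t‖ < ε) → cost F u w a b ≤ cost F σ z a b

theorem cost_comp_neg (F : Euc d → ℝ) (u w : ℝ → Euc d) (a b : ℝ) :
    cost F (fun t => u (-t)) (fun t => -w (-t)) a b = cost F u w (-b) (-a) := by
  simp only [cost, norm_neg]
  rw [intervalIntegral.integral_comp_neg (fun t => ‖w t‖ ^ 2),
    intervalIntegral.integral_comp_neg (fun t => F (u t))]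

theorem IsLocMin.comp_neg {F : Euc d → ℝ} {u w : ℝ → Euc d} {α β ε : ℝ}
    (h : IsLocMin F u w α β ε) (hαβ : α ≤ β) :
    IsLocMin F (fun t => u (-t)) (fun t => -w (-t)) (-β) (-α) ε := by
  refine ⟨h.isH1.comp_neg hαβ, h.eps_pos, fun a b ha hab hb σ z hσ hσa hσb hclose => ?_⟩
  have h1 := h.cost_le (-b) (-a) (by linarith) (by linarith) (by linarith) _ _
    (hσ.comp_neg hab) (by simpa using hσb) (by simpa using hσa) fun t ht => by
      simpa using hclose (-t) ⟨by linarith [ht.2], by linarith [ht.1]⟩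
  rw [cost_comp_neg] at h1 ⊢
  simpa using h1

/-- Comparison with a competitor made of two pieces. -/
theorem IsLocMin.cost_le_add {F : Euc d → ℝ} (hF : IsPotential F) {u w : ℝ → Euc d}
    {α β ε : ℝ} (h : IsLocMin F u w α β ε) {a b c : ℝ} (ha : α ≤ a) (hac : a ≤ c) (hcb : c ≤ b)
    (hb : b ≤ β) {u₁ w₁ u₂ w₂ : ℝ → Euc d} (h₁ : IsH1 u₁ w₁ a c) (h₂ : IsH1 u₂ w₂ c b)
    (heq : u₁ c = u₂ c) (hua : u₁ a = u a) (hub : u₂ b = u b)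
    (hclose₁ : ∀ t ∈ Icc a c, ‖u₁ t - u t‖ < ε) (hclose₂ : ∀ t ∈ Icc c b, ‖u₂ t - u t‖ < ε) :
    cost F u w a b ≤ cost F u₁ w₁ a c + cost F u₂ w₂ c b := by
  rw [← cost_glue hF hac hcb h₁ h₂ heq]
  refine h.cost_le a b ha (hac.trans hcb) hb _ _ (IsH1.glue_isH1 hac hcb h₁ h₂ heq) ?_ ?_ ?_
  · rw [IsH1.glue_left hac, hua]
  · rw [IsH1.glue_right' hcb heq, hub]
  · intro t ht
    rcases le_total t c with htc | htc
    · rw [IsH1.glue_left htc]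
      exact hclose₁ t ⟨ht.1, htc⟩
    · rw [IsH1.glue_right' htc heq]
      exact hclose₂ t ⟨htc, ht.2⟩

variable {K : Set (Euc d)}

/-- The potential `h (|∇ f_K| ^ 2)`, written in terms of `etaMap`. -/
noncomputable def etaPotential (K : Set (Euc d)) (h : ℝ → ℝ) (x : Euc d) : ℝ :=
  h (‖x - etaMap K x‖ ^ 2)

theorem etaPotential_le_of_mem_hullZone (hK : K.Finite) (hne : K.Nonempty) {h : ℝ → ℝ}
    (hmono : MonotoneOn h (Ici 0)) {x p : Euc d} (hx : x ∈ hullZone K p) :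
    etaPotential K h x ≤ h (‖x - p‖ ^ 2) := by
  have hx' : p ∈ convexHull ℝ (optClass K x) := hx
  exact hmono (mem_Ici.2 (sq_nonneg _)) (mem_Ici.2 (sq_nonneg _))
    (pow_le_pow_left₀ (norm_nonneg _) (norm_sub_etaMap_le hK hne hx') 2)

theorem isPotential_etaPotential (hK : K.Finite) (hne : K.Nonempty) {h : ℝ → ℝ}
    (h0 : ∀ s ∈ Ici (0 : ℝ), 0 ≤ h s) (hmono : MonotoneOn h (Ici 0)) :
    IsPotential (etaPotential K h) := by
  refine ⟨?_, fun x => h0 _ (mem_Ici.2 (sq_nonneg _)), fun R => ?_⟩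
  · -- `h` is replaced by the monotone function `s ↦ h (max s 0)`, which is measurable.
    have h1 : Measurable fun s : ℝ => h (max s 0) := by
      refine Monotone.measurable fun s t hst => ?_
      exact hmono (mem_Ici.2 (le_max_right _ _)) (mem_Ici.2 (le_max_right _ _))
        (max_le_max hst le_rfl)
    have h2 := h1.comp ((lowerSemicontinuous_norm_sub_etaMap hK hne).measurable.pow_const 2)
    convert h2 using 1
    ext x
    simp only [etaPotential, Function.comp]
    rw [max_eq_left (sq_nonneg _)]
  · obtain ⟨C, hC⟩ := hK.isBounded.exists_norm_le
    refine ⟨h ((R + C) ^ 2), fun x hx => ?_⟩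
    obtain ⟨y, hy⟩ := optClass_nonempty hK hne x
    have h1 := norm_sub_etaMap_le hK hne (subset_convexHull ℝ _ hy)
    have h2 : ‖x - y‖ ≤ R + C := (norm_sub_le _ _).trans (add_le_add hx (hC y hy.1))
    refine hmono (mem_Ici.2 (sq_nonneg _)) (mem_Ici.2 (sq_nonneg _)) ?_
    exact pow_le_pow_left₀ (norm_nonneg _) (h1.trans h2) 2

/-- The action of a curve with square integrable velocity, as a real number. -/
theorem action_eq_ofReal_cost (hK : K.Finite) (hne : K.Nonempty) {h : ℝ → ℝ}
    (hF : IsPotential (etaPotential K h)) {δ : ℝ} (hδ : 0 < δ) {x₀ x₁ : Euc d}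
    {γ : C(Icc (0 : ℝ) δ, Euc d)} {z : ℝ → Euc d} (hγ : IsH1 (IccExtend hδ.le γ) z 0 δ)
    (h₀ : γ ⟨0, left_mem_Icc.2 hδ.le⟩ = x₀) (h₁ : γ ⟨δ, right_mem_Icc.2 hδ.le⟩ = x₁) :
    action h (oppSqDist K) hδ.le x₀ x₁ γ =
      ENNReal.ofReal (cost (etaPotential K h) (IccExtend hδ.le γ) z 0 δ) := by
  rw [action, if_pos ⟨hγ.absolutelyContinuous hδ.le, h₀, h₁⟩, cost,
    ← intervalIntegral.integral_add hγ.sq_integrable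
      (hF.intervalIntegrable hδ.le hγ.continuousOn),
    intervalIntegral.integral_of_le hδ.le, ← restrict_Ioo_eq_restrict_Ioc,
    ofReal_integral_eq_lintegral_ofReal]
  · refine lintegral_congr_ae ((ae_restrict_iff' measurableSet_Ioo).2 ?_)
    filter_upwards [hγ.ae_hasDerivAt hδ.le] with t ht hmem
    rw [(ht hmem).deriv, norm_extGrad_oppSqDist hK hne, etaPotential]
  · have := (hγ.sq_integrable.add (hF.intervalIntegrable hδ.le hγ.continuousOn)).1
    exact this.mono_set Ioo_subset_Ioc_self
  · exact ae_of_all _ fun t => add_nonneg (sq_nonneg _) (hF.nonneg _)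

theorem cost_nonneg {F : Euc d → ℝ} (hF : IsPotential F) (u w : ℝ → Euc d) {a b : ℝ}
    (hab : a ≤ b) : 0 ≤ cost F u w a b :=
  add_nonneg (intervalIntegral.integral_nonneg hab fun _ _ => sq_nonneg _)
    (intervalIntegral.integral_nonneg hab fun _ _ => hF.nonneg _)

theorem isH1_of_action_lt_top (hK : K.Finite) (hne : K.Nonempty) {h : ℝ → ℝ}
    (hF : IsPotential (etaPotential K h)) {δ : ℝ} (hδ : 0 < δ) {x₀ x₁ : Euc d}
    {γ : C(Icc (0 : ℝ) δ, Euc d)} (hγ : action h (oppSqDist K) hδ.le x₀ x₁ γ < ⊤) :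
    IsH1 (IccExtend hδ.le γ) (deriv (IccExtend hδ.le γ)) 0 δ ∧
      γ ⟨0, left_mem_Icc.2 hδ.le⟩ = x₀ ∧ γ ⟨δ, right_mem_Icc.2 hδ.le⟩ = x₁ := by
  rw [action] at hγ
  split_ifs at hγ with hcond
  · refine ⟨hcond.1.isH1 hδ.le ?_, hcond.2⟩
    rw [intervalIntegrable_iff_integrableOn_Ioo_of_le hδ.le]
    refine ⟨((stronglyMeasurable_deriv _).norm.pow 2).aestronglyMeasurable, ?_⟩
    refine lt_of_le_of_lt (lintegral_mono fun t => ?_) hγ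
    rw [Real.enorm_of_nonneg (sq_nonneg _)]
    refine ENNReal.ofReal_le_ofReal (le_add_of_nonneg_right ?_)
    rw [norm_extGrad_oppSqDist hK hne]
    exact hF.nonneg _
  · exact absurd hγ (lt_irrefl _)

/-- A competitor on a subinterval, extended by `γ` itself, is a competitor on `[0, δ]`. -/
theorem IsLocalMinimizer.exists_isLocMin (hK : K.Finite) (hne : K.Nonempty) {h : ℝ → ℝ}
    (hF : IsPotential (etaPotential K h)) {δ : ℝ} (hδ : 0 < δ) {x₀ x₁ : Euc d}
    {γ : C(Icc (0 : ℝ) δ, Euc d)} (hγ : IsLocalMinimizer h (oppSqDist K) hδ.le x₀ x₁ γ) :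
    ∃ ε, IsLocMin (etaPotential K h) (IccExtend hδ.le γ) (deriv (IccExtend hδ.le γ)) 0 δ ε := by
  obtain ⟨hfin, hmin⟩ := hγ
  obtain ⟨hH1, hγ₀, hγ₁⟩ := isH1_of_action_lt_top hK hne hF hδ hfin
  set F := etaPotential K h
  set U := IccExtend hδ.le γ with hU
  obtain ⟨ε, hε, hball⟩ := Metric.eventually_nhds_iff.1 hmin
  refine ⟨ε, hH1, hε, fun a b ha hab hb σ z hσ hσa hσb hclose => ?_⟩
  have m0 : (0 : ℝ) ∈ Icc 0 δ := ⟨le_rfl, hδ.le⟩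
  have mδ : δ ∈ Icc 0 δ := ⟨hδ.le, le_rfl⟩
  have ma : a ∈ Icc 0 δ := ⟨ha, hab.trans hb⟩
  have mb : b ∈ Icc 0 δ := ⟨ha.trans hab, hb⟩
  have hσU := IsH1.glue_isH1 hab hb hσ (hH1.mono mb mδ) hσb
  have hUσ : U a = IsH1.glue b σ U a := by rw [IsH1.glue_left hab, hσa]
  have hcomp := IsH1.glue_isH1 ha (hab.trans hb) (hH1.mono m0 ma) hσU hUσ
  have hcost : cost F (IsH1.glue a U (IsH1.glue b σ U))
      (IsH1.glue a (deriv U) (IsH1.glue b z (deriv U))) 0 δ =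
      cost F U (deriv U) 0 a + (cost F σ z a b + cost F U (deriv U) b δ) := by
    rw [cost_glue hF ha (hab.trans hb) (hH1.mono m0 ma) hσU hUσ,
      cost_glue hF hab hb hσ (hH1.mono mb mδ) hσb]
  set V := IsH1.glue a U (IsH1.glue b σ U) with hV
  have hVclose : ∀ t ∈ Icc 0 δ, ‖V t - U t‖ < ε := by
    intro t ht
    rcases le_total t a with hta | hta
    · rw [hV, IsH1.glue_left hta, sub_self, norm_zero]
      exact hε
    · rw [hV, IsH1.glue_right' hta hUσ]
      rcases le_total t b with htb | htb
      · rw [IsH1.glue_left htb]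
        exact hclose t ⟨hta, htb⟩
      · rw [IsH1.glue_right' htb hσb, sub_self, norm_zero]
        exact hε
  let γ' : C(Icc (0 : ℝ) δ, Euc d) := ⟨fun t => V t, hcomp.continuousOn.domRestrict⟩
  have hγ'V : ∀ t ∈ Icc 0 δ, IccExtend hδ.le γ' t = V t := fun t ht => by
    rw [IccExtend_of_mem _ _ ht]
    rfl
  have hγ'H1 := hcomp.congr hδ.le hγ'V (fun _ _ => rfl)
  have hU0 : U 0 = x₀ := by rw [hU, IccExtend_of_mem _ _ m0, hγ₀]
  have hUδ : U δ = x₁ := by rw [hU, IccExtend_of_mem _ _ mδ, hγ₁]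
  have e0 : γ' ⟨0, left_mem_Icc.2 hδ.le⟩ = x₀ := by
    change V 0 = x₀
    rw [hV, IsH1.glue_left ha, hU0]
  have e1 : γ' ⟨δ, right_mem_Icc.2 hδ.le⟩ = x₁ := by
    change V δ = x₁
    rw [hV, IsH1.glue_right' (hab.trans hb) hUσ, IsH1.glue_right' hb hσb, hUδ]
  have hdist : dist γ' γ < ε := by
    rw [ContinuousMap.dist_lt_iff hε]
    intro t
    have h1 := hVclose t t.2
    rw [hU, IccExtend_of_mem _ _ t.2] at h1
    rw [dist_eq_norm]
    exact h1
  have key := hball hdist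
  rw [action_eq_ofReal_cost hK hne hF hδ hH1 hγ₀ hγ₁,
    action_eq_ofReal_cost hK hne hF hδ hγ'H1 e0 e1,
    ENNReal.ofReal_le_ofReal_iff (cost_nonneg hF _ _ hδ.le),
    cost_congr F hδ.le (fun t ht => hγ'V t (Ioc_subset_Icc_self ht)) fun _ _ => rfl, hcost,
    ← cost_add hF hH1 ha (hab.trans hb), ← cost_add hF (hH1.mono ma mδ) hab hb] at key
  linarith

end LocalMinimality

/-! ### Projection on a closed convex set -/

section Projection

variable {d : ℕ}

theorem inner_sub_nearestPoint_le {C : Set (Euc d)} (hC : Convex ℝ C) (hne : C.Nonempty)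
    (hcl : IsClosed C) (x : Euc d) {q : Euc d} (hq : q ∈ C) :
    inner ℝ (x - nearestPoint C x) (q - nearestPoint C x) ≤ 0 := by
  obtain ⟨hmem, hle⟩ := nearestPoint_spec hne hcl x
  refine (norm_eq_iInf_iff_real_inner_le_zero hC hmem).1 ?_ q hq
  have : Nonempty C := hne.to_subtype
  exact le_antisymm (le_ciInf fun z => hle z z.2)
    (ciInf_le (f := fun z : C => ‖x - z‖) ⟨0, by rintro _ ⟨z, rfl⟩; exact norm_nonneg _⟩
      ⟨nearestPoint C x, hmem⟩)

theorem lipschitzWith_nearestPoint {C : Set (Euc d)} (hC : Convex ℝ C) (hne : C.Nonempty)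
    (hcl : IsClosed C) : LipschitzWith 1 (nearestPoint C) := by
  refine LipschitzWith.of_dist_le_mul fun x y => ?_
  rw [dist_eq_norm, dist_eq_norm, NNReal.coe_one, one_mul]
  set p := nearestPoint C x
  set q := nearestPoint C y
  have h1 : inner ℝ (x - p) (q - p) ≤ 0 :=
    inner_sub_nearestPoint_le hC hne hcl x (nearestPoint_spec hne hcl y).1
  have h2 : inner ℝ (y - q) (p - q) ≤ 0 :=
    inner_sub_nearestPoint_le hC hne hcl y (nearestPoint_spec hne hcl x).1
  have h3 : inner ℝ (x - y) (p - q) =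
      ‖p - q‖ ^ 2 - inner ℝ (x - p) (q - p) - inner ℝ (y - q) (p - q) := by
    rw [← real_inner_self_eq_norm_sq]
    simp only [inner_sub_left, inner_sub_right]
    ring
  have h4 := real_inner_le_norm (x - y) (p - q)
  by_contra hlt
  have := mul_lt_mul_of_pos_right (not_le.1 hlt) ((norm_nonneg _).trans_lt (not_le.1 hlt))
  nlinarith

theorem nearestPoint_eq_self {C : Set (Euc d)} (hC : Convex ℝ C) {x : Euc d} (hx : x ∈ C) :
    nearestPoint C x = x :=
  nearestPoint_unique hC hx fun z _ => by simp

end Projection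

/-! ### Behaviour of a minimizer to the right of a given time -/

section Germ

variable {d : ℕ} {K : Set (Euc d)} {h : ℝ → ℝ} {u w : ℝ → Euc d} {α β ε a : ℝ}

theorem eventually_potential_near (hK : K.Finite) (hne : K.Nonempty)
    (hc : ContinuousOn h (Ici 0)) (x : Euc d) {ω : ℝ} (hω : 0 < ω) :
    ∀ᶠ z in 𝓝 x, ∀ p ∈ range (etaMap K), |h (‖z - p‖ ^ 2) - h (‖x - p‖ ^ 2)| < ω := by
  refine (eventually_all_finite (finite_range_etaMap hK hne)).2 fun p _ => ?_
  have h1 : Continuous fun z : Euc d => h (‖z - p‖ ^ 2) :=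
    hc.comp_continuous (by fun_prop) fun z => mem_Ici.2 (sq_nonneg _)
  have h2 := (h1.tendsto x).eventually (Metric.ball_mem_nhds _ hω)
  filter_upwards [h2] with z hz
  rwa [Real.dist_eq] at hz

theorem exists_potential_gap (hK : K.Finite) (hne : K.Nonempty)
    (hm : StrictMonoOn h (Ici 0)) (x p : Euc d) :
    ∃ c > 0, ∀ q ∈ range (etaMap K), ‖x - p‖ < ‖x - q‖ →
      h (‖x - p‖ ^ 2) + c ≤ h (‖x - q‖ ^ 2) := by
  have h1 : ∀ᶠ c : ℝ in 𝓝[>] 0, ∀ q ∈ range (etaMap K), ‖x - p‖ < ‖x - q‖ →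
      h (‖x - p‖ ^ 2) + c ≤ h (‖x - q‖ ^ 2) := by
    refine (eventually_all_finite (finite_range_etaMap hK hne)).2 fun q _ => ?_
    by_cases hlt : ‖x - p‖ < ‖x - q‖
    · have h2 : h (‖x - p‖ ^ 2) < h (‖x - q‖ ^ 2) :=
        hm (mem_Ici.2 (sq_nonneg _)) (mem_Ici.2 (sq_nonneg _))
          (pow_lt_pow_left₀ hlt (norm_nonneg _) two_ne_zero)
      have h3 : ∀ᶠ c : ℝ in 𝓝[>] 0, c < h (‖x - q‖ ^ 2) - h (‖x - p‖ ^ 2) :=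
        nhdsWithin_le_nhds (gt_mem_nhds (sub_pos.2 h2))
      filter_upwards [h3] with c hc _
      linarith
    · exact Eventually.of_forall fun c hcon => absurd hcon hlt
  obtain ⟨c, hc, hpos⟩ := (h1.and self_mem_nhdsWithin).exists
  exact ⟨c, hpos, hc⟩

theorem eventually_forall_Ioc {a : ℝ} {P : ℝ → Prop} (h : ∀ᶠ t in 𝓝[>] a, P t) :
    ∀ᶠ s in 𝓝[>] a, ∀ t ∈ Ioc a s, P t := by
  obtain ⟨b, hb, hsub⟩ := mem_nhdsGT_iff_exists_Ioo_subset.1 h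
  filter_upwards [Ioo_mem_nhdsGT hb] with s hs t ht
  exact hsub ⟨ht.1, ht.2.trans_lt hs.2⟩

theorem IsH1.eventually_forall_Icc (hu : IsH1 u w α β) (ha : α ≤ a) (haβ : a < β)
    {P : Euc d → Prop} (hP : ∀ᶠ z in 𝓝 (u a), P z) :
    ∀ᶠ s in 𝓝[>] a, ∀ t ∈ Icc a s, P (u t) := by
  have h1 : Tendsto u (𝓝[>] a) (𝓝 (u a)) := by
    have h2 := hu.continuousOn a ⟨ha, haβ.le⟩
    refine h2.mono_left ?_
    rw [← nhdsWithin_Ioc_eq_nhdsGT haβ]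
    exact nhdsWithin_mono _ fun t ht => ⟨ha.trans ht.1.le, ht.2⟩
  filter_upwards [eventually_forall_Ioc (h1.eventually hP)] with s hs t ht
  rcases ht.1.eq_or_lt with rfl | hlt
  · exact hP.self_of_nhds
  · exact hs t ⟨hlt, ht.2⟩

/-- If `η` equals `p` at both ends of a short time interval, and is nowhere closer to `x` than `p`,
then it is constant: otherwise projecting the curve on the convex set `hullZone K p` would strictly
decrease the potential without increasing the speed. -/
theorem IsLocMin.etaMap_eq_of_endpoints (hK : K.Finite) (hne : K.Nonempty)
    (h0 : ∀ s ∈ Ici (0 : ℝ), 0 ≤ h s) (hmono : MonotoneOn h (Ici 0))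
    (hmin : IsLocMin (etaPotential K h) u w α β ε) {x p : Euc d} {r b c : ℝ} (hr : 2 * r ≤ ε)
    (hsub : ∀ z, ‖z - x‖ < r → optClass K z ⊆ optClass K x)
    (hgap : ∀ z z', ‖z - x‖ < r → ‖z' - x‖ < r → ∀ q ∈ range (etaMap K),
      ‖x - p‖ < ‖x - q‖ → h (‖z - p‖ ^ 2) < h (‖z' - q‖ ^ 2))
    (hb : α ≤ b) (hbc : b ≤ c) (hcβ : c ≤ β) (hball : ∀ t ∈ Icc b c, ‖u t - x‖ < r)
    (hub : etaMap K (u b) = p) (huc : etaMap K (u c) = p)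
    (hdich : ∀ t ∈ Icc b c, etaMap K (u t) = p ∨ ‖x - p‖ < ‖x - etaMap K (u t)‖) :
    ∀ t ∈ Icc b c, etaMap K (u t) = p := by
  have hF := isPotential_etaPotential hK hne h0 hmono
  set F := etaPotential K h
  have hzone : ∀ t, etaMap K (u t) = p → u t ∈ hullZone K p := fun t ht => by
    rw [← ht]
    exact mem_hullZone_etaMap hK hne _
  have mb : b ∈ Icc b c := ⟨le_rfl, hbc⟩
  have mc : c ∈ Icc b c := ⟨hbc, le_rfl⟩
  have hx : x ∈ hullZone K p := convexHull_mono (hsub _ (hball b mb)) (hzone b hub)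
  have hconv := convex_hullZone hK hne p
  have hlip := lipschitzWith_nearestPoint hconv ⟨x, hx⟩ (isClosed_hullZone hK hne p)
  set P := nearestPoint (hullZone K p) with hPdef
  have hPx : P x = x := nearestPoint_eq_self hconv hx
  have hPball : ∀ z, ‖P z - x‖ ≤ ‖z - x‖ := fun z => by
    have := hlip.dist_le_mul z x
    rw [dist_eq_norm, dist_eq_norm, hPx, NNReal.coe_one, one_mul] at this
    exact this
  have hPF : ∀ z, F (P z) ≤ h (‖P z - p‖ ^ 2) := fun z =>
    etaPotential_le_of_mem_hullZone hK hne hmono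
      (nearestPoint_spec ⟨x, hx⟩ (isClosed_hullZone hK hne p) z).1
  have hu : IsH1 u w b c := hmin.isH1.mono ⟨hb, hbc.trans hcβ⟩ ⟨hb.trans hbc, hcβ⟩
  have hlt : ∀ t ∈ Icc b c, etaMap K (u t) ≠ p → F (P (u t)) < F (u t) := fun t ht hne' =>
    (hPF _).trans_lt (hgap _ _ ((hPball _).trans_lt (hball t ht)) (hball t ht) _
      (mem_range_self _) ((hdich t ht).resolve_left hne'))
  have hle : ∀ t ∈ Icc b c, F (P (u t)) ≤ F (u t) := fun t ht => by
    by_cases hp : etaMap K (u t) = p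
    · rw [show P (u t) = u t from nearestPoint_eq_self hconv (hzone t hp)]
    · exact (hlt t ht hp).le
  obtain ⟨z, hz, hzle⟩ := hu.exists_comp_lipschitz hbc hlip
  have hcost := hmin.cost_le b c hb hbc hcβ _ z hz (nearestPoint_eq_self hconv (hzone b hub))
    (nearestPoint_eq_self hconv (hzone c huc)) fun t ht => by
      have h1 := hball t ht
      have h2 := hPball (u t)
      have h3 : ‖P (u t) - u t‖ ≤ ‖P (u t) - x‖ + ‖u t - x‖ := by
        rw [← norm_neg (u t - x), neg_sub]
        exact norm_sub_le_norm_sub_add_norm_sub _ _ _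
      linarith
  have hi1 := hF.intervalIntegrable hbc hu.continuousOn
  have hi2 := hF.intervalIntegrable hbc hz.continuousOn
  have hint : ∫ t in b..c, (F (u t) - F (P (u t))) ≤ 0 := by
    rw [intervalIntegral.integral_sub hi1 hi2]
    rw [cost, cost] at hcost
    linarith
  intro t₀ ht₀
  by_contra hbad
  have hb' : b < t₀ := lt_of_le_of_ne ht₀.1 fun heq => hbad (heq ▸ hub)
  have hc' : t₀ < c := lt_of_le_of_ne ht₀.2 fun heq => hbad (heq ▸ huc)
  have hev := eventually_etaMap_ne hK hne (hsub _ (hball t₀ ht₀)) ((hdich t₀ ht₀).resolve_left hbad)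
  have hcont : ContinuousAt u t₀ := hu.continuousOn.continuousAt (Icc_mem_nhds hb' hc')
  obtain ⟨b', c', hmem, hIoo⟩ := mem_nhds_iff_exists_Ioo_subset.1
    ((hcont.eventually hev).and (Ioo_mem_nhds hb' hc'))
  obtain ⟨b'', hb''⟩ := exists_between hmem.1
  obtain ⟨c'', hc''⟩ := exists_between hmem.2
  have hsub' : Icc b'' c'' ⊆ Ioo b' c' := fun t ht => ⟨hb''.1.trans_le ht.1, ht.2.trans_lt hc''.2⟩
  have hbc'' : b'' < c'' := hb''.2.trans hc''.1
  have m1 := (hIoo (hsub' ⟨le_rfl, hbc''.le⟩)).2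
  have m2 := (hIoo (hsub' ⟨hbc''.le, le_rfl⟩)).2
  have hpos : 0 < ∫ t in b''..c'', (F (u t) - F (P (u t))) := by
    refine intervalIntegral.intervalIntegral_pos_of_pos_on ((hi1.sub hi2).mono_set ?_)
      (fun t ht => ?_) hbc''
    · exact IsH1.uIcc_subset (Ioo_subset_Icc_self m1) (Ioo_subset_Icc_self m2)
    · have h1 := hIoo (hsub' (Ioo_subset_Icc_self ht))
      exact sub_pos.2 (hlt t (Ioo_subset_Icc_self h1.2) h1.1)
  have hmonoint : ∫ t in b''..c'', (F (u t) - F (P (u t))) ≤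
      ∫ t in b..c, (F (u t) - F (P (u t))) := by
    refine intervalIntegral.integral_mono_interval m1.1.le hbc''.le m2.2.le ?_ (hi1.sub hi2)
    refine (ae_restrict_iff' measurableSet_Ioc).2 (ae_of_all _ fun t ht => ?_)
    exact sub_nonneg.2 (hle t (Ioc_subset_Icc_self ht))
  linarith

theorem cost_comp_mul_add (F : Euc d → ℝ) (u w : ℝ → Euc d) {l : ℝ} (hl : 0 < l) (m a b : ℝ) :
    cost F (fun t => u (l * t + m)) (fun t => l • w (l * t + m)) a b =
      l * (∫ t in (l * a + m)..(l * b + m), ‖w t‖ ^ 2) +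
        l⁻¹ * ∫ t in (l * a + m)..(l * b + m), F (u t) := by
  have h1 : (fun t => ‖l • w (l * t + m)‖ ^ 2) = fun t => l ^ 2 * ‖w (l * t + m)‖ ^ 2 := by
    ext t
    rw [norm_smul, mul_pow, Real.norm_eq_abs, sq_abs]
  rw [cost, h1, intervalIntegral.integral_const_mul,
    intervalIntegral.integral_comp_mul_add (fun t => ‖w t‖ ^ 2) hl.ne',
    intervalIntegral.integral_comp_mul_add (fun t => F (u t)) hl.ne', smul_eq_mul, smul_eq_mul]
  field_simp

theorem cost_line_le {F : Euc d → ℝ} (hF : IsPotential F) (p v : Euc d) {a b c C : ℝ} (hab : a ≤ b)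
    (hC : ∀ t ∈ Icc a b, F (p + (t - c) • v) ≤ C) :
    cost F (fun t => p + (t - c) • v) (fun _ => v) a b ≤ (b - a) * (‖v‖ ^ 2 + C) := by
  have h1 := intervalIntegral.integral_mono_on hab
    (hF.intervalIntegrable hab (IsH1.line p v a b c).continuousOn) intervalIntegrable_const hC
  rw [intervalIntegral.integral_const, smul_eq_mul] at h1
  rw [cost, intervalIntegral.integral_const, smul_eq_mul]
  linarith

theorem mul_le_integral_potential {F : Euc d → ℝ} (hF : IsPotential F) {a b C : ℝ} (hab : a ≤ b)
    (hu : IsH1 u w a b) (hC : ∀ t ∈ Ioc a b, C ≤ F (u t)) :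
    (b - a) * C ≤ ∫ t in a..b, F (u t) := by
  have h1 := intervalIntegral.integral_mono_on_of_le_Ioo hab intervalIntegrable_const
    (hF.intervalIntegrable hab hu.continuousOn) fun t ht => hC t (Ioo_subset_Ioc_self ht)
  rwa [intervalIntegral.integral_const, smul_eq_mul] at h1

/-- A minimizer is Lipschitz at each time: otherwise it would be cheaper to start more slowly, along
a segment, and to run through the rest of the curve slightly faster. -/
theorem IsLocMin.exists_norm_sub_le {F : Euc d → ℝ} (hF : IsPotential F)
    (hmin : IsLocMin F u w α β ε) (ha : α ≤ a) (haβ : a < β) :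
    ∃ M, ∀ᶠ s in 𝓝[>] a, ‖u s - u a‖ ≤ M * (s - a) := by
  have hε := hmin.eps_pos
  have hev := eventually_norm_sub_lt (u a) (half_pos hε)
  obtain ⟨b, hb, hbmem⟩ := ((hmin.isH1.eventually_forall_Icc ha haβ hev).and
    (Ioc_mem_nhdsGT haβ)).exists
  obtain ⟨B, hB⟩ := hF.bound (‖u a‖ + ε / 2)
  have hab : a < b := hbmem.1
  have hu : IsH1 u w a b := hmin.isH1.mono ⟨ha, haβ.le⟩ ⟨ha.trans hab.le, hbmem.2⟩
  set A := ∫ t in a..b, ‖w t‖ ^ 2 with hA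
  refine ⟨√(4 * B + 4 * A / (b - a)), ?_⟩
  have hsmall : a < a + (b - a) / 4 := by linarith
  filter_upwards [Ioc_mem_nhdsGT hsmall] with s hs
  set τ := s - a with hτdef
  have hτ : 0 < τ := sub_pos.2 hs.1
  have hτb : 4 * τ ≤ b - a := by linarith [hs.2]
  have hsb : s ∈ Icc a b := ⟨hs.1.le, by linarith⟩
  have ma : a ∈ Icc a b := ⟨le_rfl, hab.le⟩
  have mb : b ∈ Icc a b := ⟨hab.le, le_rfl⟩
  -- The competitor reaches `u s` along a segment in time `2 * τ`, twice the time that `u` takes,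
  -- and makes up for the delay by running through the rest of the curve at the relative speed `l`.
  set c := a + 2 * τ with hc
  set v := (2 * τ)⁻¹ • (u s - u a) with hv
  set l := (b - s) / (b - c) with hl
  have hbc : 0 < b - c := by linarith
  have hbs : 0 < b - s := by linarith
  have hlpos : 0 < l := div_pos hbs hbc
  have hl1 : l - 1 ≤ 2 * τ / (b - a) := by
    rw [hl, div_sub_one hbc.ne', div_le_div_iff₀ hbc (by linarith)]
    nlinarith
  have hlinv : l⁻¹ ≤ 1 := inv_le_one_of_one_le₀ (by rw [hl, one_le_div hbc]; linarith)
  have e1 : l * c + (b - l * b) = s := by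
    have : l * (b - c) = b - s := div_mul_cancel₀ _ hbc.ne'
    linarith
  have e2 : l * b + (b - l * b) = b := by ring
  have hmap : ∀ t ∈ Icc c b, l * t + (b - l * b) ∈ Icc a b := fun t ht => by
    have h1 := mul_le_mul_of_nonneg_left ht.1 hlpos.le
    have h2 := mul_le_mul_of_nonneg_left ht.2 hlpos.le
    exact ⟨by linarith, by linarith⟩
  have hclose : ∀ z : Euc d, ‖z - u a‖ ≤ ε / 2 → ∀ t ∈ Icc a b, ‖z - u t‖ < ε := by
    intro z hz t ht
    have h1 := hb t ht
    have h2 : ‖z - u t‖ ≤ ‖z - u a‖ + ‖u t - u a‖ := by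
      rw [← norm_neg (u t - u a), neg_sub]
      exact norm_sub_le_norm_sub_add_norm_sub _ _ _
    linarith
  have hline : ∀ t ∈ Icc a c, ‖u a + (t - a) • v - u a‖ ≤ ε / 2 := by
    intro t ht
    have h1 : ‖(t - a) • v‖ ≤ ‖u s - u a‖ := by
      rw [hv, smul_smul, norm_smul, Real.norm_eq_abs,
        abs_of_nonneg (mul_nonneg (by linarith [ht.1]) (by positivity))]
      refine mul_le_of_le_one_left (norm_nonneg _) ?_
      rw [← div_eq_mul_inv, div_le_one (by linarith)]
      linarith [ht.2]
    rw [add_sub_cancel_left]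
    exact h1.trans (hb s hsb).le
  have hcost := hmin.cost_le_add hF ha (c := c) (by linarith) (by linarith) hbmem.2
    (IsH1.line (u a) v a c a)
    (IsH1.comp_mul_add (u := u) (w := w) l (b - l * b) hlpos (by rw [e1, e2]; exact hu.mono hsb mb))
    (by
      rw [e1, hv, smul_smul, show (c - a) * (2 * τ)⁻¹ = 1 by
        rw [hc, add_sub_cancel_left]; exact mul_inv_cancel₀ (by positivity), one_smul]
      abel) (by simp) (by rw [e2])
    (fun t ht => hclose _ (hline t ht) t ⟨ht.1, ht.2.trans (by linarith)⟩)
    (fun t ht => hclose _ (hb _ (hmap t ht)).le t ⟨by linarith [ht.1], ht.2⟩)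
  rw [cost_comp_mul_add F u w hlpos, e1, e2] at hcost
  have hcl := cost_line_le hF (u a) v (a := a) (b := c) (c := a) (C := B) (by linarith)
    fun t ht => hB _ (by
      have h1 := hline t ht
      have h2 := norm_add_le (u a + (t - a) • v - u a) (u a)
      rw [sub_add_cancel] at h2
      linarith)
  have hkin := (hu.mono ma hsb).norm_sub_sq_le hs.1.le
  rw [cost, ← intervalIntegral.integral_add_adjacent_intervals
    (hu.mono ma hsb).sq_integrable (hu.mono hsb mb).sq_integrable,
    ← intervalIntegral.integral_add_adjacent_intervals
    (hF.intervalIntegrable hs.1.le (hu.mono ma hsb).continuousOn)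
    (hF.intervalIntegrable hsb.2 (hu.mono hsb mb).continuousOn)] at hcost
  rw [← intervalIntegral.integral_add_adjacent_intervals
    (hu.mono ma hsb).sq_integrable (hu.mono hsb mb).sq_integrable] at hA
  set I₁ := ∫ t in a..s, ‖w t‖ ^ 2
  set I₂ := ∫ t in s..b, ‖w t‖ ^ 2
  have hI₁ : 0 ≤ I₁ := intervalIntegral.integral_nonneg hs.1.le fun _ _ => sq_nonneg _
  have hI₂ : 0 ≤ I₂ := intervalIntegral.integral_nonneg hsb.2 fun _ _ => sq_nonneg _
  have hJ₁ : 0 ≤ ∫ t in a..s, F (u t) :=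
    intervalIntegral.integral_nonneg hs.1.le fun _ _ => hF.nonneg _
  have hJ₂ : 0 ≤ ∫ t in s..b, F (u t) :=
    intervalIntegral.integral_nonneg hsb.2 fun _ _ => hF.nonneg _
  have hJ₂' := mul_le_mul_of_nonneg_right hlinv hJ₂
  have hlI : (l - 1) * I₂ ≤ 2 * τ / (b - a) * A := by
    refine mul_le_mul hl1 (by linarith) hI₂ (div_nonneg (by linarith) (by linarith))
  have hvsq : (c - a) * ‖v‖ ^ 2 = ‖u s - u a‖ ^ 2 / (2 * τ) := by
    rw [hv, norm_smul, mul_pow, Real.norm_eq_abs, sq_abs, hc]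
    field_simp
    ring
  have hX : ‖u s - u a‖ ^ 2 / τ ≤ I₁ := by
    rw [div_le_iff₀ hτ]
    linarith
  have hX2 : ‖u s - u a‖ ^ 2 / τ = 2 * (‖u s - u a‖ ^ 2 / (2 * τ)) := by
    field_simp
  have hfin : ‖u s - u a‖ ^ 2 / (2 * τ) ≤ 2 * τ * B + 2 * τ / (b - a) * A := by
    have : (c - a) * (‖v‖ ^ 2 + B) = ‖u s - u a‖ ^ 2 / (2 * τ) + 2 * τ * B := by
      rw [mul_add, hvsq, hc]
      ring
    linarith
  rw [div_le_iff₀ (by positivity)] at hfin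
  have hfin' : ‖u s - u a‖ ^ 2 ≤ (4 * B + 4 * A / (b - a)) * τ ^ 2 := by
    refine hfin.trans (le_of_eq ?_)
    ring
  calc ‖u s - u a‖ = √(‖u s - u a‖ ^ 2) := (Real.sqrt_sq (norm_nonneg _)).symm
    _ ≤ √((4 * B + 4 * A / (b - a)) * τ ^ 2) := Real.sqrt_le_sqrt hfin'
    _ = √(4 * B + 4 * A / (b - a)) * τ := by
      rw [Real.sqrt_mul' _ (sq_nonneg _), Real.sqrt_sq hτ.le]

end Germ

/-! ### Blow-up at a given time -/

section BlowUp

variable {d : ℕ} {K : Set (Euc d)} {h : ℝ → ℝ} {u w : ℝ → Euc d} {α β ε a : ℝ}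

/-- Conical form of the semicontinuity of the optimality class: near the ray from `x` in the
direction `v`, optimality classes are contained in the one along the ray. -/
theorem exists_optClass_add_smul_subset (hK : K.Finite) (hne : K.Nonempty) {x v : Euc d} {k₀ : ℝ}
    (hk₀ : 0 < k₀) (hv : optClass K (x + k₀ • v) ⊆ optClass K x) :
    ∃ ρ > 0, ∀ y k, 0 < k → k ≤ k₀ → ‖y - v‖ < ρ →
      optClass K (x + k • y) ⊆ optClass K (x + k₀ • v) := by
  have h1 : Tendsto (fun y : Euc d => x + k₀ • y) (𝓝 v) (𝓝 (x + k₀ • v)) :=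
    Continuous.tendsto (by fun_prop) v
  obtain ⟨ρ, hρ, hball⟩ := Metric.eventually_nhds_iff.1
    (h1.eventually (eventually_optClass_subset hK hne (x + k₀ • v)))
  refine ⟨ρ, hρ, fun y k hk hkk hy => ?_⟩
  have h2 : optClass K (x + k₀ • y) ⊆ optClass K (x + k₀ • v) :=
    hball (by rwa [dist_eq_norm])
  have h3 := optClass_add_smul hK hne (h2.trans hv) (div_pos hk hk₀) ((div_le_one hk₀).2 hkk)
  rw [add_sub_cancel_left, smul_smul, div_mul_cancel₀ _ hk₀.ne'] at h3
  rwa [h3]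

theorem IsLocMin.eventually_le_potential (hK : K.Finite) (hne : K.Nonempty)
    (hc : ContinuousOn h (Ici 0)) (hmono : MonotoneOn h (Ici 0))
    (hmin : IsLocMin (etaPotential K h) u w α β ε) (ha : α ≤ a) (haβ : a < β) {p : Euc d}
    (hlow : ∀ᶠ t in 𝓝[>] a, ‖u a - p‖ ≤ ‖u a - etaMap K (u t)‖) {ω : ℝ} (hω : 0 < ω) :
    ∀ᶠ s in 𝓝[>] a, ∀ t ∈ Ioc a s, h (‖u a - p‖ ^ 2) - ω ≤ etaPotential K h (u t) := by
  filter_upwards [eventually_forall_Ioc hlow, hmin.isH1.eventually_forall_Icc ha haβ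
    (eventually_potential_near hK hne hc (u a) hω)] with s h1 h2 t ht
  have h3 := abs_lt.1 (h2 t (Ioc_subset_Icc_self ht) _ (mem_range_self (u t)))
  have h4 : h (‖u a - p‖ ^ 2) ≤ h (‖u a - etaMap K (u t)‖ ^ 2) :=
    hmono (mem_Ici.2 (sq_nonneg _)) (mem_Ici.2 (sq_nonneg _))
      (pow_le_pow_left₀ (norm_nonneg _) (h1 t ht) 2)
  rw [etaPotential]
  linarith [h3.1]

/-- Comparison with the uniform motion along the segment `[u a, u s]`, which stays in `hullZone K p`
if `η (u s) = p`: the variance of the velocity plus the potential energy is at most the potential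
energy of the segment, which is at most `h (|u a - p|²) + ω` per unit of time. -/
theorem IsLocMin.eventually_excess_le (hK : K.Finite) (hne : K.Nonempty)
    (h0 : ∀ s ∈ Ici (0 : ℝ), 0 ≤ h s)
    (hc : ContinuousOn h (Ici 0)) (hmono : MonotoneOn h (Ici 0))
    (hmin : IsLocMin (etaPotential K h) u w α β ε) (ha : α ≤ a) (haβ : a < β) {p : Euc d}
    {ω : ℝ} (hω : 0 < ω) :
    ∀ᶠ s in 𝓝[>] a, etaMap K (u s) = p → ∀ v : Euc d, u s - u a = (s - a) • v →
      (∫ t in a..s, ‖w t - v‖ ^ 2) + ∫ t in a..s, etaPotential K h (u t) ≤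
        (s - a) * (h (‖u a - p‖ ^ 2) + ω) := by
  have hF := isPotential_etaPotential hK hne h0 hmono
  have hε := hmin.eps_pos
  filter_upwards [hmin.isH1.eventually_forall_Icc ha haβ
    (eventually_norm_sub_lt (u a) (half_pos hε)), hmin.isH1.eventually_forall_Icc ha haβ
    (eventually_optClass_subset hK hne (u a)), Ioc_mem_nhdsGT haβ,
    hmin.isH1.eventually_forall_Icc ha haβ (P := fun z => ∀ l ∈ Icc (0 : ℝ) 1,
      ∀ q ∈ range (etaMap K), h (‖u a + l • (z - u a) - q‖ ^ 2) < h (‖u a - q‖ ^ 2) + ω) (by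
        obtain ⟨r, hr, hball⟩ := Metric.eventually_nhds_iff.1
          (eventually_potential_near hK hne hc (u a) hω)
        filter_upwards [eventually_norm_sub_lt (u a) hr] with z hz l hl q hq
        have h1 : dist (u a + l • (z - u a)) (u a) < r := by
          rw [dist_eq_norm, add_sub_cancel_left, norm_smul, Real.norm_of_nonneg hl.1]
          exact (mul_le_of_le_one_left (norm_nonneg _) hl.2).trans_lt hz
        linarith [(abs_lt.1 (hball h1 q hq)).2])]
    with s hs hopt hsβ hpot hp v hv
  have hsa : 0 < s - a := sub_pos.2 hsβ.1
  have ms : s ∈ Icc a s := ⟨hsβ.1.le, le_rfl⟩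
  have hzs : u s ∈ hullZone K p := by
    rw [← hp]
    exact mem_hullZone_etaMap hK hne _
  have hza : u a ∈ hullZone K p := convexHull_mono (hopt s ms) hzs
  -- Points of the segment are parametrized by the fraction of elapsed time.
  have hseg : ∀ t ∈ Icc a s, ∃ l ∈ Icc (0 : ℝ) 1, u a + (t - a) • v = u a + l • (u s - u a) := by
    intro t ht
    refine ⟨(t - a) / (s - a), ⟨div_nonneg (by linarith [ht.1]) hsa.le,
      (div_le_one hsa).2 (by linarith [ht.2])⟩, ?_⟩
    rw [hv, smul_smul, div_mul_cancel₀ _ hsa.ne']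
  have hu : IsH1 u w a s := hmin.isH1.mono ⟨ha, haβ.le⟩ ⟨ha.trans hsβ.1.le, hsβ.2⟩
  have hcost := hmin.cost_le a s ha hsβ.1.le hsβ.2 _ _ (IsH1.line (u a) v a s a) (by simp)
    (by rw [← hv]; abel) (fun t ht => by
      obtain ⟨l, hl, heq⟩ := hseg t ht
      have h1 : ‖u a + (t - a) • v - u a‖ < ε / 2 := by
        rw [heq, add_sub_cancel_left, norm_smul, Real.norm_of_nonneg hl.1]
        exact (mul_le_of_le_one_left (norm_nonneg _) hl.2).trans_lt (hs s ms)
      have h2 := hs t ht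
      have h3 := norm_sub_le_norm_sub_add_norm_sub (u a + (t - a) • v) (u a) (u t)
      rw [norm_sub_rev (u a) (u t)] at h3
      linarith)
  have hline := cost_line_le hF (u a) v (c := a) (C := h (‖u a - p‖ ^ 2) + ω) hsβ.1.le
    (fun t ht => by
      obtain ⟨l, hl, heq⟩ := hseg t ht
      rw [heq]
      have hz : u a + l • (u s - u a) ∈ hullZone K p :=
        (convex_hullZone hK hne p).add_smul_sub_mem hza hzs hl
      exact (etaPotential_le_of_mem_hullZone hK hne hmono hz).trans
        (hpot s ms l hl p ⟨u s, hp⟩).le)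
  have hkin := (hu.integral_norm_sub_sq hsβ.1.le hv).2
  rw [cost] at hcost
  linarith

/-- If `η` takes the value `p` at times decreasing to `a`, no value at such times is closer to
`u a`, and the velocities of the curve at these times converge to `v`, then `η` has the value `p`
along the ray from `u a` in the direction `v`: otherwise following this ray is cheaper. -/
theorem IsLocMin.etaMap_ray_eq (hK : K.Finite) (hne : K.Nonempty)
    (h0 : ∀ s ∈ Ici (0 : ℝ), 0 ≤ h s) (hc : ContinuousOn h (Ici 0))
    (hm : StrictMonoOn h (Ici 0))
    (hmin : IsLocMin (etaPotential K h) u w α β ε) (ha : α ≤ a) (haβ : a < β) {p : Euc d}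
    (hlow : ∀ᶠ t in 𝓝[>] a, ‖u a - p‖ ≤ ‖u a - etaMap K (u t)‖) {L : Filter ℝ} [L.NeBot]
    (hL : L ≤ 𝓝[>] a) (hLp : ∀ᶠ s in L, etaMap K (u s) = p) {v : Euc d}
    (hv : Tendsto (fun s => (s - a)⁻¹ • (u s - u a)) L (𝓝 v)) {k₀ : ℝ} (hk₀ : 0 < k₀)
    (hopt : optClass K (u a + k₀ • v) ⊆ optClass K (u a)) :
    etaMap K (u a + k₀ • v) = p := by
  have hmono := hm.monotoneOn
  have hF := isPotential_etaPotential hK hne h0 hmono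
  have hε := hmin.eps_pos
  set x := u a with hx
  set q := etaMap K (x + k₀ • v) with hq
  have hadd : ∀ s, a < s → u s = x + (s - a) • ((s - a)⁻¹ • (u s - x)) := fun s hs => by
    rw [smul_smul, mul_inv_cancel₀ (sub_pos.2 hs).ne', one_smul]
    abel
  have hp : p ∈ convexHull ℝ (optClass K (x + k₀ • v)) := by
    obtain ⟨ρ, hρ, hsub⟩ := exists_optClass_add_smul_subset hK hne hk₀ hopt
    obtain ⟨s, hs1, hs2, hs3⟩ := (hLp.and ((hv.eventually (eventually_norm_sub_lt v hρ)).and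
      (hL (Ioc_mem_nhdsGT (show a < a + k₀ by linarith))))).exists
    have h1 := hsub _ (s - a) (sub_pos.2 hs3.1) (by linarith [hs3.2]) hs2
    rw [← hadd s hs3.1] at h1
    rw [← hs1]
    exact convexHull_mono h1 (etaMap_mem hK hne _)
  by_contra hqp
  have hlt : ‖x - q‖ < ‖x - p‖ := by
    by_contra hle
    exact hqp (eq_etaMap_of_norm_sub_le hK hne hopt hp (not_lt.1 hle)).symm
  set hp' := h (‖x - p‖ ^ 2) with hhp
  set hq' := h (‖x - q‖ ^ 2) with hhq
  have hΔ : 0 < hp' - hq' := sub_pos.2 (hm (mem_Ici.2 (sq_nonneg _)) (mem_Ici.2 (sq_nonneg _))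
    (pow_lt_pow_left₀ hlt (norm_nonneg _) two_ne_zero))
  have hq0 : 0 ≤ hq' := h0 _ (mem_Ici.2 (sq_nonneg _))
  -- The gain in potential is `8 * ω`, and each of the errors below is at most `ω`.
  set ω := (hp' - hq') / 8 with hω
  have hωpos : 0 < ω := by positivity
  obtain ⟨B, hB⟩ := hF.bound (‖x‖ + 1)
  have hB0 : 0 ≤ B := (hF.nonneg x).trans (hB x (by linarith))
  -- The competitor follows the ray for the fraction `1 - k` of the time, with velocity `v`, and
  -- then joins `u s` with velocity `v'`, which is close to `v` when the mean velocity `v₁` is.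
  obtain ⟨k, hk0, hk1, hkB⟩ : ∃ k : ℝ, 0 < k ∧ k < 1 ∧ k * B ≤ ω := by
    refine ⟨min (1 / 2) (ω / (B + 1)), by positivity,
      (min_le_left _ _).trans_lt (by norm_num), ?_⟩
    have h1 : min (1 / 2) (ω / (B + 1)) * B ≤ ω / (B + 1) * B :=
      mul_le_mul_of_nonneg_right (min_le_right _ _) hB0
    have h2 : ω / (B + 1) * B ≤ ω := by
      rw [div_mul_eq_mul_div, div_le_iff₀ (by linarith)]
      nlinarith
    exact h1.trans h2
  -- All curves stay in a ball of radius `r` around `x`.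
  obtain ⟨r, hr, hpotr⟩ := Metric.eventually_nhds_iff.1
    ((eventually_potential_near hK hne hc x hωpos).and
      (eventually_norm_sub_lt x (lt_min (half_pos hε) one_pos)))
  have hV' : Tendsto (fun s => v + k⁻¹ • ((s - a)⁻¹ • (u s - x) - v)) L (𝓝 v) := by
    have h1 := ((hv.sub_const v).const_smul k⁻¹).const_add v
    simpa using h1
  have htime : Tendsto (fun s => (s - a) * (2 * ‖v‖ + 1)) L (𝓝 0) := by
    have h1 : Continuous fun s : ℝ => (s - a) * (2 * ‖v‖ + 1) := by fun_prop
    simpa using (h1.tendsto a).mono_left (hL.trans nhdsWithin_le_nhds)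
  have hIoc : ∀ᶠ s in 𝓝[>] a, s ∈ Ioc a (min β (a + k₀)) :=
    Ioc_mem_nhdsGT (lt_min haβ (by linarith))
  obtain ⟨s, hs1, hs2, hs3, hs4, hs5, hs6, hs7⟩ := ((((hv.norm.pow 2).eventually
    (lt_mem_nhds (show ‖v‖ ^ 2 - ω < ‖v‖ ^ 2 by linarith)))).and
    (((hV'.norm.pow 2).eventually (gt_mem_nhds (show ‖v‖ ^ 2 < ‖v‖ ^ 2 + ω by linarith))).and
    ((hV'.norm.eventually (gt_mem_nhds (show ‖v‖ < ‖v‖ + 1 by linarith))).and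
    ((htime.eventually (gt_mem_nhds hr)).and
    ((hIoc.filter_mono hL).and
    (((hmin.isH1.eventually_forall_Icc ha haβ
      (eventually_norm_sub_lt x (half_pos hε))).filter_mono hL).and
    ((hmin.eventually_le_potential hK hne hc hmono ha haβ hlow hωpos).filter_mono hL))))))).exists
  clear htime hV'
  set v₁ := (s - a)⁻¹ • (u s - x) with hv₁
  set v' := v + k⁻¹ • (v₁ - v) with hv'
  set τ := s - a with hτ
  have hsa : 0 < τ := sub_pos.2 hs5.1
  have hsβ : s ≤ β := hs5.2.trans (min_le_left _ _)
  have hsk : τ ≤ k₀ := by linarith [hs5.2.trans (min_le_right _ _)]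
  have hus : u s - x = τ • v₁ := by rw [hadd s hs5.1]; abel
  set c := a + (1 - k) * τ with hcdef
  have hkτ : 0 < k * τ := by positivity
  have hkτ' : 0 < (1 - k) * τ := mul_pos (by linarith) hsa
  have hac : a ≤ c := by linarith
  have hcs' : s - c = k * τ := by rw [hcdef]; ring
  have hcs : c ≤ s := by linarith
  have hca : c - a = (1 - k) * τ := by rw [hcdef]; ring
  set y := x + (c - a) • v with hy
  have hsplit : τ * (2 * ‖v‖ + 1) = τ * ‖v‖ + τ * (‖v‖ + 1) := by ring
  have hτv : 0 ≤ τ * ‖v‖ := by positivity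
  have hball₁ : ∀ t ∈ Icc a c, ‖x + (t - a) • v - x‖ < r := fun t ht => by
    rw [add_sub_cancel_left, norm_smul, Real.norm_of_nonneg (by linarith [ht.1])]
    have : (t - a) * ‖v‖ ≤ τ * ‖v‖ :=
      mul_le_mul_of_nonneg_right (by linarith [ht.2]) (norm_nonneg _)
    have : 0 < τ * (‖v‖ + 1) := by positivity
    linarith
  have hball₂ : ∀ t ∈ Icc c s, ‖y + (t - c) • v' - x‖ < r := fun t ht => by
    have e : y + (t - c) • v' - x = (c - a) • v + (t - c) • v' := by rw [hy]; abel
    have h1 := norm_add_le ((c - a) • v) ((t - c) • v')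
    rw [norm_smul, norm_smul, Real.norm_of_nonneg (show 0 ≤ c - a by linarith),
      Real.norm_of_nonneg (show 0 ≤ t - c by linarith [ht.1])] at h1
    have h2 : (c - a) * ‖v‖ ≤ τ * ‖v‖ :=
      mul_le_mul_of_nonneg_right (by linarith) (norm_nonneg _)
    have h3 : (t - c) * ‖v'‖ ≤ τ * (‖v‖ + 1) :=
      mul_le_mul (by linarith [ht.2]) hs3.le (norm_nonneg _) hsa.le
    rw [e]
    linarith
  have hclose : ∀ z, ‖z - x‖ < r → ∀ t ∈ Icc a s, ‖z - u t‖ < ε := fun z hz t ht => by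
    have h1 := (hpotr (by rwa [dist_eq_norm])).2.trans_le (min_le_left _ _)
    have h2 := hs6 t ht
    have h3 := norm_sub_le_norm_sub_add_norm_sub z x (u t)
    rw [norm_sub_rev x (u t)] at h3
    linarith
  have hcost := hmin.cost_le_add hF ha hac hcs hsβ (IsH1.line x v a c a) (IsH1.line y v' c s c)
    (by rw [sub_self, zero_smul, add_zero]) (by simp [hx]) (by
      rw [hcs', hy, hca, hv', smul_add, smul_smul, mul_right_comm, mul_inv_cancel₀ hk0.ne', one_mul]
      have : x + (((1 - k) * τ) • v + ((k * τ) • v + τ • (v₁ - v))) = x + τ • v₁ := by module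
      rw [add_assoc, this, ← hus]
      abel)
    (fun t ht => hclose _ (hball₁ t ht) t ⟨ht.1, ht.2.trans hcs⟩)
    (fun t ht => hclose _ (hball₂ t ht) t ⟨hac.trans ht.1, ht.2⟩)
  have hzx : x ∈ hullZone K q := convexHull_mono hopt (etaMap_mem hK hne _)
  have hcost₁ := cost_line_le hF x v (c := a) (C := hq' + ω) hac (fun t ht => by
    have hz : x + (t - a) • v ∈ hullZone K q := by
      have h1 := (convex_hullZone hK hne q).add_smul_sub_mem hzx
        (mem_hullZone_etaMap hK hne (x + k₀ • v)) (t := (t - a) / k₀)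
        ⟨div_nonneg (by linarith [ht.1]) hk₀.le, (div_le_one hk₀).2 (by linarith [ht.2])⟩
      rwa [add_sub_cancel_left, smul_smul, div_mul_cancel₀ _ hk₀.ne'] at h1
    refine (etaPotential_le_of_mem_hullZone hK hne hmono hz).trans ?_
    have h1 := (hpotr (by rw [dist_eq_norm]; exact hball₁ t ht)).1 q (mem_range_self _)
    linarith [(abs_lt.1 h1).2])
  have hcost₂ := cost_line_le hF y v' (c := c) (C := B) hcs (fun t ht => hB _ (by
    have h1 := (hpotr (by rw [dist_eq_norm]; exact hball₂ t ht)).2.trans_le (min_le_right _ _)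
    have h2 := norm_add_le (y + (t - c) • v' - x) x
    rw [sub_add_cancel] at h2
    linarith))
  have hu : IsH1 u w a s := hmin.isH1.mono ⟨ha, haβ.le⟩ ⟨ha.trans hs5.1.le, hsβ⟩
  have hlow₁ := hu.mul_norm_sq_le hs5.1.le hus
  have hlow₂ := mul_le_integral_potential hF hs5.1.le hu hs7
  rw [cost] at hcost
  rw [hca] at hcost₁
  rw [hcs'] at hcost₂
  have hfinal : τ * (‖v₁‖ ^ 2 + (hp' - ω)) ≤
      τ * ((1 - k) * (‖v‖ ^ 2 + (hq' + ω)) + k * (‖v'‖ ^ 2 + B)) := by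
    linarith
  have hfinal' := le_of_mul_le_mul_left hfinal hsa
  have h1 : k * ‖v'‖ ^ 2 ≤ k * (‖v‖ ^ 2 + ω) := mul_le_mul_of_nonneg_left hs2.le hk0.le
  have h2 : 0 ≤ k * hq' := mul_nonneg hk0.le hq0
  have h3 : hp' - hq' = 8 * ω := by rw [hω]; ring
  linarith

/-- If `η (u s) = p` for a time `s` close to `a`, where no nearby value of `η` is closer to `u a`
than `p`, then `η` has been equal to `p` during the whole second half of `[a, s]`. -/
theorem IsLocMin.eventually_eq_on_second_half (hK : K.Finite) (hne : K.Nonempty)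
    (h0 : ∀ s ∈ Ici (0 : ℝ), 0 ≤ h s) (hc : ContinuousOn h (Ici 0))
    (hm : StrictMonoOn h (Ici 0))
    (hmin : IsLocMin (etaPotential K h) u w α β ε) (ha : α ≤ a) (haβ : a < β) {p : Euc d}
    (hlow : ∀ᶠ t in 𝓝[>] a, ‖u a - p‖ ≤ ‖u a - etaMap K (u t)‖) :
    ∀ᶠ s in 𝓝[>] a, etaMap K (u s) = p → ∀ t ∈ Icc ((a + s) / 2) s, etaMap K (u t) = p := by
  have hmono := hm.monotoneOn
  have hF := isPotential_etaPotential hK hne h0 hmono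
  have hε := hmin.eps_pos
  by_contra hcon
  rw [not_eventually] at hcon
  have hGne : (𝓝[>] a ⊓ 𝓟 {s | ¬(etaMap K (u s) = p → ∀ t ∈ Icc ((a + s) / 2) s,
    etaMap K (u t) = p)}).NeBot := frequently_iff_neBot.1 hcon
  set L := Ultrafilter.of (𝓝[>] a ⊓ 𝓟 {s | ¬(etaMap K (u s) = p → ∀ t ∈ Icc ((a + s) / 2) s,
    etaMap K (u t) = p)})
  have hLle := Ultrafilter.of_le (𝓝[>] a ⊓ 𝓟 {s | ¬(etaMap K (u s) = p →
    ∀ t ∈ Icc ((a + s) / 2) s, etaMap K (u t) = p)})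
  have hL : (L : Filter ℝ) ≤ 𝓝[>] a := hLle.trans inf_le_left
  have hLbad : ∀ᶠ s in (L : Filter ℝ), ¬(etaMap K (u s) = p → ∀ t ∈ Icc ((a + s) / 2) s,
    etaMap K (u t) = p) := hLle (mem_inf_of_right (mem_principal_self _))
  have hLp : ∀ᶠ s in (L : Filter ℝ), etaMap K (u s) = p := hLbad.mono fun s hs => by
    by_contra hcon
    exact hs fun hp => absurd hp hcon
  -- The mean velocities converge along the ultrafilter, because they are bounded.
  obtain ⟨v, hv⟩ : ∃ v, Tendsto (fun s => (s - a)⁻¹ • (u s - u a)) L (𝓝 v) := by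
    obtain ⟨M, hM⟩ := hmin.exists_norm_sub_le hF ha haβ
    have h1 : ∀ᶠ s in (L : Filter ℝ),
        (s - a)⁻¹ • (u s - u a) ∈ Metric.closedBall (0 : Euc d) M := by
      filter_upwards [hL hM, hL self_mem_nhdsWithin] with s hs hs'
      have hs'' : 0 < s - a := sub_pos.2 hs'
      rw [mem_closedBall_zero_iff, norm_smul, norm_inv, Real.norm_of_nonneg hs''.le,
        inv_mul_le_iff₀ hs'', mul_comm]
      exact hs
    obtain ⟨v, -, hv⟩ := (isCompact_closedBall (0 : Euc d) M).ultrafilter_le_nhds'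
      (L.map fun s => (s - a)⁻¹ • (u s - u a)) h1
    exact ⟨v, hv⟩
  obtain ⟨k₀, hopt, hk₀⟩ : ∃ k₀ : ℝ, optClass K (u a + k₀ • v) ⊆ optClass K (u a) ∧ 0 < k₀ := by
    have h1 : Tendsto (fun t : ℝ => u a + t • v) (𝓝[>] 0) (𝓝 (u a)) := by
      have : Continuous fun t : ℝ => u a + t • v := by fun_prop
      simpa using (this.tendsto 0).mono_left nhdsWithin_le_nhds
    exact ((h1.eventually (eventually_optClass_subset hK hne (u a))).and self_mem_nhdsWithin).exists
  have hray := hmin.etaMap_ray_eq hK hne h0 hc hm ha haβ hlow hL hLp hv hk₀ hopt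
  obtain ⟨ρ, hρ, hsub⟩ := exists_optClass_add_smul_subset hK hne hk₀ hopt
  obtain ⟨c, hcpos, hgap⟩ := exists_potential_gap hK hne hm (u a) p
  -- The variance on `[a, s]` is at most `2 * ω * (s - a)`. With `128 * ω ≤ ρ ^ 2` the deviation
  -- from the chord at a time `t ≥ a + (s - a) / 4` is at most `ρ / 2 * (t - a)`; with `16 * ω ≤ c`
  -- the potential gap `c` cannot persist for a quarter of the time.
  obtain ⟨ω, hω, hωc, hωρ⟩ : ∃ ω : ℝ, 0 < ω ∧ 16 * ω ≤ c ∧ 128 * ω ≤ ρ ^ 2 :=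
    ⟨min (c / 16) (ρ ^ 2 / 128), by positivity, by linarith [min_le_left (c / 16) (ρ ^ 2 / 128)],
      by linarith [min_le_right (c / 16) (ρ ^ 2 / 128)]⟩
  obtain ⟨r, hr, hpotr⟩ := Metric.eventually_nhds_iff.1
    ((eventually_potential_near hK hne hc (u a) hω).and
      ((eventually_optClass_subset hK hne (u a)).and
        (eventually_norm_sub_lt (u a) (half_pos hε))))
  have hρ2 : 0 < ρ / 2 := half_pos hρ
  have hr2 : 0 < min r (ε / 2) := lt_min hr (half_pos hε)
  have hIoc : ∀ᶠ s in 𝓝[>] a, s ∈ Ioc a (min β (a + k₀)) :=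
    Ioc_mem_nhdsGT (lt_min haβ (by linarith))
  obtain ⟨s, hs1, hs2, hs3, hs4, hs5, hs6, hs7⟩ := (hLp.and (hLbad.and
    ((hv.eventually (eventually_norm_sub_lt v hρ2)).and
    (((hmin.eventually_excess_le hK hne h0 hc hmono ha haβ (p := p) hω).filter_mono hL).and
    ((hIoc.filter_mono hL).and
    (((hmin.isH1.eventually_forall_Icc ha haβ (eventually_norm_sub_lt (u a) hr2)).filter_mono
      hL).and
    ((hmin.eventually_le_potential hK hne hc hmono ha haβ hlow hω).filter_mono hL))))))).exists
  set v₁ := (s - a)⁻¹ • (u s - u a) with hv₁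
  set τ := s - a with hτ
  have hsa : 0 < τ := sub_pos.2 hs5.1
  have hsβ : s ≤ β := hs5.2.trans (min_le_left _ _)
  have hsk : τ ≤ k₀ := by linarith [hs5.2.trans (min_le_right _ _)]
  have hus : u s - u a = τ • v₁ := by
    rw [hv₁, smul_smul, mul_inv_cancel₀ hsa.ne', one_smul]
  have hu : IsH1 u w a s := hmin.isH1.mono ⟨ha, haβ.le⟩ ⟨ha.trans hs5.1.le, hsβ⟩
  have hexc := hs4 hs1 v₁ hus
  set hp' := h (‖u a - p‖ ^ 2) with hhp
  have hpot := mul_le_integral_potential hF hs5.1.le hu hs7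
  have hvar : 0 ≤ ∫ t in a..s, ‖w t - v₁‖ ^ 2 :=
    intervalIntegral.integral_nonneg hs5.1.le fun _ _ => sq_nonneg _
  -- At times not too close to `a` the curve is near the ray in the direction `v`.
  have hdich : ∀ t ∈ Icc (a + τ / 4) s,
      etaMap K (u t) = p ∨ ‖u a - p‖ < ‖u a - etaMap K (u t)‖ := by
    intro t ht
    have hta : τ / 4 ≤ t - a := by linarith [ht.1]
    have hta0 : 0 < t - a := by linarith
    have hdev := hu.norm_deviation_sq_le hs5.1.le hus (t := t) ⟨by linarith, ht.2⟩
    have hdev' : ‖u t - (u a + (t - a) • v₁)‖ ^ 2 ≤ (ρ / 2 * (t - a)) ^ 2 := by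
      have h1 : ∫ t in a..s, ‖w t - v₁‖ ^ 2 ≤ 2 * ω * τ := by linarith
      have h2 : τ * ∫ t in a..s, ‖w t - v₁‖ ^ 2 ≤ τ * (2 * ω * τ) :=
        mul_le_mul_of_nonneg_left h1 hsa.le
      have h3 : 128 * ω * τ ^ 2 ≤ ρ ^ 2 * τ ^ 2 := mul_le_mul_of_nonneg_right hωρ (sq_nonneg _)
      have h4 : (τ / 4) ^ 2 ≤ (t - a) ^ 2 := pow_le_pow_left₀ (by positivity) hta 2
      have h5 := mul_le_mul_of_nonneg_left h4 (sq_nonneg ρ)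
      have h6 : τ * (2 * ω * τ) = 2 * ω * τ ^ 2 := by ring
      have h7 : (ρ / 2 * (t - a)) ^ 2 = ρ ^ 2 * (t - a) ^ 2 / 4 := by ring
      have h8 : ρ ^ 2 * (τ / 4) ^ 2 = ρ ^ 2 * τ ^ 2 / 16 := by ring
      linarith
    have hdev'' := le_of_sq_le_sq hdev' (by positivity)
    have hy : ‖(t - a)⁻¹ • (u t - u a) - v‖ < ρ := by
      have e : (t - a)⁻¹ • (u t - u a) - v =
          (t - a)⁻¹ • (u t - (u a + (t - a) • v₁)) + (v₁ - v) := by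
        rw [← sub_sub, smul_sub _ _ ((t - a) • v₁), smul_smul, inv_mul_cancel₀ hta0.ne', one_smul]
        abel
      have h1 : ‖(t - a)⁻¹ • (u t - (u a + (t - a) • v₁))‖ ≤ ρ / 2 := by
        rw [norm_smul, norm_inv, Real.norm_of_nonneg hta0.le, inv_mul_le_iff₀ hta0, mul_comm]
        exact hdev''
      rw [e]
      linarith [norm_add_le ((t - a)⁻¹ • (u t - (u a + (t - a) • v₁))) (v₁ - v)]
    have hsubt := hsub _ (t - a) hta0 (by linarith [ht.2]) hy
    have e : u a + (t - a) • ((t - a)⁻¹ • (u t - u a)) = u t := by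
      rw [smul_smul, mul_inv_cancel₀ hta0.ne', one_smul]
      abel
    rw [e] at hsubt
    by_contra hcon
    push Not at hcon
    refine hcon.1 ?_
    rw [← hray] at hcon ⊢
    exact eq_etaMap_of_norm_sub_le hK hne hopt (convexHull_mono hsubt (etaMap_mem hK hne _)) hcon.2
  have hnear : ∀ t ∈ Icc a s, ‖u t - u a‖ < r := fun t ht => (hs6 t ht).trans_le (min_le_left _ _)
  -- At some time of the second quarter of `[a, s]` the value of `η` is `p`, since otherwise the
  -- potential would be too large there.
  obtain ⟨t₁, ht₁, hpt₁⟩ : ∃ t₁ ∈ Icc (a + τ / 4) (a + τ / 2), etaMap K (u t₁) = p := by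
    by_contra hcon
    push Not at hcon
    have hbig : ∀ t ∈ Ioc (a + τ / 4) (a + τ / 2), hp' - ω + c ≤ etaPotential K h (u t) := by
      intro t ht
      have ht' : t ∈ Icc a s := ⟨by linarith [ht.1], by linarith [ht.2]⟩
      have h1 := hgap _ (mem_range_self (u t))
        ((hdich t ⟨ht.1.le, ht'.2⟩).resolve_left (hcon t (Ioc_subset_Icc_self ht)))
      have h2 := (hpotr (by rw [dist_eq_norm]; exact hnear t ht')).1 _ (mem_range_self (u t))
      rw [etaPotential]
      linarith [(abs_lt.1 h2).1]
    have m1 : a + τ / 4 ∈ Icc a s := ⟨by linarith, by linarith⟩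
    have m2 : a + τ / 2 ∈ Icc a s := ⟨by linarith, by linarith⟩
    have ma : a ∈ Icc a s := ⟨le_rfl, hs5.1.le⟩
    have ms : s ∈ Icc a s := ⟨hs5.1.le, le_rfl⟩
    have i1 := mul_le_integral_potential hF m1.1 (hu.mono ma m1) fun t ht =>
      hs7 t ⟨ht.1, ht.2.trans m1.2⟩
    have i2 := mul_le_integral_potential hF (by linarith) (hu.mono m1 m2) hbig
    have i3 := mul_le_integral_potential hF m2.2 (hu.mono m2 ms) fun t ht =>
      hs7 t ⟨m2.1.trans_lt ht.1, ht.2⟩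
    have hii1 := hF.intervalIntegrable m1.1 (hu.mono ma m1).continuousOn
    have hii2 := hF.intervalIntegrable (by linarith) (hu.mono m1 m2).continuousOn
    have hii3 := hF.intervalIntegrable m2.2 (hu.mono m2 ms).continuousOn
    rw [← intervalIntegral.integral_add_adjacent_intervals (hii1.trans hii2) hii3,
      ← intervalIntegral.integral_add_adjacent_intervals hii1 hii2] at hexc
    have hs : s = a + τ := by rw [hτ]; ring
    have e1 : (a + τ / 4 - a) * (hp' - ω) = τ * (hp' - ω) / 4 := by ring
    have e2 : (a + τ / 2 - (a + τ / 4)) * (hp' - ω + c) = τ * (hp' - ω) / 4 + τ * c / 4 := by ring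
    have e3 : (s - (a + τ / 2)) * (hp' - ω) = τ * (hp' - ω) / 2 := by rw [hs]; ring
    have e4 : τ * (hp' + ω) = τ * (hp' - ω) + 2 * (τ * ω) := by ring
    have e5 : τ * (16 * ω) ≤ τ * c := mul_le_mul_of_nonneg_left hωc hsa.le
    have e6 : 0 < τ * ω := by positivity
    linarith
  have hr3 : 2 * min r (ε / 2) ≤ ε := by linarith [min_le_right r (ε / 2)]
  refine hs2 fun _ t ht => hmin.etaMap_eq_of_endpoints hK hne h0 hmono hr3
    (fun z hz => (hpotr (by rw [dist_eq_norm]; exact hz.trans_le (min_le_left _ _))).2.1)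
    (fun z z' hz hz' q hq hlt => ?_) (b := t₁) (c := s) (by linarith [ht₁.1])
    (by linarith [ht₁.2]) hsβ (fun t ht => hs6 t ⟨by linarith [ht.1, ht₁.1], ht.2⟩) hpt₁ hs1
    (fun t ht => hdich t ⟨ht₁.1.trans ht.1, ht.2⟩) t ⟨by linarith [ht.1, ht₁.2], ht.2⟩
  have h1 := (hpotr (by rw [dist_eq_norm]; exact hz.trans_le (min_le_left _ _))).1 p ⟨u s, hs1⟩
  have h2 := (hpotr (by rw [dist_eq_norm]; exact hz'.trans_le (min_le_left _ _))).1 q hq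
  linarith [hgap q hq hlt, (abs_lt.1 h1).2, (abs_lt.1 h2).1]

/-- Along a minimizer, `η` is constant immediately to the right of each time. -/
theorem IsLocMin.exists_eventually_etaMap_eq (hK : K.Finite) (hne : K.Nonempty)
    (h0 : ∀ s ∈ Ici (0 : ℝ), 0 ≤ h s) (hc : ContinuousOn h (Ici 0))
    (hm : StrictMonoOn h (Ici 0))
    (hmin : IsLocMin (etaPotential K h) u w α β ε) (ha : α ≤ a) (haβ : a < β) :
    ∃ p, ∀ᶠ t in 𝓝[>] a, etaMap K (u t) = p := by
  -- `Z` is the set of values taken at times arbitrarily close to `a`.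
  set Z := {p ∈ range (etaMap K) | ∃ᶠ t in 𝓝[>] a, etaMap K (u t) = p} with hZ
  have hZfin : Z.Finite := (finite_range_etaMap hK hne).subset (sep_subset _ _)
  have hev : ∀ᶠ t in 𝓝[>] a, etaMap K (u t) ∈ Z := by
    have h1 : ∀ᶠ t in 𝓝[>] a, ∀ p ∈ range (etaMap K), p ∉ Z → etaMap K (u t) ≠ p := by
      refine (eventually_all_finite (finite_range_etaMap hK hne)).2 fun p hp => ?_
      by_cases hpZ : p ∈ Z
      · exact Eventually.of_forall fun t hcon => absurd hpZ hcon
      · have h2 : ¬∃ᶠ t in 𝓝[>] a, etaMap K (u t) = p := fun hf => hpZ ⟨hp, hf⟩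
        exact (not_frequently.1 h2).mono fun t ht _ => ht
    filter_upwards [h1] with t ht
    by_contra hcon
    exact ht _ (mem_range_self _) hcon rfl
  obtain ⟨t₀, ht₀⟩ := hev.exists
  obtain ⟨p, hpZ, hpmin⟩ := hZfin.exists_minimalFor (fun q => ‖u a - q‖) _ ⟨_, ht₀⟩
  have hlow : ∀ᶠ t in 𝓝[>] a, ‖u a - p‖ ≤ ‖u a - etaMap K (u t)‖ := by
    filter_upwards [hev] with t ht
    rcases le_total ‖u a - p‖ ‖u a - etaMap K (u t)‖ with hle | hle
    · exact hle
    · exact hpmin ht hle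
  obtain ⟨s, hsp, hs, hsa⟩ := (hpZ.2.and_eventually ((eventually_forall_Ioc
    (hmin.eventually_eq_on_second_half hK hne h0 hc hm ha haβ hlow)).and
    self_mem_nhdsWithin)).exists
  have hsa' : 0 < s - a := sub_pos.2 hsa
  -- Iterating on dyadic intervals.
  have hdyadic : ∀ n : ℕ, ∀ t ∈ Icc (a + (s - a) / 2 ^ n) s, etaMap K (u t) = p := by
    intro n
    induction n with
    | zero =>
      intro t ht
      have : t = s := le_antisymm ht.2 (by simpa using ht.1)
      rw [this, hsp]
    | succ n ih =>
      intro t ht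
      have hpos : 0 < (s - a) / 2 ^ n := by positivity
      have hle : (s - a) / 2 ^ n ≤ s - a := div_le_self hsa'.le (one_le_pow₀ one_le_two)
      rcases le_total (a + (s - a) / 2 ^ n) t with hle' | hle'
      · exact ih t ⟨hle', ht.2⟩
      · refine hs (a + (s - a) / 2 ^ n) ⟨by linarith, by linarith⟩ (ih _ ⟨le_rfl, by linarith⟩) t
          ⟨?_, hle'⟩
        have h1 := ht.1
        rw [pow_succ, ← div_div] at h1
        linarith
  refine ⟨p, ?_⟩
  filter_upwards [Ioc_mem_nhdsGT (show a < s from hsa)] with t ht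
  obtain ⟨n, hn⟩ := exists_pow_lt_of_lt_one (div_pos (sub_pos.2 ht.1) hsa')
    (show (1 / 2 : ℝ) < 1 by norm_num)
  refine hdyadic n t ⟨?_, ht.2⟩
  rw [lt_div_iff₀ hsa', one_div, inv_pow, inv_mul_eq_div] at hn
  linarith

end BlowUp

/-! ### Regularity from a bound on the deviation from chords -/

section Regularity

variable {d : ℕ}

theorem norm_slope_sub_slope_le {u : ℝ → Euc d} {a b M : ℝ}
    (hu : ∀ c e, a ≤ c → c < e → e ≤ b → ∀ r ∈ Icc c e,
      ‖u r - (u c + (r - c) • slope u c e)‖ ≤ M * (e - c) ^ 2)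
    {c e c' e' : ℝ} (hac : a ≤ c) (hcc' : c ≤ c') (hlt : c' < e') (hee' : e' ≤ e) (heb : e ≤ b) :
    (e' - c') * ‖slope u c' e' - slope u c e‖ ≤ 2 * M * (e - c) ^ 2 := by
  have hpos : 0 < e' - c' := sub_pos.2 hlt
  have h1 := hu c e hac (by linarith) heb c' ⟨hcc', by linarith⟩
  have h2 := hu c e hac (by linarith) heb e' ⟨by linarith, hee'⟩
  have h3 : (e' - c') • (slope u c' e' - slope u c e) =
      (u e' - (u c + (e' - c) • slope u c e)) - (u c' - (u c + (c' - c) • slope u c e)) := by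
    have h4 : (e' - c') • slope u c' e' = u e' - u c' := by
      rw [slope_def_module, smul_smul, mul_inv_cancel₀ hpos.ne', one_smul]
    rw [smul_sub, h4]
    module
  have h5 := congrArg norm h3
  rw [norm_smul, Real.norm_of_nonneg hpos.le] at h5
  rw [h5]
  linarith [norm_sub_le (u e' - (u c + (e' - c) • slope u c e))
    (u c' - (u c + (c' - c) • slope u c e))]

/-- The slopes on nested intervals differ at most by a multiple of the length of the larger one;
the proof halves the larger interval until it is comparable with the smaller one. -/
theorem norm_slope_sub_slope_le_of_nested {u : ℝ → Euc d} {a b M : ℝ}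
    (hu : ∀ c e, a ≤ c → c < e → e ≤ b → ∀ r ∈ Icc c e,
      ‖u r - (u c + (r - c) • slope u c e)‖ ≤ M * (e - c) ^ 2)
    {c e c' e' : ℝ} (hac : a ≤ c) (hcc' : c ≤ c') (hlt : c' < e') (hee' : e' ≤ e) (heb : e ≤ b) :
    ‖slope u c' e' - slope u c e‖ ≤ 8 * M * (e - c) := by
  have near : ∀ c e c' e' : ℝ, a ≤ c → c ≤ c' → c' < e' → e' ≤ e → e ≤ b →
      (e - c) / 2 ≤ e' - c' → ‖slope u c' e' - slope u c e‖ ≤ 4 * M * (e - c) := by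
    intro c e c' e' hac hcc' hlt hee' heb hhalf
    have h1 := norm_slope_sub_slope_le hu hac hcc' hlt hee' heb
    have hpos : 0 < e - c := by linarith
    have h2 := mul_le_mul_of_nonneg_right hhalf (norm_nonneg (slope u c' e' - slope u c e))
    have h3 : (e - c) * ‖slope u c' e' - slope u c e‖ ≤ (e - c) * (4 * M * (e - c)) := by
      nlinarith
    exact le_of_mul_le_mul_left h3 hpos
  have hM : 0 ≤ M := by
    have h1 := (norm_nonneg _).trans (hu c e hac (by linarith) heb c ⟨le_rfl, by linarith⟩)
    exact nonneg_of_mul_nonneg_left h1 (pow_pos (by linarith) 2)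
  have main : ∀ n : ℕ, ∀ c e c' e' : ℝ, a ≤ c → c ≤ c' → c' < e' → e' ≤ e → e ≤ b →
      (e - c) / 2 ^ n ≤ e' - c' → ‖slope u c' e' - slope u c e‖ ≤ 8 * M * (e - c) := by
    intro n
    induction n with
    | zero =>
      intro c e c' e' hac hcc' hlt hee' heb hn
      rw [pow_zero, div_one] at hn
      have h1 : c' = c := by linarith
      have h2 : e' = e := by linarith
      rw [h1, h2, sub_self, norm_zero]
      have : 0 ≤ e - c := by linarith
      positivity
    | succ n ih =>
      intro c e c' e' hac hcc' hlt hee' heb hn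
      have hpos : 0 < e - c := by linarith
      rcases le_total ((e - c) / 2) (e' - c') with hhalf | hhalf
      · have h1 := near c e c' e' hac hcc' hlt hee' heb hhalf
        have : 0 ≤ M * (e - c) := by positivity
        linarith
      · -- an interval of half the length between the two
        obtain ⟨c'', h1, h2, h3, h4⟩ : ∃ c'' : ℝ, c ≤ c'' ∧ c'' ≤ c' ∧ e' ≤ c'' + (e - c) / 2 ∧
            c'' + (e - c) / 2 ≤ e := by
          refine ⟨max c (e' - (e - c) / 2), le_max_left _ _, max_le hcc' (by linarith), ?_, ?_⟩
          · linarith [le_max_right c (e' - (e - c) / 2)]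
          · rcases max_cases c (e' - (e - c) / 2) with ⟨h, _⟩ | ⟨h, _⟩ <;> linarith
        have i1 := ih c'' (c'' + (e - c) / 2) c' e' (by linarith) h2 hlt h3 (by linarith) (by
          rw [pow_succ] at hn
          rw [add_sub_cancel_left, div_div, mul_comm]
          exact hn)
        have i2 := near c e c'' (c'' + (e - c) / 2) hac h1 (by linarith) h4 heb (by linarith)
        have h5 := norm_sub_le_norm_sub_add_norm_sub (slope u c' e')
          (slope u c'' (c'' + (e - c) / 2)) (slope u c e)
        rw [add_sub_cancel_left] at i1
        linarith
  obtain ⟨n, hn⟩ := exists_pow_lt_of_lt_one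
    (div_pos (sub_pos.2 hlt) (show 0 < e - c by linarith)) (show (1 / 2 : ℝ) < 1 by norm_num)
  refine main n c e c' e' hac hcc' hlt hee' heb ?_
  rw [lt_div_iff₀ (show 0 < e - c by linarith), one_div, inv_pow, inv_mul_eq_div] at hn
  exact hn.le

/-- A curve whose distance to its chords is at most quadratic in their length is of class
`C^{1,1}`. -/
theorem isC11On_of_chord_bound {u : ℝ → Euc d} {a b M : ℝ} (hab : a < b)
    (hu : ∀ c e, a ≤ c → c < e → e ≤ b → ∀ r ∈ Icc c e,
      ‖u r - (u c + (r - c) • slope u c e)‖ ≤ M * (e - c) ^ 2) : IsC11On u a b := by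
  have hM : 0 ≤ M := by
    have h1 := (norm_nonneg _).trans (hu a b le_rfl hab le_rfl a ⟨le_rfl, hab.le⟩)
    exact nonneg_of_mul_nonneg_left h1 (pow_pos (sub_pos.2 hab) 2)
  have hnest : ∀ c e r t : ℝ, a ≤ c → e ≤ b → r ∈ Icc c e → t ∈ Icc c e → t ≠ r →
      ‖slope u r t - slope u c e‖ ≤ 8 * M * (e - c) := by
    intro c e r t hac heb hr ht hne
    rcases lt_or_gt_of_ne hne with h | h
    · rw [slope_comm]
      exact norm_slope_sub_slope_le_of_nested hu hac ht.1 h hr.2 heb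
    · exact norm_slope_sub_slope_le_of_nested hu hac hr.1 h ht.2 heb
  have hneBot : ∀ r ∈ Icc a b, (𝓝[Icc a b \ {r}] r).NeBot := fun r hr =>
    accPt_principal_iff_nhdsWithin.1 (uniqueDiffOn_Icc hab r hr).accPt
  have hlim : ∀ r ∈ Icc a b, ∃ v, Tendsto (slope u r) (𝓝[Icc a b \ {r}] r) (𝓝 v) := by
    intro r hr
    have := hneBot r hr
    refine cauchy_map_iff_exists_tendsto.1 (Metric.cauchy_iff.2 ⟨inferInstance, fun ε hε => ?_⟩)
    obtain ⟨ρ, hρ, hρε⟩ : ∃ ρ : ℝ, 0 < ρ ∧ 32 * M * ρ < ε := by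
      refine ⟨ε / (32 * M + 1), by positivity, ?_⟩
      rw [mul_div_assoc', div_lt_iff₀ (by positivity)]
      nlinarith
    refine ⟨slope u r '' (Icc (r - ρ) (r + ρ) ∩ (Icc a b \ {r})), image_mem_map
      (inter_mem (nhdsWithin_le_nhds (Icc_mem_nhds (by linarith) (by linarith)))
        self_mem_nhdsWithin), ?_⟩
    have hbd : ∀ t ∈ Icc (r - ρ) (r + ρ) ∩ (Icc a b \ {r}),
        ‖slope u r t - slope u (max a (r - ρ)) (min b (r + ρ))‖ ≤ 16 * M * ρ := by
      intro t ht
      refine (hnest _ _ r t (le_max_left _ _) (min_le_left _ _)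
        ⟨max_le hr.1 (by linarith), le_min hr.2 (by linarith)⟩
        ⟨max_le ht.2.1.1 ht.1.1, le_min ht.2.1.2 ht.1.2⟩ ht.2.2).trans ?_
      have h1 := le_max_right a (r - ρ)
      have h2 := min_le_right b (r + ρ)
      have h3 : 8 * M * (min b (r + ρ) - max a (r - ρ)) ≤ 8 * M * (2 * ρ) :=
        mul_le_mul_of_nonneg_left (by linarith) (by positivity)
      linarith
    rintro _ ⟨t, ht, rfl⟩ _ ⟨t', ht', rfl⟩
    have h1 := dist_triangle_right (slope u r t) (slope u r t')
      (slope u (max a (r - ρ)) (min b (r + ρ)))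
    simp only [dist_eq_norm] at h1 ⊢
    linarith [hbd t ht, hbd t' ht']
  choose! v hv using hlim
  have hvs : ∀ c e r : ℝ, a ≤ c → c < e → e ≤ b → r ∈ Icc c e →
      ‖v r - slope u c e‖ ≤ 8 * M * (e - c) := by
    intro c e r hac hce heb hr
    have hr' : r ∈ Icc a b := ⟨hac.trans hr.1, hr.2.trans heb⟩
    -- The limit is computed along the points of the smaller interval.
    have hne' : (𝓝[Icc c e \ {r}] r).NeBot :=
      accPt_principal_iff_nhdsWithin.1 (uniqueDiffOn_Icc hce r hr).accPt
    have h1 : Tendsto (slope u r) (𝓝[Icc c e \ {r}] r) (𝓝 (v r)) :=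
      (hv r hr').mono_left (nhdsWithin_mono _ (sdiff_subset_sdiff_left (Icc_subset_Icc hac heb)))
    refine le_of_tendsto (h1.sub_const _).norm ?_
    filter_upwards [self_mem_nhdsWithin] with t ht
    exact hnest c e r t hac heb hr ht.1 ht.2
  refine ⟨v, fun r hr => hasDerivWithinAt_iff_tendsto_slope.2 (hv r hr),
    (16 * M).toNNReal, LipschitzOnWith.of_dist_le_mul fun r hr t ht => ?_⟩
  have key : ∀ r t : ℝ, r ∈ Icc a b → t ∈ Icc a b → r < t →
      dist (v r) (v t) ≤ 16 * M * (t - r) := by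
    intro r t hr ht hrt
    have h1 := hvs r t r hr.1 hrt ht.2 ⟨le_rfl, hrt.le⟩
    have h2 := hvs r t t hr.1 hrt ht.2 ⟨hrt.le, le_rfl⟩
    have h3 := dist_triangle_right (v r) (v t) (slope u r t)
    simp only [dist_eq_norm] at h3 ⊢
    linarith
  rw [Real.coe_toNNReal _ (by positivity)]
  rcases lt_trichotomy r t with h | rfl | h
  · rw [dist_comm r t, Real.dist_eq, abs_of_pos (sub_pos.2 h)]
    exact key r t hr ht h
  · simp
  · rw [dist_comm, Real.dist_eq, abs_of_pos (sub_pos.2 h)]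
    exact key t r ht hr h

theorem integral_mul_sub_sq_add (r₀ s A B : ℝ) :
    ∫ r in (r₀ - s)..(r₀ + s), (A * (r - r₀) ^ 2 + B) = 2 / 3 * A * s ^ 3 + 2 * B * s := by
  rw [intervalIntegral.integral_comp_sub_right (fun x => A * x ^ 2 + B) r₀,
    intervalIntegral.integral_add (Continuous.intervalIntegrable (by fun_prop) _ _)
      intervalIntegrable_const,
    intervalIntegral.integral_const_mul, integral_pow, intervalIntegral.integral_const, smul_eq_mul]
  push_cast
  ring

/-- Second order consequence, at a point `r₀` where the velocity `v` has derivative `A`, of the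
integral inequality satisfied by the chords of `u`. -/
theorem norm_sq_le_inner_of_chord_inequality {u v g : ℝ → Euc d} {a b r₀ : ℝ} {A : Euc d}
    (hr₀ : r₀ ∈ Ioo a b) (hu : ∀ r ∈ Ioo a b, HasDerivAt u (v r) r)
    (hv : ContinuousOn v (Ioo a b)) (hg : ContinuousOn g (Ioo a b)) (hA : HasDerivAt v A r₀)
    (hineq : ∀ c e, a < c → c < e → e < b → ∫ t in c..e, ‖v t - slope u c e‖ ^ 2 ≤
      ∫ t in c..e, inner ℝ (g t) (u c + (t - c) • slope u c e - u t)) :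
    ‖A‖ ^ 2 ≤ inner ℝ (g r₀) A := by
  -- The inequality for the chord on a symmetric interval `[r₀ - s, r₀ + s]`, with `s` small
  -- depending on `e`, divided by `s ^ 3`.
  have key : ∀ e : ℝ, 0 < e → 2 / 3 * (‖A‖ ^ 2 - inner ℝ (g r₀) A) ≤
      e * (9 * ‖A‖ + 8 * (‖g r₀‖ + e)) := by
    intro e he
    have hv' : ∀ᶠ r in 𝓝 r₀, ‖v r - v r₀ - (r - r₀) • A‖ ≤ e * ‖r - r₀‖ :=
      (hasDerivAt_iff_isLittleO.1 hA).def he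
    have hg' : ∀ᶠ r in 𝓝 r₀, ‖g r - g r₀‖ < e := by
      have := (hg.continuousAt (Ioo_mem_nhds hr₀.1 hr₀.2)).eventually
        (eventually_norm_sub_lt (g r₀) he)
      exact this
    obtain ⟨s', hs', hball⟩ := Metric.eventually_nhds_iff.1
      ((hv'.and hg').and (Ioo_mem_nhds hr₀.1 hr₀.2))
    obtain ⟨s, hs, hss'⟩ := exists_between hs'
    have hnear : ∀ r ∈ Icc (r₀ - s) (r₀ + s), ‖v r - v r₀ - (r - r₀) • A‖ ≤ e * s ∧
        ‖g r - g r₀‖ < e ∧ r ∈ Ioo a b := by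
      intro r hr
      have h1 : |r - r₀| ≤ s := abs_le.2 ⟨by linarith [hr.1], by linarith [hr.2]⟩
      obtain ⟨⟨h2, h3⟩, h4⟩ := hball (show dist r r₀ < s' by
        rw [Real.dist_eq]; exact h1.trans_lt hss')
      exact ⟨h2.trans (mul_le_mul_of_nonneg_left h1 he.le), h3, h4⟩
    have mr : r₀ ∈ Icc (r₀ - s) (r₀ + s) := ⟨by linarith, by linarith⟩
    have ml : r₀ - s ∈ Icc (r₀ - s) (r₀ + s) := ⟨le_rfl, by linarith⟩
    have mR : r₀ + s ∈ Icc (r₀ - s) (r₀ + s) := ⟨by linarith, le_rfl⟩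
    -- `R` is the remainder in the second order Taylor expansion of `u` at `r₀`.
    set R : ℝ → Euc d := fun r => u r - u r₀ - (r - r₀) • v r₀ - ((r - r₀) ^ 2 / 2) • A with hR
    have hRder : ∀ r ∈ Icc (r₀ - s) (r₀ + s),
        HasDerivWithinAt R (v r - v r₀ - (r - r₀) • A) (Icc (r₀ - s) (r₀ + s)) r := by
      intro r hr
      have h1 := hu r (hnear r hr).2.2
      have h2 : HasDerivAt (fun r : ℝ => (r - r₀) • v r₀) ((1 : ℝ) • v r₀) r :=
        ((hasDerivAt_id r).sub_const r₀).smul_const _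
      have h3 : HasDerivAt (fun r : ℝ => ((r - r₀) ^ 2 / 2) • A) ((r - r₀) • A) r := by
        have h4 := (((hasDerivAt_id r).sub_const r₀).pow 2).div_const 2
        refine (h4.congr_deriv ?_).smul_const A
        simp
      rw [one_smul] at h2
      exact (((h1.sub_const (u r₀)).sub h2).sub h3).hasDerivWithinAt
    have hR₀ : R r₀ = 0 := by simp [hR]
    have hRle : ∀ r ∈ Icc (r₀ - s) (r₀ + s), ‖R r‖ ≤ e * s ^ 2 := by
      intro r hr
      have h1 := (convex_Icc (r₀ - s) (r₀ + s)).norm_image_sub_le_of_norm_hasDerivWithin_le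
        hRder (fun r hr => (hnear r hr).1) mr hr
      rw [hR₀, sub_zero] at h1
      refine h1.trans ?_
      have h2 : ‖r - r₀‖ ≤ s := abs_le.2 ⟨by linarith [hr.1], by linarith [hr.2]⟩
      have := mul_le_mul_of_nonneg_left h2 (mul_nonneg he.le hs.le)
      linarith
    have hue : ∀ r, u r = u r₀ + (r - r₀) • v r₀ + ((r - r₀) ^ 2 / 2) • A + R r := fun r => by
      simp only [hR]
      abel
    set S := slope u (r₀ - s) (r₀ + s) with hS
    have hSv : ‖S - v r₀‖ ≤ e * s := by
      have h1 : S - v r₀ = (2 * s)⁻¹ • (R (r₀ + s) - R (r₀ - s)) := by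
        have h2 : (2 * s) • (S - v r₀) = R (r₀ + s) - R (r₀ - s) := by
          rw [hS, slope_def_module, show r₀ + s - (r₀ - s) = 2 * s by ring, smul_sub, smul_smul,
            mul_inv_cancel₀ (by positivity), one_smul, hue (r₀ + s), hue (r₀ - s)]
          module
        rw [← h2, smul_smul, inv_mul_cancel₀ (by positivity), one_smul]
      rw [h1, norm_smul, norm_inv, Real.norm_of_nonneg (by positivity),
        inv_mul_le_iff₀ (by positivity)]
      linarith [norm_sub_le (R (r₀ + s)) (R (r₀ - s)), hRle _ ml, hRle _ mR]
    have hlow : ∀ r ∈ Icc (r₀ - s) (r₀ + s),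
        ‖A‖ ^ 2 * (r - r₀) ^ 2 + -(4 * e * s ^ 2 * ‖A‖) ≤ ‖v r - S‖ ^ 2 := by
      intro r hr
      have h1 : v r - S = (v r - v r₀ - (r - r₀) • A) - (S - v r₀) + (r - r₀) • A := by abel
      have h2 : |r - r₀| ≤ s := abs_le.2 ⟨by linarith [hr.1], by linarith [hr.2]⟩
      set X := (v r - v r₀ - (r - r₀) • A) - (S - v r₀) with hX
      have h3 : ‖X‖ ≤ 2 * e * s := by
        have := norm_sub_le (v r - v r₀ - (r - r₀) • A) (S - v r₀)
        linarith [(hnear r hr).1]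
      have h4 : |inner ℝ X ((r - r₀) • A)| ≤ 2 * e * s * (s * ‖A‖) := by
        refine (abs_real_inner_le_norm _ _).trans ?_
        rw [norm_smul, Real.norm_eq_abs]
        exact mul_le_mul h3 (mul_le_mul_of_nonneg_right h2 (norm_nonneg _)) (by positivity)
          (by positivity)
      rw [h1, norm_add_sq_real, norm_smul, mul_pow, Real.norm_eq_abs, sq_abs]
      have h5 := (abs_le.1 h4).1
      nlinarith [sq_nonneg ‖X‖]
    have hup : ∀ r ∈ Icc (r₀ - s) (r₀ + s),
        inner ℝ (g r) (u (r₀ - s) + (r - (r₀ - s)) • S - u r) ≤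
          -(inner ℝ (g r₀) A / 2) * (r - r₀) ^ 2 +
            (s ^ 2 * inner ℝ (g r₀) A / 2 + e * s ^ 2 * (‖A‖ / 2 + 4 * (‖g r₀‖ + e))) := by
      intro r hr
      have h2 : |r - r₀| ≤ s := abs_le.2 ⟨by linarith [hr.1], by linarith [hr.2]⟩
      have h3 : (r - r₀) ^ 2 ≤ s ^ 2 := sq_le_sq' (by linarith [hr.1]) (by linarith [hr.2])
      set Y := R (r₀ - s) - R r + (r - r₀ + s) • (S - v r₀) with hY
      have hYle : ‖Y‖ ≤ 4 * e * s ^ 2 := by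
        have h4 := norm_add_le (R (r₀ - s) - R r) ((r - r₀ + s) • (S - v r₀))
        have h5 := norm_sub_le (R (r₀ - s)) (R r)
        have h6 : ‖(r - r₀ + s) • (S - v r₀)‖ ≤ (2 * s) * (e * s) := by
          rw [norm_smul, Real.norm_of_nonneg (by linarith [hr.1])]
          exact mul_le_mul (by linarith [hr.2]) hSv (norm_nonneg _) (by positivity)
        have h7 := hRle _ ml
        have h8 := hRle _ hr
        linarith
      have h1 : u (r₀ - s) + (r - (r₀ - s)) • S - u r = ((s ^ 2 - (r - r₀) ^ 2) / 2) • A + Y := by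
        rw [hue (r₀ - s), hue r, hY]
        module
      have hgr : ‖g r‖ ≤ ‖g r₀‖ + e := by
        have := norm_add_le (g r - g r₀) (g r₀)
        rw [sub_add_cancel] at this
        linarith [(hnear r hr).2.1]
      have i1 : inner ℝ (g r) Y ≤ (‖g r₀‖ + e) * (4 * e * s ^ 2) :=
        (real_inner_le_norm _ _).trans
          (mul_le_mul hgr hYle (norm_nonneg _) (by positivity))
      have i2 : (inner ℝ (g r) A : ℝ) ≤ inner ℝ (g r₀) A + e * ‖A‖ := by
        have h4 : (inner ℝ (g r) A : ℝ) = inner ℝ (g r₀) A + inner ℝ (g r - g r₀) A := by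
          rw [inner_sub_left]
          ring
        rw [h4]
        have := (real_inner_le_norm (g r - g r₀) A).trans
          (mul_le_mul_of_nonneg_right (hnear r hr).2.1.le (norm_nonneg _))
        linarith
      have i3 := mul_le_mul_of_nonneg_left i2
        (show 0 ≤ (s ^ 2 - (r - r₀) ^ 2) / 2 by linarith)
      have i4 : (s ^ 2 - (r - r₀) ^ 2) / 2 * (e * ‖A‖) ≤ s ^ 2 / 2 * (e * ‖A‖) :=
        mul_le_mul_of_nonneg_right (by linarith [sq_nonneg (r - r₀)]) (by positivity)
      rw [h1, inner_add_right, real_inner_smul_right]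
      linarith
    have hle : r₀ - s ≤ r₀ + s := by linarith
    have hsub : Icc (r₀ - s) (r₀ + s) ⊆ Ioo a b := fun r hr => (hnear r hr).2.2
    have hvc : ContinuousOn v (Icc (r₀ - s) (r₀ + s)) := hv.mono hsub
    have hgc : ContinuousOn g (Icc (r₀ - s) (r₀ + s)) := hg.mono hsub
    have huc : ContinuousOn u (Icc (r₀ - s) (r₀ + s)) := fun r hr =>
      (hu r (hsub hr)).continuousAt.continuousWithinAt
    have hi1 : IntervalIntegrable (fun r => ‖v r - S‖ ^ 2) volume (r₀ - s) (r₀ + s) := by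
      refine ContinuousOn.intervalIntegrable_of_Icc hle ?_
      fun_prop
    have hi2 : IntervalIntegrable
        (fun r => (inner ℝ (g r) (u (r₀ - s) + (r - (r₀ - s)) • S - u r) : ℝ)) volume
        (r₀ - s) (r₀ + s) := by
      refine ContinuousOn.intervalIntegrable_of_Icc hle ?_
      fun_prop
    have j1 := intervalIntegral.integral_mono_on hle
      (Continuous.intervalIntegrable (by fun_prop) _ _) hi1 hlow
    have j2 := intervalIntegral.integral_mono_on hle hi2
      (Continuous.intervalIntegrable (by fun_prop) _ _) hup
    rw [integral_mul_sub_sq_add] at j1 j2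
    have j3 := hineq (r₀ - s) (r₀ + s) (hsub ml).1 (by linarith) (hsub mR).2
    have hs3 : 0 < s ^ 3 := by positivity
    refine le_of_mul_le_mul_left ?_ hs3
    nlinarith
  by_contra hlt
  rw [not_le] at hlt
  have hlim : Tendsto (fun e : ℝ => e * (9 * ‖A‖ + 8 * (‖g r₀‖ + e))) (𝓝[>] 0) (𝓝 0) := by
    have h1 : Continuous fun e : ℝ => e * (9 * ‖A‖ + 8 * (‖g r₀‖ + e)) := by fun_prop
    simpa using (h1.tendsto 0).mono_left nhdsWithin_le_nhds
  have h1 := ge_of_tendsto hlim (eventually_nhdsWithin_of_forall fun e he => key e he)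
  linarith

end Regularity

/-! ### Regularity of a minimizer inside a potential zone -/

section ZoneRegularity

variable {d : ℕ} {K : Set (Euc d)} {h H k : ℝ → ℝ} {u w : ℝ → Euc d} {α β ε c e : ℝ} {p : Euc d}

/-- A function of class `C¹` on `[0, ∞)` extends to a function of class `C¹` on `ℝ`. -/
theorem exists_hasDerivAt_extension (hh : ContDiffOn ℝ 1 h (Ici 0)) :
    ∃ H k : ℝ → ℝ, Continuous k ∧ (∀ s, HasDerivAt H (k s) s) ∧ EqOn H h (Ici 0) ∧
      EqOn k (derivWithin h (Ici 0)) (Ici 0) := by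
  have hder : ContinuousOn (derivWithin h (Ici 0)) (Ici 0) :=
    hh.continuousOn_derivWithin (uniqueDiffOn_Ici 0) le_rfl
  set k : ℝ → ℝ := fun s => derivWithin h (Ici 0) (max s 0) with hk
  have hkc : Continuous k :=
    hder.comp_continuous (by fun_prop) fun s => mem_Ici.2 (le_max_right _ _)
  have hkeq : EqOn k (derivWithin h (Ici 0)) (Ici 0) := fun s hs => by
    simp only [hk, max_eq_left (mem_Ici.1 hs)]
  refine ⟨fun s => h 0 + ∫ r in (0 : ℝ)..s, k r, k, hkc, fun s =>
    (hkc.integral_hasStrictDerivAt 0 s).hasDerivAt.const_add _, fun s hs => ?_, hkeq⟩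
  have hs' : (0 : ℝ) ≤ s := hs
  have h1 : ∫ r in (0 : ℝ)..s, k r = h s - h 0 := by
    refine intervalIntegral.integral_eq_sub_of_hasDeriv_right ?_ (fun x hx => ?_)
      (hkc.intervalIntegrable _ _)
    · rw [uIcc_of_le hs']
      exact hh.continuousOn.mono Icc_subset_Ici_self
    · rw [min_eq_left hs'] at hx
      have hx0 : x ∈ Ici (0 : ℝ) := hx.1.le
      rw [hkeq hx0]
      have hd := (hh.differentiableOn one_ne_zero x hx0).hasDerivWithinAt
      exact hd.mono fun y hy => mem_Ici.2 (hx.1.le.trans (le_of_lt hy))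
  simp only [h1]
  ring

theorem mem_hullZone_of_etaMap_eq (hK : K.Finite) (hne : K.Nonempty) (hce : c < e)
    (hu : ContinuousOn u (Icc c e)) (hp : ∀ t ∈ Ioo c e, etaMap K (u t) = p) :
    ∀ t ∈ Icc c e, u t ∈ hullZone K p := by
  have h1 : MapsTo u (Ioo c e) (hullZone K p) := fun t ht => by
    rw [← hp t ht]
    exact mem_hullZone_etaMap hK hne _
  have h2 := h1.closure_of_continuousOn (by rwa [closure_Ioo hce.ne])
  rwa [closure_Ioo hce.ne, (isClosed_hullZone hK hne p).closure_eq] at h2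

theorem continuousOn_deformed_potential (hH : Continuous H) {y : ℝ → Euc d} {s : Set ℝ}
    (hu : ContinuousOn u s) (hy : ContinuousOn y s) (p : Euc d) (l : ℝ) :
    ContinuousOn (fun t => H (‖u t + l • y t - p‖ ^ 2)) s := by
  fun_prop

theorem continuousOn_deformed_gradient (hk : Continuous k) {y : ℝ → Euc d} {s : Set ℝ}
    (hu : ContinuousOn u s) (hy : ContinuousOn y s) (p : Euc d) :
    ContinuousOn (fun z : ℝ × ℝ => (2 * inner ℝ (k (‖u z.2 + z.1 • y z.2 - p‖ ^ 2) •
      (u z.2 + z.1 • y z.2 - p)) (y z.2) : ℝ)) (Icc (-1) 1 ×ˢ s) := by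
  have h1 : ContinuousOn (fun z : ℝ × ℝ => u z.2) (Icc (-1) 1 ×ˢ s) :=
    hu.comp continuousOn_snd fun z hz => hz.2
  have h2 : ContinuousOn (fun z : ℝ × ℝ => y z.2) (Icc (-1) 1 ×ˢ s) :=
    hy.comp continuousOn_snd fun z hz => hz.2
  fun_prop

theorem hasDerivAt_deformed_potential (hH : ∀ s, HasDerivAt H (k s) s) (x y p : Euc d) (l : ℝ) :
    HasDerivAt (fun l : ℝ => H (‖x + l • y - p‖ ^ 2))
      (2 * inner ℝ (k (‖x + l • y - p‖ ^ 2) • (x + l • y - p)) y) l := by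
  have h1 : HasDerivAt (fun l : ℝ => x + l • y - p) ((1 : ℝ) • y) l :=
    (((hasDerivAt_id l).smul_const y).const_add x).sub_const p
  rw [one_smul] at h1
  refine ((hH _).comp l h1.norm_sq).congr_deriv ?_
  rw [real_inner_smul_left]
  ring

/-- The derivative of the potential energy when a curve is deformed in the direction `y`. -/
theorem hasDerivAt_integral_potential (hk : Continuous k) (hH : ∀ s, HasDerivAt H (k s) s)
    (hce : c ≤ e) {y : ℝ → Euc d} (hu : ContinuousOn u (Icc c e)) (hy : ContinuousOn y (Icc c e))
    (p : Euc d) :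
    HasDerivAt (fun l : ℝ => ∫ t in c..e, H (‖u t + l • y t - p‖ ^ 2))
      (∫ t in c..e, 2 * inner ℝ (k (‖u t - p‖ ^ 2) • (u t - p)) (y t)) 0 := by
  have hHc : Continuous H := continuous_iff_continuousAt.2 fun s => (hH s).continuousAt
  obtain ⟨C, hC⟩ := (isCompact_Icc.prod isCompact_Icc).exists_bound_of_continuousOn
    (continuousOn_deformed_gradient hk hu hy p)
  have hint : ∀ l : ℝ, IntervalIntegrable (fun t => H (‖u t + l • y t - p‖ ^ 2)) volume c e :=
    fun l => ContinuousOn.intervalIntegrable_of_Icc hce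
      (continuousOn_deformed_potential hHc hu hy p l)
  have hint' : IntervalIntegrable (fun t =>
      (2 * inner ℝ (k (‖u t + (0 : ℝ) • y t - p‖ ^ 2) • (u t + (0 : ℝ) • y t - p)) (y t) : ℝ))
      volume c e := by
    refine ContinuousOn.intervalIntegrable_of_Icc hce ?_
    fun_prop
  have hbd : ∀ᵐ t : ℝ, t ∈ uIoc c e → ∀ l ∈ Icc (-1 : ℝ) 1,
      ‖(2 * inner ℝ (k (‖u t + l • y t - p‖ ^ 2) • (u t + l • y t - p)) (y t) : ℝ)‖ ≤ C := by
    refine ae_of_all _ fun t ht l hl => ?_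
    rw [uIoc_of_le hce] at ht
    exact hC (l, t) ⟨hl, Ioc_subset_Icc_self ht⟩
  have key := (intervalIntegral.hasDerivAt_integral_of_dominated_loc_of_deriv_le
    (F := fun l t => H (‖u t + l • y t - p‖ ^ 2))
    (F' := fun l t => 2 * inner ℝ (k (‖u t + l • y t - p‖ ^ 2) • (u t + l • y t - p)) (y t))
    (Icc_mem_nhds (show (-1 : ℝ) < 0 by norm_num) (show (0 : ℝ) < 1 by norm_num))
    (Eventually.of_forall fun l => (hint l).aestronglyMeasurable_restrict_uIoc) (hint 0)
    hint'.aestronglyMeasurable_restrict_uIoc hbd intervalIntegrable_const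
    (ae_of_all _ fun t _ l _ => hasDerivAt_deformed_potential hH (u t) (y t) p l)).2
  simpa only [zero_smul, add_zero] using key

/-- First variation towards chords: while `η` keeps the value `p`, the curve can be deformed towards
its chords, which remain in the convex set `hullZone K p`. -/
theorem IsLocMin.chord_inequality (hK : K.Finite) (hne : K.Nonempty)
    (h0 : ∀ s ∈ Ici (0 : ℝ), 0 ≤ H s) (hmono : MonotoneOn H (Ici 0)) (hk : Continuous k)
    (hH : ∀ s, HasDerivAt H (k s) s) (hmin : IsLocMin (etaPotential K H) u w α β ε)
    (hc : α ≤ c) (hce : c < e) (he : e ≤ β) (hp : ∀ t ∈ Ioo c e, etaMap K (u t) = p) :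
    ∫ t in c..e, ‖w t - slope u c e‖ ^ 2 ≤
      ∫ t in c..e, inner ℝ (k (‖u t - p‖ ^ 2) • (u t - p))
        (u c + (t - c) • slope u c e - u t) := by
  have hF := isPotential_etaPotential hK hne h0 hmono
  have hHc : Continuous H := continuous_iff_continuousAt.2 fun s => (hH s).continuousAt
  have hpos : 0 < e - c := sub_pos.2 hce
  have hu : IsH1 u w c e := hmin.isH1.mono ⟨hc, hce.le.trans he⟩ ⟨hc.trans hce.le, he⟩
  set S := slope u c e with hS
  have hSe : u e - u c = (e - c) • S := by
    rw [hS, slope_def_module, smul_smul, mul_inv_cancel₀ hpos.ne', one_smul]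
  set y : ℝ → Euc d := fun t => u c + (t - c) • S - u t with hy
  have hlineH1 := IsH1.line (u c) S c e c
  have hyc : ContinuousOn y (Icc c e) := hlineH1.continuousOn.sub hu.continuousOn
  have hzone := mem_hullZone_of_etaMap_eq hK hne hce hu.continuousOn hp
  have hder := hasDerivAt_integral_potential (k := k) hk hH hce.le hu.continuousOn hyc p
  set Φ : ℝ → ℝ := fun l => ∫ t in c..e, H (‖u t + l • y t - p‖ ^ 2) with hΦ
  set Q := ∫ t in c..e, ‖w t - S‖ ^ 2 with hQ
  obtain ⟨D, hD⟩ := isCompact_Icc.exists_bound_of_continuousOn hyc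
  have hD0 : 0 ≤ D := (norm_nonneg _).trans (hD c ⟨le_rfl, hce.le⟩)
  have hQe := (hu.integral_norm_sub_sq hce.le hSe).2
  have hΦ0 : ∫ t in c..e, etaPotential K H (u t) = Φ 0 := by
    simp only [hΦ, zero_smul, add_zero]
    rw [intervalIntegral.integral_of_le hce.le, intervalIntegral.integral_of_le hce.le,
      ← restrict_Ioo_eq_restrict_Ioc]
    refine setIntegral_congr_fun measurableSet_Ioo fun t ht => ?_
    simp only [etaPotential, hp t ht]
  have hineq : ∀ l : ℝ, 0 < l → l < 1 → l * D < ε → (2 - l) * Q ≤ (Φ l - Φ 0) / l := by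
    intro l hl hl1 hlD
    have hσ := hu.combo hlineH1 l
    have hcost := hmin.cost_le c e hc hce.le he _ _ hσ (by simp)
      (by simp only [← hSe]; rw [show u c + (u e - u c) - u e = 0 by abel, smul_zero, add_zero])
      (fun t ht => by
        rw [add_sub_cancel_left, norm_smul, Real.norm_of_nonneg hl.le]
        exact (mul_le_mul_of_nonneg_left (hD t ht) hl.le).trans_lt hlD)
    have h1 := (hσ.integral_norm_sub_sq hce.le (v := S) (by
      rw [← hSe]
      simp only [sub_self, zero_smul, add_zero, smul_zero]
      rw [show u c + (u e - u c) - u e = 0 by abel, smul_zero, add_zero])).2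
    have h2 : ∫ t in c..e, ‖w t + l • (S - w t) - S‖ ^ 2 = (1 - l) ^ 2 * Q := by
      rw [hQ, ← intervalIntegral.integral_const_mul]
      congr 1
      ext t
      rw [show w t + l • (S - w t) - S = (1 - l) • (w t - S) by module, norm_smul, mul_pow,
        Real.norm_eq_abs, sq_abs]
    have h3 : ∫ t in c..e, etaPotential K H (u t + l • y t) ≤ Φ l := by
      have hconv := convex_hullZone hK hne p
      have hle : ∀ t ∈ Icc c e,
          etaPotential K H (u t + l • y t) ≤ H (‖u t + l • y t - p‖ ^ 2) := by
        intro t ht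
        have hchord : u c + (t - c) • S ∈ hullZone K p := by
          have h4 := hconv.add_smul_sub_mem (hzone c ⟨le_rfl, hce.le⟩) (hzone e ⟨hce.le, le_rfl⟩)
            (t := (t - c) / (e - c)) ⟨div_nonneg (by linarith [ht.1]) hpos.le,
              (div_le_one hpos).2 (by linarith [ht.2])⟩
          rwa [hSe, smul_smul, div_mul_cancel₀ _ hpos.ne'] at h4
        have hz : u t + l • y t ∈ hullZone K p :=
          hconv.add_smul_sub_mem (hzone t ht) hchord ⟨hl.le, hl1.le⟩
        exact etaPotential_le_of_mem_hullZone hK hne hmono hz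
      have hi1 : IntervalIntegrable (fun t => etaPotential K H (u t + l • y t)) volume c e :=
        hF.intervalIntegrable hce.le hσ.continuousOn
      have hi2 : IntervalIntegrable (fun t => H (‖u t + l • y t - p‖ ^ 2)) volume c e :=
        ContinuousOn.intervalIntegrable_of_Icc hce.le
          (continuousOn_deformed_potential hHc hu.continuousOn hyc p l)
      exact intervalIntegral.integral_mono_on hce.le hi1 hi2 hle
    rw [cost, cost, hΦ0] at hcost
    rw [le_div_iff₀ hl]
    rw [h2] at h1
    have h4 : (2 - l) * Q * l = Q - (1 - l) ^ 2 * Q := by ring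
    rw [h4]
    linarith
  have hlim : Tendsto (fun l : ℝ => (Φ l - Φ 0) / l) (𝓝[>] 0)
      (𝓝 (∫ t in c..e, 2 * inner ℝ (k (‖u t - p‖ ^ 2) • (u t - p)) (y t))) := by
    have h1 := (hasDerivAt_iff_tendsto_slope.1 hder).mono_left
      (nhdsWithin_mono 0 (show Ioi (0 : ℝ) ⊆ {0}ᶜ from fun l hl => ne_of_gt hl))
    refine h1.congr fun l => ?_
    rw [slope_def_field, sub_zero]
  have hlim' : Tendsto (fun l : ℝ => (2 - l) * Q) (𝓝[>] 0) (𝓝 (2 * Q)) := by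
    have h1 : Continuous fun l : ℝ => (2 - l) * Q := by fun_prop
    simpa using (h1.tendsto 0).mono_left nhdsWithin_le_nhds
  have hle := le_of_tendsto_of_tendsto hlim' hlim (by
    have hev : ∀ᶠ l in 𝓝[>] (0 : ℝ), l * D < ε := by
      have h1 : Continuous fun l : ℝ => l * D := by fun_prop
      have h2 := (h1.tendsto 0).mono_left (nhdsWithin_le_nhds (s := Ioi 0))
      rw [zero_mul] at h2
      exact h2.eventually (gt_mem_nhds hmin.eps_pos)
    filter_upwards [hev, Ioo_mem_nhdsGT (show (0 : ℝ) < 1 by norm_num)] with l h1 h2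
    exact hineq l h2.1 h2.2 h1)
  rw [intervalIntegral.integral_const_mul] at hle
  linarith

/-- Inside a potential zone a minimizer is of class `C^{1,1}`, with acceleration bounded by the
gradient of half the potential. -/
theorem IsLocMin.isC11On_of_etaMap_eq (hK : K.Finite) (hne : K.Nonempty)
    (h0 : ∀ s ∈ Ici (0 : ℝ), 0 ≤ H s) (hmono : MonotoneOn H (Ici 0)) (hk : Continuous k)
    (hk0 : ∀ s ∈ Ici (0 : ℝ), 0 ≤ k s)
    (hH : ∀ s, HasDerivAt H (k s) s) (hmin : IsLocMin (etaPotential K H) u w α β ε)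
    (hc : α ≤ c) (hce : c < e) (he : e ≤ β) (hp : ∀ t ∈ Ioo c e, etaMap K (u t) = p) :
    IsC11On u c e ∧ ∀ᵐ r ∂(volume.restrict (Ioo c e)), ∃ A : Euc d,
      HasDerivAt (deriv u) A r ∧ ‖A‖ ≤ k (‖u r - p‖ ^ 2) * ‖u r - p‖ := by
  have hu : IsH1 u w c e := hmin.isH1.mono ⟨hc, hce.le.trans he⟩ ⟨hc.trans hce.le, he⟩
  set g : ℝ → Euc d := fun t => k (‖u t - p‖ ^ 2) • (u t - p) with hg
  have hupc : ContinuousOn (fun t => u t - p) (Icc c e) := hu.continuousOn.sub continuousOn_const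
  have hgc : ContinuousOn g (Icc c e) := (hk.comp_continuousOn (hupc.norm.pow 2)).smul hupc
  have hvar : ∀ c' e', c ≤ c' → c' < e' → e' ≤ e → ∫ t in c'..e', ‖w t - slope u c' e'‖ ^ 2 ≤
      ∫ t in c'..e', inner ℝ (g t) (u c' + (t - c') • slope u c' e' - u t) :=
    fun c' e' h1 h2 h3 => hmin.chord_inequality hK hne h0 hmono hk hH (hc.trans h1) h2
      (h3.trans he) fun t ht => hp t ⟨h1.trans_lt ht.1, ht.2.trans_le h3⟩
  obtain ⟨G, hG⟩ := isCompact_Icc.exists_bound_of_continuousOn hgc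
  have hG0 : 0 ≤ G := (norm_nonneg _).trans (hG c ⟨le_rfl, hce.le⟩)
  have hC11 : IsC11On u c e := by
    refine isC11On_of_chord_bound (M := G) hce fun c' e' h1 h2 h3 r hr => ?_
    have hpos : 0 < e' - c' := sub_pos.2 h2
    have hu' : IsH1 u w c' e' := hu.mono ⟨h1, h2.le.trans h3⟩ ⟨h1.trans h2.le, h3⟩
    have hSe : u e' - u c' = (e' - c') • slope u c' e' := by
      rw [slope_def_module, smul_smul, mul_inv_cancel₀ hpos.ne', one_smul]
    set Q := ∫ t in c'..e', ‖w t - slope u c' e'‖ ^ 2 with hQ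
    have hQ0 : 0 ≤ Q := intervalIntegral.integral_nonneg h2.le fun _ _ => sq_nonneg _
    set m := √((e' - c') * Q) with hm
    have hm0 : 0 ≤ m := Real.sqrt_nonneg _
    have hmsq : m ^ 2 = (e' - c') * Q := Real.sq_sqrt (by positivity)
    have hdev : ∀ t ∈ Icc c' e', ‖u t - (u c' + (t - c') • slope u c' e')‖ ≤ m := fun t ht =>
      Real.le_sqrt_of_sq_le (hu'.norm_deviation_sq_le h2.le hSe ht)
    have hQle : Q ≤ (e' - c') * (G * m) := by
      refine (hvar c' e' h1 h2 h3).trans ?_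
      have hi : IntervalIntegrable
          (fun t => (inner ℝ (g t) (u c' + (t - c') • slope u c' e' - u t) : ℝ)) volume c' e' := by
        refine ContinuousOn.intervalIntegrable_of_Icc h2.le ?_
        exact (hgc.mono (Icc_subset_Icc h1 h3)).inner
          ((IsH1.line (u c') _ c' e' c').continuousOn.sub hu'.continuousOn)
      have h4 := intervalIntegral.integral_mono_on h2.le hi
        (intervalIntegrable_const (c := G * m)) fun t ht => by
          refine (real_inner_le_norm _ _).trans (mul_le_mul (hG t ⟨h1.trans ht.1, ht.2.trans h3⟩)
            ?_ (norm_nonneg _) hG0)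
          rw [norm_sub_rev]
          exact hdev t ht
      rwa [intervalIntegral.integral_const, smul_eq_mul] at h4
    have hmle : m ≤ G * (e' - c') ^ 2 := by
      rcases hm0.eq_or_lt with hzero | hmpos
      · rw [← hzero]
        positivity
      · have h4 : m * m ≤ m * (G * (e' - c') ^ 2) := by
          have := mul_le_mul_of_nonneg_left hQle hpos.le
          nlinarith
        exact le_of_mul_le_mul_left h4 hmpos
    exact (hdev r hr).trans hmle
  refine ⟨hC11, ?_⟩
  obtain ⟨v, hv, L, hL⟩ := hC11
  have hv' : ∀ r ∈ Ioo c e, HasDerivAt u (v r) r := fun r hr =>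
    (hv r (Ioo_subset_Icc_self hr)).hasDerivAt (Icc_mem_nhds hr.1 hr.2)
  have hwv : ∀ᵐ t, t ∈ Ioo c e → w t = v t := by
    filter_upwards [hu.ae_hasDerivAt hce.le] with t ht hmem
    exact (ht hmem).unique (hv' t hmem)
  have hvar' : ∀ c' e', c < c' → c' < e' → e' < e → ∫ t in c'..e', ‖v t - slope u c' e'‖ ^ 2 ≤
      ∫ t in c'..e', inner ℝ (g t) (u c' + (t - c') • slope u c' e' - u t) := by
    intro c' e' h1 h2 h3
    refine (le_of_eq ?_).trans (hvar c' e' h1.le h2 h3.le)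
    refine intervalIntegral.integral_congr_ae ?_
    filter_upwards [hwv] with t ht hmem
    rw [uIoc_of_le h2.le] at hmem
    rw [ht ⟨h1.trans hmem.1, hmem.2.trans_lt h3⟩]
  rw [ae_restrict_iff' measurableSet_Ioo]
  filter_upwards [hL.ae_differentiableWithinAt_of_mem (μ := volume)] with r hr hmem
  have hd : DifferentiableAt ℝ v r :=
    (hr (Ioo_subset_Icc_self hmem)).differentiableAt (Icc_mem_nhds hmem.1 hmem.2)
  have hderiv : deriv u =ᶠ[𝓝 r] v := by
    filter_upwards [Ioo_mem_nhds hmem.1 hmem.2] with t ht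
    exact (hv' t ht).deriv
  refine ⟨deriv v r, hd.hasDerivAt.congr_of_eventuallyEq hderiv, ?_⟩
  have hle := norm_sq_le_inner_of_chord_inequality hmem hv'
    (hL.continuousOn.mono Ioo_subset_Icc_self) (hgc.mono Ioo_subset_Icc_self) hd.hasDerivAt hvar'
  have hle' : ‖deriv v r‖ * ‖deriv v r‖ ≤ ‖g r‖ * ‖deriv v r‖ := by
    rw [← sq]
    exact hle.trans (real_inner_le_norm _ _)
  have hgr : ‖g r‖ = k (‖u r - p‖ ^ 2) * ‖u r - p‖ := by
    simp only [hg]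
    rw [norm_smul, Real.norm_of_nonneg (hk0 _ (mem_Ici.2 (sq_nonneg _)))]
  rw [← hgr]
  rcases (norm_nonneg (deriv v r)).eq_or_lt with hzero | hpos
  · rw [← hzero]
    exact norm_nonneg _
  · exact le_of_mul_le_mul_right hle' hpos

end ZoneRegularity

/-! ### Finiteness of the shock times -/

section Shocks

variable {d : ℕ} {K : Set (Euc d)}

theorem notMem_nondegenerateShocks_iff {δ : ℝ} {γ : C(Icc (0 : ℝ) δ, Euc d)} {t : Icc (0 : ℝ) δ} :
    t ∉ nondegenerateShocks K γ ↔ ∃ p, ∀ᶠ s in 𝓝 t, etaMap K (γ s) = p := by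
  constructor
  · intro ht
    have h1 : ∃ I ∈ 𝓝 t, ∃ c, ∀ s ∈ I, etaMap K (γ s) = c := by
      by_contra hcon
      push Not at hcon
      exact ht fun I hI ⟨c, hc⟩ => by
        obtain ⟨s, hs, hne⟩ := hcon I hI c
        exact hne (hc s hs)
    obtain ⟨I, hI, c, hc⟩ := h1
    exact ⟨c, mem_of_superset hI hc⟩
  · rintro ⟨p, hp⟩ ht
    exact ht _ hp ⟨p, fun s hs => hs⟩

/-- The map `η ∘ γ` is constant on connected sets without shock times. -/
theorem etaMap_eq_of_isPreconnected {δ : ℝ} {γ : C(Icc (0 : ℝ) δ, Euc d)}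
    {S : Set (Icc (0 : ℝ) δ)} (hS : IsPreconnected S) (hsub : S ⊆ (nondegenerateShocks K γ)ᶜ)
    {s r : Icc (0 : ℝ) δ} (hs : s ∈ S) (hr : r ∈ S) : etaMap K (γ r) = etaMap K (γ s) := by
  refine hS.induction₂ (fun x y => etaMap K (γ x) = etaMap K (γ y)) (fun x hx => ?_)
    (fun x y z _ _ _ h1 h2 => h1.trans h2) (fun x y _ _ h => h.symm) hr hs
  obtain ⟨p, hp⟩ := notMem_nondegenerateShocks_iff.1 (hsub hx)
  filter_upwards [nhdsWithin_le_nhds hp] with y hy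
  rw [hy, hp.self_of_nhds]

theorem etaMap_eq_of_isPreconnected_real {δ : ℝ} (hδ : 0 ≤ δ) {γ : C(Icc (0 : ℝ) δ, Euc d)}
    {S : Set ℝ} (hS : IsPreconnected S)
    (hsub : ∀ t ∈ S, projIcc 0 δ hδ t ∉ nondegenerateShocks K γ)
    {s r : ℝ} (hs : s ∈ S) (hr : r ∈ S) :
    etaMap K (IccExtend hδ γ r) = etaMap K (IccExtend hδ γ s) :=
  etaMap_eq_of_isPreconnected (hS.image _ continuous_projIcc.continuousOn)
    (by rintro _ ⟨t, ht, rfl⟩; exact hsub t ht) (mem_image_of_mem _ hs) (mem_image_of_mem _ hr)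

theorem notMem_nondegenerateShocks_of_eventually {δ : ℝ} (hδ : 0 ≤ δ)
    {γ : C(Icc (0 : ℝ) δ, Euc d)} {t : Icc (0 : ℝ) δ} {p : Euc d}
    (h : ∀ᶠ s in 𝓝 (t : ℝ), etaMap K (IccExtend hδ γ s) = p) : t ∉ nondegenerateShocks K γ := by
  rw [notMem_nondegenerateShocks_iff]
  refine ⟨p, ?_⟩
  filter_upwards [(continuous_subtype_val.tendsto t).eventually h] with s hs
  rwa [IccExtend_of_mem _ _ s.2] at hs

/-- Shock times are isolated, hence finite in number. -/
theorem finite_nondegenerateShocks (hK : K.Finite) (hne : K.Nonempty) {h : ℝ → ℝ}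
    (h0 : ∀ s ∈ Ici (0 : ℝ), 0 ≤ h s) (hc : ContinuousOn h (Ici 0)) (hm : StrictMonoOn h (Ici 0))
    {δ ε : ℝ} (hδ : 0 < δ) {γ : C(Icc (0 : ℝ) δ, Euc d)} {w : ℝ → Euc d}
    (hmin : IsLocMin (etaPotential K h) (IccExtend hδ.le γ) w 0 δ ε) :
    (nondegenerateShocks K γ).Finite := by
  have hright : ∀ t : Icc (0 : ℝ) δ, ∃ b : ℝ, (t : ℝ) < b ∧
      ∀ s ∈ nondegenerateShocks K γ, (s : ℝ) ∉ Ioo (t : ℝ) b := by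
    intro t
    rcases t.2.2.eq_or_lt with heq | hlt
    · refine ⟨t + 1, by linarith, fun s _ hs => ?_⟩
      linarith [s.2.2, hs.1]
    · obtain ⟨p, hp⟩ := hmin.exists_eventually_etaMap_eq hK hne h0 hc hm t.2.1 hlt
      obtain ⟨b, hb, hsub⟩ := mem_nhdsGT_iff_exists_Ioo_subset.1 hp
      exact ⟨b, hb, fun s hs hmem => notMem_nondegenerateShocks_of_eventually hδ.le (p := p)
        (mem_of_superset (Ioo_mem_nhds hmem.1 hmem.2) hsub) hs⟩
  have hleft : ∀ t : Icc (0 : ℝ) δ, ∃ b : ℝ, b < (t : ℝ) ∧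
      ∀ s ∈ nondegenerateShocks K γ, (s : ℝ) ∉ Ioo b (t : ℝ) := by
    intro t
    rcases t.2.1.eq_or_lt with heq | hlt
    · refine ⟨t - 1, by linarith, fun s _ hs => ?_⟩
      linarith [s.2.1, hs.2]
    · obtain ⟨p, hp⟩ := (hmin.comp_neg hδ.le).exists_eventually_etaMap_eq hK hne h0 hc hm
        (neg_le_neg t.2.2) (neg_lt_neg hlt)
      obtain ⟨b, hb, hsub⟩ := mem_nhdsGT_iff_exists_Ioo_subset.1 hp
      have hb' : -(t : ℝ) < b := hb
      refine ⟨-b, by linarith, fun s hs hmem => notMem_nondegenerateShocks_of_eventually hδ.le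
        (p := p) (mem_of_superset (Ioo_mem_nhds hmem.1 hmem.2) fun r hr => ?_) hs⟩
      have h1 := hsub (show -r ∈ Ioo (-(t : ℝ)) b from ⟨by linarith [hr.2], by linarith [hr.1]⟩)
      simpa using h1
  choose b hb hbs using hright
  choose c hc' hcs using hleft
  -- Each of the neighbourhoods `(c t, b t)` of `t` contains no shock time other than `t`.
  obtain ⟨T, -, hT⟩ := isCompact_univ.elim_nhds_subcover
    (fun t : Icc (0 : ℝ) δ => Subtype.val ⁻¹' Ioo (c t) (b t))
    fun t _ => continuous_subtype_val.continuousAt.preimage_mem_nhds (Ioo_mem_nhds (hc' t) (hb t))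
  refine T.finite_toSet.subset fun s hs => ?_
  obtain ⟨t, ht, hst⟩ := mem_iUnion₂.1 (hT (mem_univ s))
  have hst' : (s : ℝ) ∈ Ioo (c t) (b t) := hst
  rcases lt_trichotomy (s : ℝ) t with hlt | heq | hgt
  · exact absurd ⟨hst'.1, hlt⟩ (hcs t s hs)
  · rw [Subtype.ext heq]
    exact ht
  · exact absurd ⟨hgt, hst'.2⟩ (hbs t s hs)

/-- The increasing enumeration of a finite subset of `[a, b]`, completed by the endpoints. -/
theorem exists_enumeration {a b : ℝ} (hab : a ≤ b) (N : Finset ℝ) (hN : ∀ x ∈ N, x ∈ Icc a b) :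
    ∃ (l : ℕ) (t : ℕ → ℝ), t 0 = a ∧ t (l + 1) = b ∧ StrictMonoOn t (Icc 1 l) ∧
      (N : Set ℝ) = t '' Icc 1 l ∧
      ∀ i ≤ l, a ≤ t i ∧ t i ≤ t (i + 1) ∧ t (i + 1) ≤ b ∧ ∀ x ∈ Ioo (t i) (t (i + 1)), x ∉ N := by
  set l := N.card with hl
  set f := N.orderEmbOfFin hl.symm with hf
  set t : ℕ → ℝ := fun i => if i = 0 then a else if hi : i - 1 < l then f ⟨i - 1, hi⟩ else b with ht
  have t0 : t 0 = a := by simp [ht]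
  have tl : t (l + 1) = b := by simp [ht]
  have tf : ∀ (i : ℕ) (hi : i - 1 < l), 1 ≤ i → t i = f ⟨i - 1, hi⟩ := by
    intro i hi h1
    simp only [ht]
    rw [if_neg (by omega), dif_pos hi]
  have hmono : StrictMonoOn t (Icc 1 l) := by
    intro i hi j hj hij
    have hi1 := hi.1
    have hi2 := hi.2
    have hj2 := hj.2
    rw [tf i (by omega) hi.1, tf j (by omega) hj.1]
    refine f.strictMono ?_
    rw [Fin.mk_lt_mk]
    omega
  have himage : (N : Set ℝ) = t '' Icc 1 l := by
    rw [← N.range_orderEmbOfFin hl.symm]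
    ext x
    constructor
    · rintro ⟨i, rfl⟩
      have := i.2
      exact ⟨i + 1, ⟨by omega, by omega⟩, tf (i + 1) (by simp) (by omega)⟩
    · rintro ⟨i, hi, rfl⟩
      have hi1 := hi.1
      have hi2 := hi.2
      exact ⟨⟨i - 1, by omega⟩, (tf i (by omega) hi.1).symm⟩
  have hmem : ∀ i ∈ Icc 1 l, t i ∈ Icc a b := fun i hi => by
    refine hN _ ?_
    rw [← Finset.mem_coe, himage]
    exact mem_image_of_mem t hi
  have hmem' : ∀ i ≤ l + 1, t i ∈ Icc a b := by
    intro i hi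
    rcases Nat.eq_zero_or_pos i with rfl | hpos
    · rw [t0]
      exact ⟨le_rfl, hab⟩
    · rcases hi.eq_or_lt with rfl | hlt
      · rw [tl]
        exact ⟨hab, le_rfl⟩
      · exact hmem i ⟨hpos, by omega⟩
  refine ⟨l, t, t0, tl, hmono, himage, fun i hi => ⟨(hmem' i (by omega)).1, ?_,
    (hmem' (i + 1) (by omega)).2, fun x hx hxN => ?_⟩⟩
  · rcases Nat.eq_zero_or_pos i with rfl | hpos
    · rw [t0]
      exact (hmem' 1 (by omega)).1
    · rcases hi.eq_or_lt with heq | hlt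
      · rw [heq, tl]
        exact (hmem' l (by omega)).2
      · exact (hmono ⟨hpos, hi⟩ ⟨by omega, by omega⟩ (Nat.lt_succ_self i)).le
  · rw [← Finset.mem_coe, himage] at hxN
    obtain ⟨j, hj, rfl⟩ := hxN
    have hj1 := hj.1
    have hj2 := hj.2
    have h1 : i < j := by
      rcases Nat.eq_zero_or_pos i with rfl | hpos
      · exact hj.1
      · exact (hmono.lt_iff_lt ⟨hpos, hi⟩ hj).1 hx.1
    have h2 : j < i + 1 := (hmono.lt_iff_lt hj ⟨by omega, by omega⟩).1 hx.2
    omega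

/-- On a single point every vector is a derivative. -/
theorem isC11On_self (u : ℝ → Euc d) (a : ℝ) : IsC11On u a a := by
  refine ⟨fun _ => 0, fun r hr => ?_, 0, LipschitzOnWith.of_dist_le_mul (by simp)⟩
  rw [Icc_self] at hr ⊢
  rw [mem_singleton_iff] at hr
  subst hr
  simpa using (hasFDerivWithinAt_singleton (𝕜 := ℝ) u r).hasDerivWithinAt

end Shocks

theorem mainTheorem1 {d : ℕ} (K : Set (EuclideanSpace ℝ (Fin d))) (hKfin : K.Finite)
    (hKne : K.Nonempty) (h : ℝ → ℝ) (h_nonneg : ∀ s ∈ Ici (0 : ℝ), 0 ≤ h s)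
    (h_C1 : ContDiffOn ℝ 1 h (Ici 0)) (h_mono : StrictMonoOn h (Ici 0))
    {δ : ℝ} (hδ : 0 < δ) (x₀ x₁ : EuclideanSpace ℝ (Fin d))
    (γ : C(Icc (0 : ℝ) δ, EuclideanSpace ℝ (Fin d)))
    (hγ : IsLocalMinimizer h (oppSqDist K) hδ.le x₀ x₁ γ) :
    (nondegenerateShocks K γ).Finite ∧
    (∀ s ∈ (nondegenerateShocks K γ)ᶜ,
      ∀ r ∈ connectedComponentIn (nondegenerateShocks K γ)ᶜ s,
        etaMap K (γ r) = etaMap K (γ s)) ∧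
    ∃ (l : ℕ) (t : ℕ → ℝ), t 0 = 0 ∧ t (l + 1) = δ ∧ StrictMonoOn t (Icc 1 l) ∧
      (fun s : Icc (0 : ℝ) δ => (s : ℝ)) '' nondegenerateShocks K γ = t '' Icc 1 l ∧
      ∀ i ≤ l,
        IsC11On (IccExtend hδ.le γ) (t i) (t (i + 1)) ∧
        ∃ η ∈ range (etaMap K),
          (∀ r ∈ Ioo (t i) (t (i + 1)), IccExtend hδ.le γ r ∈ potentialZone K η) ∧
          ∀ᵐ r ∂(volume.restrict (Ioo (t i) (t (i + 1)))),
            ∃ a : EuclideanSpace ℝ (Fin d),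
              HasDerivAt (deriv (IccExtend hδ.le γ)) a r ∧
              ‖a‖ ≤ derivWithin h (Ici 0) (‖IccExtend hδ.le γ r - η‖ ^ 2) *
                ‖IccExtend hδ.le γ r - η‖ := by
  have hF := isPotential_etaPotential hKfin hKne h_nonneg h_mono.monotoneOn
  obtain ⟨ε, hmin⟩ := hγ.exists_isLocMin hKfin hKne hF hδ
  have hfin := finite_nondegenerateShocks hKfin hKne h_nonneg h_C1.continuousOn h_mono hδ hmin
  refine ⟨hfin, fun s hs r hr => etaMap_eq_of_isPreconnected isPreconnected_connectedComponentIn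
    (connectedComponentIn_subset _ _) (mem_connectedComponentIn hs) hr, ?_⟩
  -- The extension `H` of `h` is differentiable everywhere and defines the same potential.
  obtain ⟨H, k, hk, hH, hHh, hkh⟩ := exists_hasDerivAt_extension h_C1
  have hpot : etaPotential K h = etaPotential K H := by
    ext x
    exact (hHh (mem_Ici.2 (sq_nonneg _))).symm
  rw [hpot] at hmin
  have hHmono : MonotoneOn H (Ici 0) := h_mono.monotoneOn.congr hHh.symm
  have hH0 : ∀ s ∈ Ici (0 : ℝ), 0 ≤ H s := fun s hs => by
    rw [hHh hs]
    exact h_nonneg s hs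
  have hk0 : ∀ s ∈ Ici (0 : ℝ), 0 ≤ k s := fun s hs => by
    rw [hkh hs]
    exact h_mono.monotoneOn.derivWithin_nonneg
  obtain ⟨l, t, ht0, htl, htmono, htimage, ht⟩ := exists_enumeration hδ.le
    (hfin.image fun s : Icc (0 : ℝ) δ => (s : ℝ)).toFinset (by
      intro x hx
      obtain ⟨s, -, rfl⟩ := (hfin.image _).mem_toFinset.1 hx
      exact s.2)
  refine ⟨l, t, ht0, htl, htmono, by rw [← htimage, Finite.coe_toFinset], fun i hi => ?_⟩
  obtain ⟨h1, h2, h3, h4⟩ := ht i hi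
  rcases h2.eq_or_lt with heq | hlt
  · -- If `0` or `δ` is a shock time, the corresponding extreme interval is a point; any value of
    -- `etaMap` will do.
    rw [← heq, Ioo_self]
    exact ⟨isC11On_self _ _, _, mem_range_self 0, by simp, by simp⟩
  · obtain ⟨m, hm⟩ := exists_between hlt
    have hconst : ∀ r ∈ Ioo (t i) (t (i + 1)),
        etaMap K (IccExtend hδ.le γ r) = etaMap K (IccExtend hδ.le γ m) := by
      refine fun r hr => etaMap_eq_of_isPreconnected_real hδ.le isPreconnected_Ioo
        (fun x hx hbad => ?_) hm hr
      refine h4 x hx ((hfin.image _).mem_toFinset.2 ⟨_, hbad, ?_⟩)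
      rw [projIcc_of_mem hδ.le ⟨h1.trans hx.1.le, hx.2.le.trans h3⟩]
    obtain ⟨hC11, hacc⟩ :=
      hmin.isC11On_of_etaMap_eq hKfin hKne hH0 hHmono hk hk0 hH h1 hlt h3 hconst
    refine ⟨hC11, _, mem_range_self _, hconst, ?_⟩
    filter_upwards [hacc] with r hr
    rwa [hkh (mem_Ici.2 (sq_nonneg _))] at hr
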